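/- Let $n\ge 3$ and $[n]=\{1,\dots,n\}$. Let $G_{3,2}$ be the bipartite graph whose vertices are the $2$-element and the $3$-element subsets of $[n]$, a $2$-set $A$ and a $3$-set $B$ being adjacent if $A\subseteq B$. A set $D$ of vertices is dominating if every vertex outside $D$ has a neighbour in $D$. For a dominating set $D$, let $D_2$ and $D_3$ be the families of $2$-sets and of $3$-sets in $D$, and let $H(D)$ be the graph with vertex set $[n]$ in which distinct $x,y$ are adjacent if and only if $\{x,y\}\notin D_2$ and $\{x,y\}\subseteq X$ for some $X\in D_3$. For $1<s<n$ let $K^+_{s,n-s}$ be the graph on $[n]$ in which $\{1,\dots,s\}$ induces a matching of size $\lfloor s/2\rfloor$ (plus an isolated vertex if $s$ is odd), $\{s+1,\dots,n\}$ is an independent set, and every vertex of $\{1,\dots,s\}$ is adjacent to every vertex of $\{s+1,\dots,n\}$. Let $H_{5a}$ be the graph on five vertices obtained from a path on four vertices by adding a vertex adjacent to all of them, $H_{5b}$ the graph on five vertices obtained from a $4$-cycle by adding a vertex adjacent to all of them, and $H_9=K_3\,\square\,K_3$ the Cartesian product of two triangles. Let $D$ be a dominating set in $G_{3,2}$ with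 $|D|=\binom n2-\left\lfloor\frac{(n+1)^2}{8}\right\rfloor$, and let $H=H(D)$. 1. If $n\equiv 0\pmod 4$, then $H$ is isomorphic to $K^+_{n/2,n/2}$. 2. If $n\equiv 1\pmod 4$, then $H$ is isomorphic to one of $H_{5a}$, $H_{5b}$, $H_9$, or $K^+_{s,n-s}$ with $2s\in\{n-1,n+1,n+3\}$. 3. If $n\equiv 2\pmod 4$, then $H$ is isomorphic to $K^+_{(n+2)/2,(n-2)/2}$. 4. If $n\equiv 3\pmod 4$, then $H$ is isomorphic to $K^+_{(n+1)/2,(n-1)/2}$. Moreover, the minimum size of a dominating set in $G_{3,2}$ is $\binom n2-\left\lfloor\frac{(n+1)^2}{8}\right\rfloor$, and it is attained by a dominating set that is also an independent set of $G_{3,2}$. -/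

import Mathlib

open scoped FinsetFamily

namespace LayerDomination

/-- Vertices of `G_{l,k}`: the `k`-element and the `l`-element subsets of the `n`-element set
`Fin n`. -/
abbrev LayerVertex (n l k : ℕ) : Type :=
  {A : Finset (Fin n) // A.card = k ∨ A.card = l}

/-- The bipartite graph `G_{l,k}`: a `k`-set `A` and an `l`-set `B` are adjacent iff `A ⊆ B`. -/
def layerGraph (n l k : ℕ) : SimpleGraph (LayerVertex n l k) :=
  SimpleGraph.fromRel fun A B => A.1.card = k ∧ B.1.card = l ∧ A.1 ⊆ B.1

/-- Every vertex outside `D` has a neighbour in `D`. -/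
def IsDominating {V : Type*} (G : SimpleGraph V) (D : Finset V) : Prop :=
  ∀ v, v ∉ D → ∃ w ∈ D, G.Adj v w

/-- `D_i`: the family of the `i`-element sets in `D`. -/
def level {n : ℕ} (D : Finset (LayerVertex n 3 2)) (i : ℕ) : Finset (Finset (Fin n)) :=
  (D.map (Function.Embedding.subtype _)).filter fun A => A.card = i

/-- The graph `H(D)` on `Fin n`, with edge set `∂ D_3 \ D_2`, where `∂` is the shadow. -/
def assocGraph {n : ℕ} (D : Finset (LayerVertex n 3 2)) : SimpleGraph (Fin n) where
  Adj x y := x ≠ y ∧ ({x, y} : Finset (Fin n)) ∈ ∂ (level D 3) \ level D 2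
  symm := ⟨fun x y h => ⟨h.1.symm, by rw [Finset.pair_comm]; exact h.2⟩⟩
  loopless := ⟨fun _ h => h.1 rfl⟩

/-- The graph `K^+_{s,n-s}` on `{0, …, n-1}`: all edges between `{0, …, s-1}` and
`{s, …, n-1}`, no edges inside `{s, …, n-1}`, and the matching `{0,1}, {2,3}, …` of
size `⌊s/2⌋` inside `{0, …, s-1}`. -/
def kPlus (n s : ℕ) : SimpleGraph (Fin n) :=
  SimpleGraph.fromRel fun x y =>
    (x.1 < s ∧ s ≤ y.1) ∨ (x.1 < s ∧ y.1 < s ∧ x.1 / 2 = y.1 / 2)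

/-- Three triangles in a row: the path `0, 3, 4, 2` together with the vertex `1` joined to
all of its vertices. -/
def h5a : SimpleGraph (Fin 5) :=
  SimpleGraph.fromEdgeSet
    {s(0, 1), s(1, 2), s(2, 4), s(4, 3), s(3, 0), s(3, 1), s(1, 4)}

/-- The 4-cycle `0, 1, 2, 3` together with the vertex `4` joined to all of its vertices. -/
def h5b : SimpleGraph (Fin 5) :=
  SimpleGraph.fromEdgeSet
    {s(0, 1), s(1, 2), s(2, 3), s(3, 0), s(0, 4), s(4, 1), s(2, 4), s(4, 3)}

/-- The edge-disjoint union of the six triangles `014, 235, 678` and `126, 058, 347`, that is,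
the 3-by-3 rook's graph. -/
def h9 : SimpleGraph (Fin 9) :=
  SimpleGraph.fromEdgeSet
    {s(0, 1), s(1, 2), s(2, 3), s(3, 5), s(5, 2), s(2, 6), s(6, 1), s(1, 4), s(4, 0),
     s(0, 8), s(8, 7), s(7, 6), s(6, 8), s(8, 5), s(5, 0), s(3, 4), s(4, 7), s(7, 3)}

end LayerDomination

/-! For a dominating set `D` with graph `H`, the pairs missing from `D` are exactly the edges of
`H`, every triangle of `H` must belong to `D`, and each edge of `H` in no triangle ("bare") must be
covered by a further triple of `D`, which covers at most two of them. With e edges, e₀ bare edges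
and t triangles this gives C(n,2) - |D| ≤ e - t - e₀/2, and `excess` is twelve times the right side
(`le_excess_assocGraph`). Conversely, the non-edges and triangles of a graph without bare edges form
an independent dominating set with equality (`domSet`, `card_domSet`). It remains to maximise
`excess` over all graphs and to find the maximisers.

The bound comes from one identity, `excess_identity`. A pair x, y has slack n + cod(x,y) - deg x -
deg y ≥ 0, the number of vertices seeing neither; a triangle has an analogous slack, counting the
vertices that see none or all of its corners. Give a triangle the weight 2/(largest codegree on it)
and an edge the weight left over from its triangles. Then the weighted slacks, the squares (deg -
(n+1)/2)², a nonnegative loss per triangle and the bare edges add up to n(n+1)²/4 - n·excess/6, so e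
- t - e₀/2 ≤ (n+1)²/8. Equality (`IsTight`) forces two edges of each triangle to lie in no other
triangle, and makes certain slacks vanish. With no bare edges, either the graph is K⁺, or each edge
lies in exactly one triangle, which parity and degree sums exclude where this case is needed
(`IsTight.cases`). This settles n ≡ 0, 2 (where each square is at least 1/4) and n ≡ 3 modulo 4.

For n = 4k+1 rounding leaves room, and extremal graphs need not be tight. If a triangle has two
edges in further triangles, deleting the third edge keeps the graph extremal; by induction the
smaller graph is K⁺ or the rook's graph, and adding an edge to those strictly lowers `excess`. So
every triangle may be assumed to have at most one edge in several triangles (`IsGood`), and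
triangles fall into books around such "spine" edges and isolated triangles. Deleting a vertex,
duplicating a vertex, or joining two adjacent vertices to an independent set compares the graph with
the maximum for n-1, n+1 or n+2 vertices. Equality yields K⁺; otherwise the strict inequalities
recorded in `IsResidual` hold at every vertex. Counting spines, book triangles, isolated triangles
and bare edges against the sum of squared degree deviations excludes k ≥ 3 (`false_of_three_le`),
and for k = 2 leaves the rook's graph (`IsResidual.isRook`). The case n = 5 is a finite check
(`isMaxFive_search`). -/

namespace LayerDomination

/-! ### Codegrees, slacks and the weighted degree-sum identity -/

section Counting

variable {V : Type*} (G : SimpleGraph V)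

open Classical in
/-- The adjacency indicator. -/
noncomputable def adjInd (x y : V) : ℤ := if G.Adj x y then 1 else 0

variable {G}

lemma adjInd_of_adj {x y : V} (h : G.Adj x y) : adjInd G x y = 1 := by simp [adjInd, h]

lemma adjInd_of_not_adj {x y : V} (h : ¬ G.Adj x y) : adjInd G x y = 0 := by simp [adjInd, h]

lemma adjInd_eq_one_iff {x y : V} : adjInd G x y = 1 ↔ G.Adj x y := by
  by_cases h : G.Adj x y <;> simp [adjInd, h]

lemma adjInd_comm (x y : V) : adjInd G x y = adjInd G y x := by
  by_cases h : G.Adj x y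
  · rw [adjInd_of_adj h, adjInd_of_adj h.symm]
  · rw [adjInd_of_not_adj h, adjInd_of_not_adj fun h' => h h'.symm]

@[simp] lemma adjInd_self (x : V) : adjInd G x x = 0 := by simp [adjInd]

lemma adjInd_nonneg (x y : V) : 0 ≤ adjInd G x y := by
  by_cases h : G.Adj x y <;> simp [adjInd, h]

lemma adjInd_le_one (x y : V) : adjInd G x y ≤ 1 := by
  by_cases h : G.Adj x y <;> simp [adjInd, h]

lemma adjInd_mul_self (x y : V) : adjInd G x y * adjInd G x y = adjInd G x y := by
  by_cases h : G.Adj x y <;> simp [adjInd, h]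

variable (G) in
/-- The triangle indicator. -/
noncomputable def triInd (x y z : V) : ℚ := adjInd G x y * adjInd G y z * adjInd G x z

lemma triInd_rotate (x y z : V) : triInd G y z x = triInd G x y z := by
  simp only [triInd, adjInd_comm z x, adjInd_comm y x]; ring

variable [Fintype V]

variable (G) in
/-- The degree, as an integer. -/
noncomputable def deg (x : V) : ℤ := ∑ y, adjInd G x y

variable (G) in
/-- The number of common neighbours, as an integer. -/
noncomputable def cod (x y : V) : ℤ := ∑ z, adjInd G x z * adjInd G y z

variable (G) in
open Classical in
/-- The indicator of the edges that lie in no triangle. -/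
noncomputable def bareInd (x y : V) : ℤ := if G.Adj x y ∧ cod G x y = 0 then 1 else 0

variable (G) in
/-- Six times the number `2 e - e₀ - 2 t`, where `e`, `e₀` and `t` count the edges, the edges in no
triangle, and the triangles. -/
noncomputable def excess : ℤ :=
  6 * ∑ x, ∑ y, adjInd G x y - 3 * ∑ x, ∑ y, bareInd G x y -
    2 * ∑ x, ∑ y, adjInd G x y * cod G x y

lemma cod_comm (x y : V) : cod G x y = cod G y x := by
  simp [cod, mul_comm]

lemma cod_nonneg (x y : V) : 0 ≤ cod G x y :=
  Finset.sum_nonneg fun _ _ => mul_nonneg (adjInd_nonneg _ _) (adjInd_nonneg _ _)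

lemma cod_pos {x y z : V} (hxz : G.Adj x z) (hyz : G.Adj y z) : 1 ≤ cod G x y := by
  have := Finset.single_le_sum (f := fun z => adjInd G x z * adjInd G y z)
    (fun _ _ => mul_nonneg (adjInd_nonneg _ _) (adjInd_nonneg _ _)) (Finset.mem_univ z)
  simpa [cod, adjInd_of_adj hxz, adjInd_of_adj hyz] using this

lemma exists_of_cod_pos {x y : V} (h : cod G x y ≠ 0) : ∃ z, G.Adj x z ∧ G.Adj y z := by
  by_contra! hc
  apply h
  refine Finset.sum_eq_zero fun z _ => ?_
  by_cases hx : G.Adj x z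
  · rw [adjInd_of_not_adj (hc z hx), mul_zero]
  · rw [adjInd_of_not_adj hx, zero_mul]

lemma bareInd_comm (x y : V) : bareInd G x y = bareInd G y x := by
  have : (G.Adj x y ∧ cod G x y = 0) ↔ (G.Adj y x ∧ cod G y x = 0) := by
    rw [G.adj_comm, cod_comm]
  classical
  unfold bareInd
  exact if_congr this rfl rfl

lemma bareInd_nonneg (x y : V) : 0 ≤ bareInd G x y := by
  unfold bareInd; split_ifs <;> simp

lemma sum_rotate (f : V → V → V → ℚ) :
    ∑ x, ∑ y, ∑ z, f y z x = ∑ x, ∑ y, ∑ z, f x y z := by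
  rw [Finset.sum_comm]
  conv_rhs => rw [Finset.sum_congr rfl fun x _ => Finset.sum_congr rfl fun y _ => rfl]
  have : ∀ y, ∑ x, ∑ z, f y z x = ∑ z, ∑ x, f y z x := fun y => Finset.sum_comm
  simp only [this]

/-- The vertices that see neither `x` nor `y`. -/
lemma pair_slack_eq (x y : V) : (Fintype.card V : ℤ) + cod G x y - deg G x - deg G y =
    ∑ v, (1 - adjInd G x v) * (1 - adjInd G y v) := by
  simp only [cod, deg, Fintype.card_eq_sum_ones, Nat.cast_sum, Nat.cast_one]
  rw [← Finset.sum_add_distrib, ← Finset.sum_sub_distrib, ← Finset.sum_sub_distrib]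
  exact Finset.sum_congr rfl fun v _ => by ring

lemma pair_slack_nonneg (x y : V) :
    0 ≤ (Fintype.card V : ℤ) + cod G x y - deg G x - deg G y := by
  rw [pair_slack_eq]
  exact Finset.sum_nonneg fun v _ =>
    mul_nonneg (sub_nonneg.2 (adjInd_le_one _ _)) (sub_nonneg.2 (adjInd_le_one _ _))

/-- The vertices that see none or all of `x`, `y`, `z`. -/
lemma triple_slack_eq (x y z : V) :
    (Fintype.card V : ℤ) + (cod G x y + cod G y z + cod G x z) - (deg G x + deg G y + deg G z) =
    ∑ v, ((1 - adjInd G x v) * (1 - adjInd G y v) * (1 - adjInd G z v) +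
      adjInd G x v * adjInd G y v * adjInd G z v) := by
  simp only [cod, deg, Fintype.card_eq_sum_ones, Nat.cast_sum, Nat.cast_one]
  simp only [← Finset.sum_add_distrib, ← Finset.sum_sub_distrib]
  exact Finset.sum_congr rfl fun v _ => by ring

lemma triple_slack_nonneg (x y z : V) : 0 ≤ (Fintype.card V : ℤ) +
    (cod G x y + cod G y z + cod G x z) - (deg G x + deg G y + deg G z) := by
  rw [triple_slack_eq]
  refine Finset.sum_nonneg fun v _ => add_nonneg ?_ ?_
  · exact mul_nonneg (mul_nonneg (sub_nonneg.2 (adjInd_le_one _ _))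
      (sub_nonneg.2 (adjInd_le_one _ _))) (sub_nonneg.2 (adjInd_le_one _ _))
  · exact mul_nonneg (mul_nonneg (adjInd_nonneg _ _) (adjInd_nonneg _ _)) (adjInd_nonneg _ _)

variable (G) in
/-- The weight of a triangle. -/
noncomputable def triWeight (x y z : V) : ℚ :=
  2 / (max (max (cod G x y) (cod G y z)) (cod G x z) : ℤ)

variable (G) in
/-- The weight of a pair. -/
noncomputable def pairWeight (x y : V) : ℚ :=
  1 - (∑ z, (adjInd G x z * adjInd G y z : ℚ) * triWeight G x y z) / 2

variable (G) in
/-- The loss at a triangle, which vanishes if two of its edges are in no other triangle. -/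
noncomputable def triLoss (x y z : V) : ℚ :=
  triWeight G x y z * (Fintype.card V - (cod G x y + cod G y z + cod G x z)) / 2 -
    (Fintype.card V - 2) * (1 / cod G x y + 1 / cod G y z + 1 / cod G x z) +
    (2 * Fintype.card V - 3)

lemma triWeight_rotate (x y z : V) : triWeight G y z x = triWeight G x y z := by
  simp only [triWeight, cod_comm z x, cod_comm y x]
  rw [max_right_comm, max_comm (cod G y z), max_right_comm]

/-- Rotating the triangle moves the first edge to each of the three edges, so a quantity attached to
one edge may be averaged over all three. This turns edge weights into triangle sums. -/
lemma sum_triInd_mul (f : V → V → ℚ) (g : V → V → V → ℚ)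
    (hf : ∀ x y, f x y = f y x) (hg : ∀ x y z, g y z x = g x y z) :
    ∑ x, ∑ y, ∑ z, triInd G x y z * g x y z * f x y =
      (∑ x, ∑ y, ∑ z, triInd G x y z * g x y z * (f x y + f y z + f x z)) / 3 := by
  have h1 : ∑ x, ∑ y, ∑ z, triInd G x y z * g x y z * f y z =
      ∑ x, ∑ y, ∑ z, triInd G x y z * g x y z * f x y := by
    rw [← sum_rotate (fun x y z => triInd G x y z * g x y z * f x y)]
    simp only [triInd_rotate, hg]
  have h2 : ∑ x, ∑ y, ∑ z, triInd G x y z * g x y z * f x z =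
      ∑ x, ∑ y, ∑ z, triInd G x y z * g x y z * f x y := by
    rw [← sum_rotate (fun x y z => triInd G x y z * g x y z * f x z)]
    simp only [triInd_rotate, hg, hf]
  simp only [mul_add, Finset.sum_add_distrib, h1, h2]
  ring


lemma sum_adjInd_mul_cod : (∑ x, ∑ y, (adjInd G x y * cod G x y : ℚ)) =
    ∑ x, ∑ y, ∑ z, triInd G x y z := by
  refine Finset.sum_congr rfl fun x _ => Finset.sum_congr rfl fun y _ => ?_
  simp only [cod, triInd, Int.cast_sum, Int.cast_mul, Finset.mul_sum]
  exact Finset.sum_congr rfl fun z _ => by ring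

lemma sum_triInd_fst (f : V → V → ℚ) :
    ∑ x, ∑ y, ∑ z, triInd G x y z * f x y = ∑ x, ∑ y, (adjInd G x y * cod G x y : ℚ) * f x y := by
  refine Finset.sum_congr rfl fun x _ => Finset.sum_congr rfl fun y _ => ?_
  simp only [cod, triInd, Int.cast_sum, Int.cast_mul, Finset.mul_sum, Finset.sum_mul]
  exact Finset.sum_congr rfl fun z _ => by ring

/-- An edge receives 1/cod from each of its cod triangles, hence 1 in total if it lies in a triangle
and nothing if it is bare. -/
lemma sum_triInd_inv : ∑ x, ∑ y, ∑ z, triInd G x y z *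
    (1 / cod G x y + 1 / cod G y z + 1 / cod G x z : ℚ) =
    3 * ((∑ x, ∑ y, (adjInd G x y : ℚ)) - ∑ x, ∑ y, (bareInd G x y : ℚ)) := by
  have h := sum_triInd_mul (G := G) (fun x y => 1 / (cod G x y : ℚ)) (fun _ _ _ => 1)
    (fun x y => by rw [cod_comm]) (fun _ _ _ => rfl)
  simp only [mul_one] at h
  have h2 : ∑ x, ∑ y, ∑ z, triInd G x y z * (1 / cod G x y : ℚ) =
      (∑ x, ∑ y, (adjInd G x y : ℚ)) - ∑ x, ∑ y, (bareInd G x y : ℚ) := by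
    rw [sum_triInd_fst (G := G) (fun x y => 1 / (cod G x y : ℚ)), ← Finset.sum_sub_distrib]
    refine Finset.sum_congr rfl fun x _ => ?_
    rw [← Finset.sum_sub_distrib]
    refine Finset.sum_congr rfl fun y _ => ?_
    unfold bareInd
    by_cases ha : G.Adj x y <;> by_cases hc : cod G x y = 0
    · simp [ha, hc, adjInd_of_adj ha]
    · have : (cod G x y : ℚ) ≠ 0 := by exact_mod_cast hc
      simp [ha, hc, adjInd_of_adj ha]
    · simp [ha, adjInd_of_not_adj ha]
    · simp [ha, adjInd_of_not_adj ha]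
  linarith

lemma sum_deg : ∑ x, (deg G x : ℚ) = ∑ x, ∑ y, (adjInd G x y : ℚ) := by
  simp [deg]

/-- This is where the sum of squared degrees enters; together with the linear term it is later
completed to squares around (n+1)/2. -/
lemma sum_adjInd_mul_pair_slack :
    ∑ x, ∑ y, (adjInd G x y : ℚ) * (Fintype.card V + cod G x y - deg G x - deg G y) =
    Fintype.card V * (∑ x, ∑ y, (adjInd G x y : ℚ)) +
      (∑ x, ∑ y, (adjInd G x y * cod G x y : ℚ)) - 2 * ∑ x, (deg G x : ℚ) ^ 2 := by
  have h1 : ∑ x, ∑ y, (adjInd G x y * deg G x : ℚ) = ∑ x, (deg G x : ℚ) ^ 2 := by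
    refine Finset.sum_congr rfl fun x _ => ?_
    rw [← Finset.sum_mul, sq]
    congr 1
    simp [deg]
  have h2 : ∑ x, ∑ y, (adjInd G x y * deg G y : ℚ) = ∑ x, (deg G x : ℚ) ^ 2 := by
    rw [Finset.sum_comm, ← h1]
    simp only [adjInd_comm]
  simp only [mul_add, mul_sub, Finset.sum_add_distrib, Finset.sum_sub_distrib, h1, h2]
  simp only [← Finset.sum_mul]
  ring

/-- The weighted degree-sum identity. -/
lemma excess_identity :
    ∑ x, ((deg G x : ℚ) - (Fintype.card V + 1) / 2) ^ 2 +
      (∑ x, ∑ y, (adjInd G x y : ℚ) * (pairWeight G x y *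
        (Fintype.card V + cod G x y - deg G x - deg G y))) / 2 +
      (∑ x, ∑ y, ∑ z, triInd G x y z * (triWeight G x y z *
        (Fintype.card V + (cod G x y + cod G y z + cod G x z) -
          (deg G x + deg G y + deg G z)))) / 6 +
      (∑ x, ∑ y, ∑ z, triInd G x y z * triLoss G x y z) / 6 +
      ∑ x, ∑ y, (bareInd G x y : ℚ) =
    Fintype.card V * ((Fintype.card V + 1) / 2) ^ 2 - Fintype.card V * excess G / 6 := by
  set n : ℚ := (Fintype.card V : ℚ) with hn
  have e1 : ∑ x, ((deg G x : ℚ) - (n + 1) / 2) ^ 2 = ∑ x, (deg G x : ℚ) ^ 2 -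
      (n + 1) * (∑ x, ∑ y, (adjInd G x y : ℚ)) + n * ((n + 1) / 2) ^ 2 := by
    have : ∀ x, ((deg G x : ℚ) - (n + 1) / 2) ^ 2 =
      (deg G x : ℚ) ^ 2 - (n + 1) * deg G x + ((n + 1) / 2) ^ 2 := fun x => by ring
    simp only [this, Finset.sum_add_distrib, Finset.sum_sub_distrib, ← Finset.mul_sum, sum_deg]
    simp [hn]
  have e2 : ∑ x, ∑ y, (adjInd G x y : ℚ) * (pairWeight G x y *
        (n + cod G x y - deg G x - deg G y)) =
      ∑ x, ∑ y, (adjInd G x y : ℚ) * (n + cod G x y - deg G x - deg G y) -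
      (∑ x, ∑ y, ∑ z, triInd G x y z * triWeight G x y z *
        (n + cod G x y - deg G x - deg G y)) / 2 := by
    rw [Finset.sum_div, ← Finset.sum_sub_distrib]
    refine Finset.sum_congr rfl fun x _ => ?_
    rw [Finset.sum_div, ← Finset.sum_sub_distrib]
    refine Finset.sum_congr rfl fun y _ => ?_
    have : ∑ z, triInd G x y z * triWeight G x y z * (n + cod G x y - deg G x - deg G y) =
      adjInd G x y * (∑ z, (adjInd G x z * adjInd G y z : ℚ) * triWeight G x y z) *
        (n + cod G x y - deg G x - deg G y) := by
      rw [Finset.mul_sum, Finset.sum_mul]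
      refine Finset.sum_congr rfl fun z _ => ?_
      unfold triInd; ring
    rw [this, pairWeight]; ring
  have e3 := sum_triInd_mul (G := G) (fun x y => n + cod G x y - deg G x - deg G y)
    (triWeight G) (fun x y => by rw [cod_comm]; ring) triWeight_rotate
  have e4 := sum_adjInd_mul_pair_slack (G := G)
  have e5 := sum_triInd_inv (G := G)
  have e6 := sum_adjInd_mul_cod (G := G)
  -- The sum of the three pair slacks of a triangle minus twice its triple slack is n minus the sum
  -- of its codegrees: all degrees cancel. Hence the loss depends on codegrees only.
  have e7 : (∑ x, ∑ y, ∑ z, triInd G x y z * triLoss G x y z) =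
      (∑ x, ∑ y, ∑ z, triInd G x y z * triWeight G x y z * (2 * (n + cod G x y - deg G x - deg G y
        + (n + cod G y z - deg G y - deg G z) + (n + cod G x z - deg G x - deg G z)) / 2
        - (n + (cod G x y + cod G y z + cod G x z) - (deg G x + deg G y + deg G z)) * 2 ) / 2)
      - (n - 2) * (∑ x, ∑ y, ∑ z, triInd G x y z *
          (1 / cod G x y + 1 / cod G y z + 1 / cod G x z : ℚ)) +
      (2 * n - 3) * (∑ x, ∑ y, ∑ z, triInd G x y z) := by
    simp only [Finset.mul_sum, ← Finset.sum_sub_distrib, ← Finset.sum_add_distrib]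
    refine Finset.sum_congr rfl fun x _ => Finset.sum_congr rfl fun y _ =>
      Finset.sum_congr rfl fun z _ => ?_
    unfold triLoss; rw [← hn]; ring
  have e8 : (∑ x, ∑ y, ∑ z, triInd G x y z * triWeight G x y z *
      (2 * (n + cod G x y - deg G x - deg G y
        + (n + cod G y z - deg G y - deg G z) + (n + cod G x z - deg G x - deg G z)) / 2
        - (n + (cod G x y + cod G y z + cod G x z) - (deg G x + deg G y + deg G z)) * 2 ) / 2) =
      (∑ x, ∑ y, ∑ z, triInd G x y z * triWeight G x y z * (n + cod G x y - deg G x - deg G y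
        + (n + cod G y z - deg G y - deg G z) + (n + cod G x z - deg G x - deg G z))) / 2
      - ∑ x, ∑ y, ∑ z, triInd G x y z * (triWeight G x y z *
        (n + (cod G x y + cod G y z + cod G x z) - (deg G x + deg G y + deg G z))) := by
    simp only [Finset.sum_div, ← Finset.sum_sub_distrib]
    refine Finset.sum_congr rfl fun x _ => Finset.sum_congr rfl fun y _ =>
      Finset.sum_congr rfl fun z _ => ?_
    ring
  have e9 : (excess G : ℚ) = 6 * (∑ x, ∑ y, (adjInd G x y : ℚ)) -
      3 * (∑ x, ∑ y, (bareInd G x y : ℚ)) - 2 * ∑ x, ∑ y, (adjInd G x y * cod G x y : ℚ) := by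
    simp [excess]
  rw [← hn] at e4
  rw [e1, e2, e3, e4, e7, e8, e5, ← e6, e9]
  ring

end Counting
end LayerDomination

namespace LayerDomination

/-! ### Nonnegativity of the terms and the consequences of equality -/

section Bound

/-- Here `p` plays the largest codegree of a triangle. For p ≥ q, r ≥ 1 and N ≥ 3 the right side is
visibly a sum of nonnegative terms. -/
lemma loss_eq {N p q r : ℚ} (hp : p ≠ 0) (hq : q ≠ 0) (hr : r ≠ 0) :
    2 / p * (N - (p + q + r)) / 2 - (N - 2) * (1 / p + 1 / q + 1 / r) + (2 * N - 3) =
      (N - 3) * ((q - 1) / q + (r - 1) / r) +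
        ((q - 1) * (p - q) / (p * q) + (r - 1) * (p - r) / (p * r)) := by
  field_simp; ring

lemma loss_nonneg {N p q r : ℚ} (hN : 3 ≤ N) (hq : 1 ≤ q) (hr : 1 ≤ r) (hqp : q ≤ p)
    (hrp : r ≤ p) :
    (N - 3) * ((q - 1) / q + (r - 1) / r) ≤
    2 / p * (N - (p + q + r)) / 2 - (N - 2) * (1 / p + 1 / q + 1 / r) + (2 * N - 3) ∧
    0 ≤ (N - 3) * ((q - 1) / q + (r - 1) / r) := by
  rw [loss_eq (by linarith) (by linarith) (by linarith)]
  have h1 : 0 ≤ (q - 1) / q := div_nonneg (by linarith) (by linarith)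
  have h2 : 0 ≤ (r - 1) / r := div_nonneg (by linarith) (by linarith)
  have h3 : 0 ≤ (q - 1) * (p - q) / (p * q) :=
    div_nonneg (mul_nonneg (by linarith) (by linarith)) (mul_nonneg (by linarith) (by linarith))
  have h4 : 0 ≤ (r - 1) * (p - r) / (p * r) :=
    div_nonneg (mul_nonneg (by linarith) (by linarith)) (mul_nonneg (by linarith) (by linarith))
  exact ⟨by linarith, mul_nonneg (by linarith) (by linarith)⟩

/-- The factor N - 3 has to be positive, which is why four vertices are required in `IsTight.good`.
-/
lemma loss_eq_zero {N p q r : ℚ} (hN : 3 < N) (hq : 1 ≤ q) (hr : 1 ≤ r) (hqp : q ≤ p)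
    (hrp : r ≤ p)
    (h : 2 / p * (N - (p + q + r)) / 2 - (N - 2) * (1 / p + 1 / q + 1 / r) + (2 * N - 3) = 0) :
    q = 1 ∧ r = 1 := by
  obtain ⟨h1, h2⟩ := loss_nonneg hN.le hq hr hqp hrp
  have h3 : (N - 3) * ((q - 1) / q + (r - 1) / r) = 0 := le_antisymm (h1.trans h.le) h2
  have h4 : (q - 1) / q + (r - 1) / r = 0 :=
    (mul_eq_zero.1 h3).resolve_left (by linarith)
  have h5 : 0 ≤ (q - 1) / q := div_nonneg (by linarith) (by linarith)
  have h6 : 0 ≤ (r - 1) / r := div_nonneg (by linarith) (by linarith)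
  have h7 : (q - 1) / q = 0 := by linarith
  have h8 : (r - 1) / r = 0 := by linarith
  rw [div_eq_zero_iff] at h7 h8
  constructor
  · rcases h7 with h | h <;> linarith
  · rcases h8 with h | h <;> linarith

set_option linter.unusedSectionVars false

variable {V : Type*} [Fintype V] {G : SimpleGraph V}

variable (G) in
/-- The ordered triple spans a triangle. -/
def IsTri (x y z : V) : Prop := G.Adj x y ∧ G.Adj y z ∧ G.Adj x z

lemma IsTri.rotate {x y z : V} (h : IsTri G x y z) : IsTri G y z x :=
  ⟨h.2.1, h.2.2.symm, h.1.symm⟩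

lemma IsTri.swap {x y z : V} (h : IsTri G x y z) : IsTri G y x z :=
  ⟨h.1.symm, h.2.2, h.2.1⟩

lemma IsTri.cod_pos {x y z : V} (h : IsTri G x y z) : 1 ≤ cod G x y :=
  LayerDomination.cod_pos h.2.2 h.2.1

lemma triInd_of_isTri {x y z : V} (h : IsTri G x y z) : triInd G x y z = 1 := by
  simp [triInd, adjInd_of_adj h.1, adjInd_of_adj h.2.1, adjInd_of_adj h.2.2]

lemma triInd_of_not_isTri {x y z : V} (h : ¬ IsTri G x y z) : triInd G x y z = 0 := by
  unfold triInd
  by_cases h1 : G.Adj x y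
  · by_cases h2 : G.Adj y z
    · have h3 : ¬ G.Adj x z := fun h3 => h ⟨h1, h2, h3⟩
      simp [adjInd_of_not_adj h3]
    · simp [adjInd_of_not_adj h2]
  · simp [adjInd_of_not_adj h1]

lemma IsTri.three_le_card {x y z : V} (h : IsTri G x y z) : 3 ≤ Fintype.card V := by
  classical
  have : ({x, y, z} : Finset V).card = 3 := by
    rw [Finset.card_eq_three]
    exact ⟨x, y, z, h.1.ne, h.2.2.ne, h.2.1.ne, rfl⟩
  rw [← this]
  exact Finset.card_le_univ _

lemma triLoss_rotate (x y z : V) : triLoss G y z x = triLoss G x y z := by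
  simp only [triLoss, triWeight_rotate, cod_comm z x, cod_comm y x]
  ring

/-- Every triangle can be rotated so that its first edge has the largest codegree. -/
lemma triLoss_cases {x y z : V} (P : V → V → V → Prop) (hP : ∀ x y z, P y z x → P x y z)
    (h : IsTri G x y z)
    (hmax : ∀ x y z, IsTri G x y z → cod G y z ≤ cod G x y → cod G x z ≤ cod G x y → P x y z) :
    P x y z := by
  by_cases h1 : cod G y z ≤ cod G x y
  · by_cases h2 : cod G x z ≤ cod G x y
    · exact hmax x y z h h1 h2
    · apply hP; apply hP
      refine hmax z x y h.rotate.rotate ?_ ?_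
      · rw [cod_comm z x]; omega
      · rw [cod_comm z x, cod_comm z y]; omega
  · by_cases h2 : cod G x z ≤ cod G y z
    · apply hP
      refine hmax y z x h.rotate ?_ ?_
      · rw [cod_comm z x]; omega
      · rw [cod_comm y x]; omega
    · apply hP; apply hP
      refine hmax z x y h.rotate.rotate ?_ ?_
      · rw [cod_comm z x]; omega
      · rw [cod_comm z x, cod_comm z y]; omega

lemma triLoss_of_max {x y z : V} (h1 : cod G y z ≤ cod G x y) (h2 : cod G x z ≤ cod G x y) :
    triLoss G x y z = 2 / (cod G x y : ℚ) *
      (Fintype.card V - (cod G x y + cod G y z + cod G x z)) / 2 -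
      (Fintype.card V - 2) * (1 / cod G x y + 1 / cod G y z + 1 / cod G x z) +
      (2 * Fintype.card V - 3) := by
  unfold triLoss triWeight
  rw [max_eq_left h1, max_eq_left h2]

lemma triLoss_nonneg {x y z : V} (h : IsTri G x y z) : 0 ≤ triLoss G x y z := by
  refine triLoss_cases (fun x y z => 0 ≤ triLoss G x y z)
    (fun x y z h => by rwa [triLoss_rotate] at h) h ?_
  intro x y z h h1 h2
  rw [triLoss_of_max h1 h2]
  have hN : (3 : ℚ) ≤ Fintype.card V := by exact_mod_cast h.three_le_card
  have hq : (1 : ℚ) ≤ cod G y z := by exact_mod_cast h.rotate.cod_pos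
  have hr : (1 : ℚ) ≤ cod G x z := by
    have := h.rotate.rotate.cod_pos
    rw [cod_comm] at this; exact_mod_cast this
  obtain ⟨h3, h4⟩ := loss_nonneg hN hq hr (p := cod G x y) (by exact_mod_cast h1)
    (by exact_mod_cast h2)
  exact h4.trans h3

/-- At least two of the edges of the triangle are in no other triangle. -/
def IsGoodTri (G : SimpleGraph V) (x y z : V) : Prop :=
  (cod G y z = 1 ∧ cod G x z = 1) ∨ (cod G x y = 1 ∧ cod G x z = 1) ∨
    (cod G x y = 1 ∧ cod G y z = 1)

lemma isGoodTri_of_triLoss {x y z : V} (h : IsTri G x y z) (hN : 4 ≤ Fintype.card V)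
    (h0 : triLoss G x y z = 0) : IsGoodTri G x y z := by
  refine triLoss_cases (fun x y z => triLoss G x y z = 0 → IsGoodTri G x y z)
    (fun x y z h h0 => ?_) h ?_ h0
  · have := h (by rwa [triLoss_rotate])
    simp only [IsGoodTri, cod_comm z x, cod_comm y x] at this ⊢
    tauto
  intro x y z h h1 h2 h0
  rw [triLoss_of_max h1 h2] at h0
  have hN : (3 : ℚ) < Fintype.card V := by exact_mod_cast hN
  have hq : (1 : ℚ) ≤ cod G y z := by exact_mod_cast h.rotate.cod_pos
  have hr : (1 : ℚ) ≤ cod G x z := by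
    have := h.rotate.rotate.cod_pos
    rw [cod_comm] at this; exact_mod_cast this
  obtain ⟨h3, h4⟩ := loss_eq_zero hN hq hr (p := cod G x y) (by exact_mod_cast h1)
    (by exact_mod_cast h2) h0
  exact Or.inl ⟨by exact_mod_cast h3, by exact_mod_cast h4⟩

lemma triWeight_pos {x y z : V} (h : IsTri G x y z) : 0 < triWeight G x y z := by
  unfold triWeight
  have : 0 < max (max (cod G x y) (cod G y z)) (cod G x z) :=
    lt_max_of_lt_left (lt_max_of_lt_left (by have := h.cod_pos; omega))
  have : (0 : ℚ) < (max (max (cod G x y) (cod G y z)) (cod G x z) : ℤ) := by exact_mod_cast this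
  positivity

lemma triWeight_le {x y z : V} (h : IsTri G x y z) : triWeight G x y z ≤ 2 / cod G x y := by
  unfold triWeight
  have h1 : cod G x y ≤ max (max (cod G x y) (cod G y z)) (cod G x z) :=
    le_max_of_le_left (le_max_left _ _)
  have h2 : (0 : ℚ) < cod G x y := by exact_mod_cast h.cod_pos
  exact div_le_div_of_nonneg_left (by norm_num) h2 (by exact_mod_cast h1)

/-- Each of the cod triangles on the edge has weight at most 2/cod, so half of their total weight is
at most 1. This dictates the maximum in `triWeight`. -/
lemma pairWeight_nonneg {x y : V} (h : G.Adj x y) : 0 ≤ pairWeight G x y := by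
  unfold pairWeight
  have h1 : ∑ z, (adjInd G x z * adjInd G y z : ℚ) * triWeight G x y z ≤
      ∑ z, (adjInd G x z * adjInd G y z : ℚ) * (2 / cod G x y) := by
    refine Finset.sum_le_sum fun z _ => ?_
    by_cases hx : G.Adj x z
    · by_cases hy : G.Adj y z
      · have := triWeight_le ⟨h, hy, hx⟩
        simpa [adjInd_of_adj hx, adjInd_of_adj hy] using this
      · simp [adjInd_of_not_adj hy]
    · simp [adjInd_of_not_adj hx]
  have h2 : ∑ z, (adjInd G x z * adjInd G y z : ℚ) * (2 / cod G x y) ≤ 2 := by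
    rw [← Finset.sum_mul]
    have : ∑ z, (adjInd G x z * adjInd G y z : ℚ) = cod G x y := by simp [cod]
    rw [this]
    by_cases h0 : (cod G x y : ℚ) = 0
    · simp [h0]
    · rw [mul_div_cancel₀ _ h0]
  linarith

/-- An edge that lies in a single triangle, with third vertex `z`. -/
lemma pairWeight_of_cod_eq_one {x y z : V} (h : IsTri G x y z) (h1 : cod G x y = 1) :
    pairWeight G x y = 1 - triWeight G x y z / 2 := by
  unfold pairWeight
  congr 2
  rw [Finset.sum_eq_single z]
  · simp [adjInd_of_adj h.2.1, adjInd_of_adj h.2.2]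
  · intro w _ hw
    by_cases hx : G.Adj x w
    · by_cases hy : G.Adj y w
      · exfalso
        have := Finset.add_le_sum (f := fun z => adjInd G x z * adjInd G y z)
          (s := Finset.univ) (fun _ _ => mul_nonneg (adjInd_nonneg _ _) (adjInd_nonneg _ _))
          (Finset.mem_univ z) (Finset.mem_univ w) hw.symm
        simp only [adjInd_of_adj hx, adjInd_of_adj hy, adjInd_of_adj h.2.1,
          adjInd_of_adj h.2.2] at this
        have h2 : cod G x y = ∑ z, adjInd G x z * adjInd G y z := rfl
        omega
      · simp [adjInd_of_not_adj hy]
    · simp [adjInd_of_not_adj hx]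
  · simp

variable (G) in
/-- Twice the number of edges in no triangle. -/
noncomputable def bareSum : ℤ := ∑ x, ∑ y, bareInd G x y

/-- All slacks in the degree-sum inequality vanish. -/
structure IsTight (G : SimpleGraph V) : Prop where
  good : 4 ≤ Fintype.card V → ∀ x y z, IsTri G x y z → IsGoodTri G x y z
  triple : ∀ x y z, IsTri G x y z → deg G x + deg G y + deg G z =
    Fintype.card V + (cod G x y + cod G y z + cod G x z)
  pair : ∀ x y z, IsTri G x y z → cod G x z = 1 → 2 ≤ cod G x y →
    deg G x + deg G z = Fintype.card V + 1

/-- Twelve times `excess_identity`, which clears all denominators, with the nonnegative slack and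
loss sums dropped. In case of equality these sums vanish, hence term by term. -/
theorem excess_le_and_isTight :
    3 * ∑ x, (2 * deg G x - (Fintype.card V + 1)) ^ 2 + 12 * bareSum G +
      2 * Fintype.card V * excess G ≤ 3 * Fintype.card V * (Fintype.card V + 1) ^ 2 ∧
    (3 * ∑ x, (2 * deg G x - (Fintype.card V + 1)) ^ 2 + 12 * bareSum G +
      2 * Fintype.card V * excess G = 3 * Fintype.card V * (Fintype.card V + 1) ^ 2 →
      IsTight G) := by
  have key := excess_identity (G := G)
  set A := ∑ x, ∑ y, (adjInd G x y : ℚ) * (pairWeight G x y *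
        (Fintype.card V + cod G x y - deg G x - deg G y)) with hA
  set B := ∑ x, ∑ y, ∑ z, triInd G x y z * (triWeight G x y z *
        (Fintype.card V + (cod G x y + cod G y z + cod G x z) -
          (deg G x + deg G y + deg G z))) with hB
  set C := ∑ x, ∑ y, ∑ z, triInd G x y z * triLoss G x y z with hC
  have hA0 : ∀ x y, 0 ≤ (adjInd G x y : ℚ) * (pairWeight G x y *
        (Fintype.card V + cod G x y - deg G x - deg G y)) := by
    intro x y
    by_cases h : G.Adj x y
    · rw [adjInd_of_adj h, Int.cast_one, one_mul]
      refine mul_nonneg (pairWeight_nonneg h) ?_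
      exact_mod_cast pair_slack_nonneg (G := G) x y
    · simp [adjInd_of_not_adj h]
  have hB0 : ∀ x y z, 0 ≤ triInd G x y z * (triWeight G x y z *
        (Fintype.card V + (cod G x y + cod G y z + cod G x z) -
          (deg G x + deg G y + deg G z))) := by
    intro x y z
    by_cases h : IsTri G x y z
    · rw [triInd_of_isTri h, one_mul]
      refine mul_nonneg (triWeight_pos h).le ?_
      exact_mod_cast triple_slack_nonneg (G := G) x y z
    · simp [triInd_of_not_isTri h]
  have hC0 : ∀ x y z, 0 ≤ triInd G x y z * triLoss G x y z := by
    intro x y z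
    by_cases h : IsTri G x y z
    · rw [triInd_of_isTri h, one_mul]
      exact triLoss_nonneg h
    · simp [triInd_of_not_isTri h]
  have hA1 : 0 ≤ A := Finset.sum_nonneg fun x _ => Finset.sum_nonneg fun y _ => hA0 x y
  have hB1 : 0 ≤ B := Finset.sum_nonneg fun x _ => Finset.sum_nonneg fun y _ =>
    Finset.sum_nonneg fun z _ => hB0 x y z
  have hC1 : 0 ≤ C := Finset.sum_nonneg fun x _ => Finset.sum_nonneg fun y _ =>
    Finset.sum_nonneg fun z _ => hC0 x y z
  have hZ : (∑ x, ∑ y, (bareInd G x y : ℚ)) = (bareSum G : ℚ) := by simp [bareSum]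
  have hD : ∑ x, ((deg G x : ℚ) - (Fintype.card V + 1) / 2) ^ 2 =
      ((∑ x, (2 * deg G x - (Fintype.card V + 1)) ^ 2 : ℤ) : ℚ) / 4 := by
    push_cast
    rw [Finset.sum_div]
    exact Finset.sum_congr rfl fun x _ => by ring
  rw [hZ, hD] at key
  set Q := ∑ x, (2 * deg G x - (Fintype.card V + 1)) ^ 2
  have key2 : (3 * Q + 12 * bareSum G + 2 * Fintype.card V * excess G : ℚ) +
      (6 * A + 2 * B + 2 * C) = 3 * Fintype.card V * (Fintype.card V + 1) ^ 2 := by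
    linear_combination 12 * key
  constructor
  · have : (3 * Q + 12 * bareSum G + 2 * Fintype.card V * excess G : ℚ) ≤
      3 * Fintype.card V * (Fintype.card V + 1) ^ 2 := by linarith
    exact_mod_cast this
  intro heq
  have heq' : (3 * Q + 12 * bareSum G + 2 * Fintype.card V * excess G : ℚ) =
      3 * Fintype.card V * (Fintype.card V + 1) ^ 2 := by exact_mod_cast heq
  have hA2 : A = 0 := by linarith
  have hB2 : B = 0 := by linarith
  have hC2 : C = 0 := by linarith
  have hA3 : ∀ x y, (adjInd G x y : ℚ) * (pairWeight G x y *
        (Fintype.card V + cod G x y - deg G x - deg G y)) = 0 := by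
    intro x y
    have h1 := (Finset.sum_eq_zero_iff_of_nonneg fun x _ =>
      Finset.sum_nonneg fun y _ => hA0 x y).1 hA2 x (Finset.mem_univ x)
    exact (Finset.sum_eq_zero_iff_of_nonneg fun y _ => hA0 x y).1 h1 y (Finset.mem_univ y)
  have hB3 : ∀ x y z, triInd G x y z * (triWeight G x y z *
        (Fintype.card V + (cod G x y + cod G y z + cod G x z) -
          (deg G x + deg G y + deg G z))) = 0 := by
    intro x y z
    have h1 := (Finset.sum_eq_zero_iff_of_nonneg fun x _ => Finset.sum_nonneg fun y _ =>
      Finset.sum_nonneg fun z _ => hB0 x y z).1 hB2 x (Finset.mem_univ x)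
    have h2 := (Finset.sum_eq_zero_iff_of_nonneg fun y _ =>
      Finset.sum_nonneg fun z _ => hB0 x y z).1 h1 y (Finset.mem_univ y)
    exact (Finset.sum_eq_zero_iff_of_nonneg fun z _ => hB0 x y z).1 h2 z (Finset.mem_univ z)
  have hC3 : ∀ x y z, triInd G x y z * triLoss G x y z = 0 := by
    intro x y z
    have h1 := (Finset.sum_eq_zero_iff_of_nonneg fun x _ => Finset.sum_nonneg fun y _ =>
      Finset.sum_nonneg fun z _ => hC0 x y z).1 hC2 x (Finset.mem_univ x)
    have h2 := (Finset.sum_eq_zero_iff_of_nonneg fun y _ =>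
      Finset.sum_nonneg fun z _ => hC0 x y z).1 h1 y (Finset.mem_univ y)
    exact (Finset.sum_eq_zero_iff_of_nonneg fun z _ => hC0 x y z).1 h2 z (Finset.mem_univ z)
  refine ⟨?_, ?_, ?_⟩
  · intro hN x y z h
    have := hC3 x y z
    rw [triInd_of_isTri h, one_mul] at this
    exact isGoodTri_of_triLoss h hN this
  · intro x y z h
    have := hB3 x y z
    rw [triInd_of_isTri h, one_mul] at this
    have := (mul_eq_zero.1 this).resolve_left (triWeight_pos h).ne'
    have h2 : ((Fintype.card V + (cod G x y + cod G y z + cod G x z) -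
          (deg G x + deg G y + deg G z) : ℤ) : ℚ) = 0 := by exact_mod_cast this
    have := Int.cast_eq_zero.1 h2
    omega
  · intro x y z h h1 h2
    have h' : IsTri G x z y := ⟨h.2.2, h.2.1.symm, h.1⟩
    have := hA3 x z
    rw [adjInd_of_adj h.2.2, Int.cast_one, one_mul] at this
    -- The edge `x z` lies in this triangle only, whose weight is at most 2 / cod x y ≤ 1; so at
    -- least half of the weight of the edge is left.
    have h3 : pairWeight G x z ≠ 0 := by
      rw [pairWeight_of_cod_eq_one h' h1]
      have h4 : triWeight G x z y ≤ 1 := by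
        rw [← triWeight_rotate, ← triWeight_rotate]
        refine (triWeight_le h'.rotate.rotate).trans ?_
        rw [cod_comm, div_le_one (by have : (0:ℤ) < cod G x y := by omega
                                     exact_mod_cast this)]
        exact_mod_cast h2
      linarith
    have := (mul_eq_zero.1 this).resolve_left h3
    have h5 : ((Fintype.card V + cod G x z - deg G x - deg G z : ℤ) : ℚ) = 0 := by
      exact_mod_cast this
    have := Int.cast_eq_zero.1 h5
    omega

end Bound
end LayerDomination

namespace LayerDomination

/-! ### Parity tools and the structure of tight graphs -/

section Tight

set_option linter.unusedSectionVars false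

variable {V : Type*} [Fintype V] {G : SimpleGraph V}

/-- Swapping the arguments cancels the off-diagonal terms in pairs modulo 2. Most of the parity
facts below come from here. -/
lemma even_sum_symm (f : V → V → ℤ) (hs : ∀ x y, f x y = f y x) (hd : ∀ x, f x x = 0) :
    Even (∑ x, ∑ y, f x y) := by
  rw [even_iff_two_dvd]
  have h : ((∑ x, ∑ y, f x y : ℤ) : ZMod 2) = 0 := by
    push_cast
    rw [← Fintype.sum_prod_type' (fun x y => ((f x y : ℤ) : ZMod 2))]
    refine Finset.sum_involution (fun p _ => p.swap) ?_ ?_ ?_ ?_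
    · rintro ⟨x, y⟩ _
      simp only [Prod.swap_prod_mk, hs y x]
      exact CharTwo.add_self_eq_zero _
    · rintro ⟨x, y⟩ _ hne heq
      apply hne
      simp only [Prod.swap_prod_mk, Prod.mk.injEq] at heq
      simp [heq.1, hd]
    · simp
    · simp
  exact (ZMod.intCast_zmod_eq_zero_iff_dvd _ 2).1 h

open Classical in
lemma deg_eq_card (x : V) : deg G x = (Finset.univ.filter fun y => G.Adj x y).card := by
  simp only [deg, adjInd, Finset.card_filter]
  push_cast
  rfl

open Classical in
lemma cod_eq_card (x y : V) :
    cod G x y = (Finset.univ.filter fun z => G.Adj x z ∧ G.Adj y z).card := by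
  simp only [cod, Finset.card_filter]
  push_cast
  refine Finset.sum_congr rfl fun z _ => ?_
  by_cases h1 : G.Adj x z <;> by_cases h2 : G.Adj y z <;> simp [adjInd, h1, h2]

lemma two_le_cod {x y z w : V} (h1 : G.Adj x z) (h2 : G.Adj y z) (h3 : G.Adj x w)
    (h4 : G.Adj y w) (hne : z ≠ w) : 2 ≤ cod G x y := by
  classical
  have := Finset.add_le_sum (f := fun z => adjInd G x z * adjInd G y z)
    (s := Finset.univ) (fun _ _ => mul_nonneg (adjInd_nonneg _ _) (adjInd_nonneg _ _))
    (Finset.mem_univ z) (Finset.mem_univ w) hne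
  simpa [adjInd_of_adj h1, adjInd_of_adj h2, adjInd_of_adj h3, adjInd_of_adj h4, cod] using this

lemma eq_of_cod_eq_one {x y z w : V} (h : cod G x y = 1) (h1 : G.Adj x z) (h2 : G.Adj y z)
    (h3 : G.Adj x w) (h4 : G.Adj y w) : z = w := by
  by_contra hne
  have := two_le_cod h1 h2 h3 h4 hne
  omega

lemma exists_two_of_two_le_cod {x y : V} (h : 2 ≤ cod G x y) :
    ∃ z w, z ≠ w ∧ G.Adj x z ∧ G.Adj y z ∧ G.Adj x w ∧ G.Adj y w := by
  classical
  rw [cod_eq_card] at h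
  have h' : 1 < (Finset.univ.filter fun z => G.Adj x z ∧ G.Adj y z).card := by exact_mod_cast h
  obtain ⟨z, hz, w, hw, hne⟩ := Finset.one_lt_card.1 h'
  simp only [Finset.mem_filter, Finset.mem_univ, true_and] at hz hw
  exact ⟨z, w, hne, hz.1, hz.2, hw.1, hw.2⟩

lemma bareInd_le_bareSum (x y : V) : bareInd G x y ≤ bareSum G := by
  refine le_trans (Finset.single_le_sum (f := fun y => bareInd G x y)
    (fun y _ => bareInd_nonneg x y) (Finset.mem_univ y)) ?_
  exact Finset.single_le_sum (f := fun x => ∑ y, bareInd G x y)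
    (fun x _ => Finset.sum_nonneg fun y _ => bareInd_nonneg x y) (Finset.mem_univ x)

lemma bareSum_nonneg : 0 ≤ bareSum G :=
  Finset.sum_nonneg fun x _ => Finset.sum_nonneg fun y _ => bareInd_nonneg x y

lemma exists_tri_of_bareSum {x y : V} (h0 : bareSum G = 0) (h : G.Adj x y) :
    ∃ z, IsTri G x y z := by
  have h1 := bareInd_le_bareSum (G := G) x y
  have h2 : cod G x y ≠ 0 := by
    intro h3
    have : bareInd G x y = 1 := by simp [bareInd, h, h3]
    omega
  obtain ⟨z, hz, hz'⟩ := exists_of_cod_pos h2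
  exact ⟨z, h, hz', hz⟩

/-- `G` is the join of an independent set `Aᶜ` and of a matching on `A` that misses at most one
vertex. -/
structure IsKPlus (G : SimpleGraph V) (A : Finset V) : Prop where
  indep : ∀ x ∉ A, ∀ y ∉ A, ¬ G.Adj x y
  join : ∀ x ∈ A, ∀ y ∉ A, G.Adj x y
  matching : ∀ x ∈ A, ∀ y ∈ A, ∀ z ∈ A, G.Adj x y → G.Adj x z → y = z
  unmatched : ∀ x ∈ A, ∀ y ∈ A, (∀ z ∈ A, ¬ G.Adj x z) → (∀ z ∈ A, ¬ G.Adj y z) → x = y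

lemma even_card_of_perfect {A : Finset V}
    (h : ∀ x ∈ A, ∀ y ∈ A, ∀ z ∈ A, G.Adj x y → G.Adj x z → y = z)
    (h' : ∀ x ∈ A, ∃ y ∈ A, G.Adj x y) : Even A.card := by
  classical
  have h1 := even_sum_symm (fun x y => if x ∈ A ∧ y ∈ A then adjInd G x y else 0)
    (fun x y => by simp only [and_comm (a := x ∈ A), adjInd_comm x y]) (fun x => by simp)
  have h2 : ∑ x, ∑ y, (if x ∈ A ∧ y ∈ A then adjInd G x y else 0) = A.card := by
    rw [← Finset.sum_subset (Finset.subset_univ A)]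
    · rw [Finset.card_eq_sum_ones]
      push_cast
      refine Finset.sum_congr rfl fun x hx => ?_
      obtain ⟨y, hy, hxy⟩ := h' x hx
      rw [Finset.sum_eq_single y]
      · simp [hx, hy, adjInd_of_adj hxy]
      · intro z _ hz
        split_ifs with hA
        · exact adjInd_of_not_adj fun hxz => hz (h x hx z hA.2 y hy hxz hxy)
        · rfl
      · simp
    · intro x _ hx
      simp [hx]
  rw [h2] at h1
  exact_mod_cast h1

/-- The common neighbourhood `Z` of a spine `x y` becomes the independent side. The vanishing slacks
fix the degrees so exactly that `Z` is joined to everything outside it; then every edge outside `Z`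
is again a spine, and goodness makes those edges a matching, perfect because no edge is bare. -/
lemma IsTight.isKPlus (ht : IsTight G) (h0 : bareSum G = 0) (hN : 4 ≤ Fintype.card V)
    {x y : V} (hxy : G.Adj x y) (hp : 2 ≤ cod G x y) :
    ∃ A : Finset V, IsKPlus G A ∧ (∀ a ∈ A, ∃ b ∈ A, G.Adj a b) ∧
      deg G x = Fintype.card V - A.card + 1 := by
  classical
  set Z : Finset V := Finset.univ.filter fun z => G.Adj x z ∧ G.Adj y z with hZ
  have hZcard : cod G x y = Z.card := cod_eq_card x y
  have memZ : ∀ z, z ∈ Z ↔ G.Adj x z ∧ G.Adj y z := by simp [hZ]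
  have tri : ∀ z ∈ Z, IsTri G x y z := fun z hz => ⟨hxy, ((memZ z).1 hz).2, ((memZ z).1 hz).1⟩
  have good : ∀ z ∈ Z, cod G y z = 1 ∧ cod G x z = 1 := by
    intro z hz
    rcases ht.good hN x y z (tri z hz) with h | h | h
    · exact h
    · omega
    · omega
  have hxz : ∀ z ∈ Z, deg G x + deg G z = Fintype.card V + 1 := fun z hz =>
    ht.pair x y z (tri z hz) (good z hz).2 hp
  have hyz : ∀ z ∈ Z, deg G y + deg G z = Fintype.card V + 1 := fun z hz =>
    ht.pair y x z (tri z hz).swap (good z hz).1 (by rwa [cod_comm])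
  obtain ⟨z₀, hz₀⟩ : Z.Nonempty := by
    rw [← Finset.card_pos]; omega
  -- The triple equation for `x`, `y`, `z₀` minus the pair equation for `y`, `z₀`.
  have hdx : deg G x = Z.card + 1 := by
    have h1 := ht.triple x y z₀ (tri z₀ hz₀)
    have h2 := hxz z₀ hz₀
    have h3 := hyz z₀ hz₀
    have h4 := good z₀ hz₀
    omega
  have hZind : ∀ z ∈ Z, ∀ w ∈ Z, ¬ G.Adj z w := by
    intro z hz w hw h
    have := eq_of_cod_eq_one (good z hz).2 hxy ((memZ z).1 hz).2.symm ((memZ w).1 hw).1 h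
    exact ((memZ w).1 hw).2.ne this
  -- The pair equation gives deg z = n - |Z|, and `Z` is independent, so `z` must see the whole
  -- complement.
  have hZadj : ∀ z ∈ Z, ∀ a ∉ Z, G.Adj z a := by
    intro z hz
    have h1 : deg G z = (Zᶜ).card := by
      have := hxz z hz
      rw [Finset.card_compl]
      have : Z.card ≤ Fintype.card V := Finset.card_le_univ _
      omega
    rw [deg_eq_card] at h1
    have h2 : (Finset.univ.filter fun a => G.Adj z a) ⊆ Zᶜ := by
      intro a ha
      simp only [Finset.mem_filter, Finset.mem_univ, true_and] at ha
      rw [Finset.mem_compl]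
      exact fun haZ => hZind z hz a haZ ha
    have h3 := Finset.eq_of_subset_of_card_le h2 (by exact_mod_cast h1.ge)
    intro a ha
    have : a ∈ Zᶜ := Finset.mem_compl.2 ha
    rw [← h3] at this
    simpa using this
  have hmatch : ∀ a ∉ Z, ∀ b ∉ Z, ∀ c ∉ Z, G.Adj a b → G.Adj a c → b = c := by
    intro a ha b hb c hc hab hac
    have htri : IsTri G a b z₀ := ⟨hab, (hZadj z₀ hz₀ b hb).symm, (hZadj z₀ hz₀ a ha).symm⟩
    have h2 : 2 ≤ cod G a b := by
      have h3 : (Z.card : ℤ) ≤ cod G a b := by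
        rw [cod_eq_card]
        refine Nat.cast_le.2 (Finset.card_le_card fun z hz => ?_)
        simp only [Finset.mem_filter, Finset.mem_univ, true_and]
        exact ⟨(hZadj z hz a ha).symm, (hZadj z hz b hb).symm⟩
      omega
    have h4 : cod G a z₀ = 1 := by
      rcases ht.good hN a b z₀ htri with h | h | h
      · exact h.2
      · exact h.2
      · omega
    exact eq_of_cod_eq_one h4 hab (hZadj z₀ hz₀ b hb) hac (hZadj z₀ hz₀ c hc)
  have hex : ∀ a ∉ Z, ∃ b ∉ Z, G.Adj a b := by
    intro a ha
    obtain ⟨b, hb⟩ := exists_tri_of_bareSum h0 (hZadj z₀ hz₀ a ha)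
    exact ⟨b, fun hbZ => hZind z₀ hz₀ b hbZ hb.2.2, hb.2.1⟩
  refine ⟨Zᶜ, ⟨?_, ?_, ?_, ?_⟩, ?_, ?_⟩
  · intro z hz w hw
    rw [Finset.mem_compl, not_not] at hz hw
    exact hZind z hz w hw
  · intro a ha z hz
    rw [Finset.mem_compl] at ha
    rw [Finset.mem_compl, not_not] at hz
    exact (hZadj z hz a ha).symm
  · intro a ha b hb c hc
    rw [Finset.mem_compl] at ha hb hc
    exact hmatch a ha b hb c hc
  · intro a ha b hb h
    rw [Finset.mem_compl] at ha
    obtain ⟨c, hc, hac⟩ := hex a ha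
    exact absurd hac (h c (Finset.mem_compl.2 hc))
  · intro a ha
    rw [Finset.mem_compl] at ha
    obtain ⟨c, hc, hac⟩ := hex a ha
    exact ⟨c, Finset.mem_compl.2 hc, hac⟩
  · rw [Finset.card_compl, hdx]
    have : Z.card ≤ Fintype.card V := Finset.card_le_univ _
    omega

/-- The triangles at `x` match its neighbours in pairs. -/
lemma even_deg_of_cod_eq_one {x : V} (h : ∀ y, G.Adj x y → cod G x y = 1) : Even (deg G x) := by
  have h1 := even_sum_symm (fun y z => adjInd G x y * adjInd G x z * adjInd G y z)
    (fun y z => by rw [adjInd_comm y z]; ring) (fun y => by simp)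
  have h2 : ∑ y, ∑ z, adjInd G x y * adjInd G x z * adjInd G y z = deg G x := by
    refine Finset.sum_congr rfl fun y _ => ?_
    by_cases hy : G.Adj x y
    · have := h y hy
      simp only [mul_assoc, ← Finset.mul_sum]
      rw [show ∑ z, adjInd G x z * adjInd G y z = cod G x y from rfl, this, mul_one]
    · simp [adjInd_of_not_adj hy]
  rwa [h2] at h1

/-- The structure of the graphs in which all slacks vanish. -/
lemma IsTight.cases (ht : IsTight G) (h0 : bareSum G = 0) (hN : 4 ≤ Fintype.card V)
    (hd : ∃ x, deg G x ≠ 0) :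
    (∃ (A : Finset V) (x : V), IsKPlus G A ∧ Even A.card ∧
      deg G x = Fintype.card V - A.card + 1) ∨
    ((∀ x, Even (deg G x)) ∧
      ∃ x y z, deg G x + deg G y + deg G z = Fintype.card V + 3) := by
  by_cases h : ∃ x y, G.Adj x y ∧ 2 ≤ cod G x y
  · obtain ⟨x, y, hxy, hp⟩ := h
    obtain ⟨A, hA, hA', hx⟩ := ht.isKPlus h0 hN hxy hp
    exact Or.inl ⟨A, x, hA, even_card_of_perfect hA.matching hA', hx⟩
  · push Not at h
    have h1 : ∀ x y, G.Adj x y → cod G x y = 1 := by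
      intro x y hxy
      obtain ⟨z, hz⟩ := exists_tri_of_bareSum h0 hxy
      have := hz.cod_pos
      have := h x y hxy
      omega
    refine Or.inr ⟨fun x => even_deg_of_cod_eq_one fun y => h1 x y, ?_⟩
    obtain ⟨x, hx⟩ := hd
    obtain ⟨y, hy⟩ : ∃ y, G.Adj x y := by
      by_contra! hc
      exact hx (Finset.sum_eq_zero fun y _ => adjInd_of_not_adj (hc y))
    obtain ⟨z, hz⟩ := exists_tri_of_bareSum h0 hy
    refine ⟨x, y, z, ?_⟩
    rw [ht.triple x y z hz, h1 x y hz.1, h1 y z hz.2.1, h1 x z hz.2.2]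
    norm_num

lemma sum_sq_nonneg : 0 ≤ ∑ x, (2 * deg G x - (Fintype.card V + 1)) ^ 2 :=
  Finset.sum_nonneg fun _ _ => sq_nonneg _

/-- The general upper bound. -/
lemma two_mul_excess_le : 2 * excess G ≤ 3 * (Fintype.card V + 1) ^ 2 := by
  have h := (excess_le_and_isTight (G := G)).1
  have h1 := sum_sq_nonneg (G := G)
  have h2 := bareSum_nonneg (G := G)
  rcases Nat.eq_zero_or_pos (Fintype.card V) with h0 | h0
  · have : IsEmpty V := Fintype.card_eq_zero_iff.1 h0
    simp [excess]
  · have h3 : (0 : ℤ) < Fintype.card V := by exact_mod_cast h0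
    have h4 : (Fintype.card V : ℤ) * (2 * excess G) ≤
        Fintype.card V * (3 * (Fintype.card V + 1) ^ 2) := by nlinarith
    exact le_of_mul_le_mul_left h4 h3

lemma isTight_of_excess_eq (h : 2 * excess G = 3 * (Fintype.card V + 1) ^ 2) :
    IsTight G ∧ bareSum G = 0 ∧ ∀ x, 2 * deg G x = Fintype.card V + 1 := by
  have h3 := excess_le_and_isTight (G := G)
  have h1 := sum_sq_nonneg (G := G)
  have h2 := bareSum_nonneg (G := G)
  have h4 : 2 * Fintype.card V * excess G = 3 * Fintype.card V * (Fintype.card V + 1) ^ 2 := by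
    linear_combination (Fintype.card V : ℤ) * h
  have h5 : ∑ x, (2 * deg G x - (Fintype.card V + 1)) ^ 2 = 0 := by linarith [h3.1]
  refine ⟨h3.2 (by linarith [h3.1]), by linarith [h3.1], fun x => ?_⟩
  have := (Finset.sum_eq_zero_iff_of_nonneg fun x _ => sq_nonneg _).1 h5 x (Finset.mem_univ x)
  have := pow_eq_zero_iff (two_ne_zero) |>.1 this
  omega

/-- As n+1 is odd, each of the n squares is at least 1. Together they use up exactly the deficit 3
in the hypothesis, so all of them equal 1 and nothing is left for the other slacks. -/
lemma isTight_of_excess_eq_of_even (hn : Even (Fintype.card V))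
    (h : 2 * excess G = 3 * (Fintype.card V + 1) ^ 2 - 3) :
    IsTight G ∧ bareSum G = 0 ∧
      ∀ x, 2 * deg G x = Fintype.card V ∨ 2 * deg G x = Fintype.card V + 2 := by
  have h3 := excess_le_and_isTight (G := G)
  have h2 := bareSum_nonneg (G := G)
  have h4 : 2 * Fintype.card V * excess G =
      3 * Fintype.card V * (Fintype.card V + 1) ^ 2 - 3 * Fintype.card V := by
    linear_combination (Fintype.card V : ℤ) * h
  have h5 : ∀ x, 1 ≤ (2 * deg G x - (Fintype.card V + 1)) ^ 2 := by
    intro x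
    have : (2 * deg G x - (Fintype.card V + 1)) ≠ 0 := by
      obtain ⟨m, hm⟩ := hn
      omega
    have := sq_pos_of_ne_zero this
    omega
  have h6 : (Fintype.card V : ℤ) ≤ ∑ x, (2 * deg G x - (Fintype.card V + 1)) ^ 2 := by
    have := Finset.sum_le_sum fun x (_ : x ∈ Finset.univ) => h5 x
    simpa using this
  have h7 : ∑ x, ((2 * deg G x - (Fintype.card V + 1)) ^ 2 - 1) = 0 := by
    rw [Finset.sum_sub_distrib]
    simp only [Finset.sum_const, Finset.card_univ, nsmul_eq_mul, mul_one]
    linarith [h3.1]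
  have h8 : ∑ x, (2 * deg G x - (Fintype.card V + 1)) ^ 2 = (Fintype.card V : ℤ) := by
    linarith [h3.1]
  refine ⟨h3.2 (by linarith [h3.1]), by linarith [h3.1], fun x => ?_⟩
  have := (Finset.sum_eq_zero_iff_of_nonneg fun x _ => sub_nonneg.2 (h5 x)).1 h7 x
    (Finset.mem_univ x)
  have h9 : (2 * deg G x - (Fintype.card V + 1)) ^ 2 = 1 := by linarith
  rcases sq_eq_sq_iff_eq_or_eq_neg.1 (h9.trans (one_pow 2).symm) with h | h
  · right; omega
  · left; omega

end Tight
end LayerDomination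

namespace LayerDomination

/-! ### The maximum of the excess, and the extremal graphs for n not 1 modulo 4 -/

section Extremal

set_option linter.unusedSectionVars false

variable {V : Type*} [Fintype V] {G : SimpleGraph V}

open Classical in
lemma card_fiber_eq_six [DecidableEq V] {s : Finset V} (hs : s ∈ G.cliqueFinset 3) :
    ((Finset.univ.filter fun p : V × V × V => IsTri G p.1 p.2.1 p.2.2).filter
      fun p => ({p.1, p.2.1, p.2.2} : Finset V) = s).card = 6 := by
  rw [SimpleGraph.mem_cliqueFinset_iff, SimpleGraph.is3Clique_iff] at hs
  obtain ⟨a, b, c, hab, hac, hbc, rfl⟩ := hs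
  have : ((Finset.univ.filter fun p : V × V × V => IsTri G p.1 p.2.1 p.2.2).filter
      fun p => ({p.1, p.2.1, p.2.2} : Finset V) = {a, b, c}) =
      {(a, b, c), (a, c, b), (b, a, c), (b, c, a), (c, a, b), (c, b, a)} := by
    ext ⟨x, y, z⟩
    simp only [Finset.mem_filter, Finset.mem_univ, true_and, Finset.mem_insert,
      Finset.mem_singleton, Prod.mk.injEq]
    constructor
    · rintro ⟨⟨h1, h2, h3⟩, h⟩
      have hx : x ∈ ({a, b, c} : Finset V) := by rw [← h]; simp
      have hy : y ∈ ({a, b, c} : Finset V) := by rw [← h]; simp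
      have hz : z ∈ ({a, b, c} : Finset V) := by rw [← h]; simp
      simp only [Finset.mem_insert, Finset.mem_singleton] at hx hy hz
      have := h1.ne
      have := h2.ne
      have := h3.ne
      rcases hx with rfl | rfl | rfl <;> rcases hy with rfl | rfl | rfl <;>
        rcases hz with rfl | rfl | rfl <;> simp_all
    · have e1 : ({a, c, b} : Finset V) = {a, b, c} := by rw [Finset.pair_comm]
      have e2 : ({b, a, c} : Finset V) = {a, b, c} := Finset.insert_comm _ _ _
      have e3 : ({b, c, a} : Finset V) = {a, b, c} := by rw [Finset.pair_comm]; exact e2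
      have e4 : ({c, a, b} : Finset V) = {a, b, c} := by rw [Finset.insert_comm]; exact e1
      have e5 : ({c, b, a} : Finset V) = {a, b, c} := by rw [Finset.insert_comm]; exact e3
      rintro (⟨rfl, rfl, rfl⟩ | ⟨rfl, rfl, rfl⟩ | ⟨rfl, rfl, rfl⟩ | ⟨rfl, rfl, rfl⟩ |
        ⟨rfl, rfl, rfl⟩ | ⟨rfl, rfl, rfl⟩)
      · exact ⟨⟨hab, hbc, hac⟩, rfl⟩
      · exact ⟨⟨hac, hbc.symm, hab⟩, e1⟩
      · exact ⟨⟨hab.symm, hac, hbc⟩, e2⟩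
      · exact ⟨⟨hbc, hac.symm, hab.symm⟩, e3⟩
      · exact ⟨⟨hac.symm, hab, hbc.symm⟩, e4⟩
      · exact ⟨⟨hbc.symm, hab.symm, hac.symm⟩, e5⟩
  rw [this]
  have h1 := hab.ne
  have h2 := hac.ne
  have h3 := hbc.ne
  have h4 := h1.symm
  have h5 := h2.symm
  have h6 := h3.symm
  rw [Finset.card_insert_of_notMem, Finset.card_insert_of_notMem, Finset.card_insert_of_notMem,
    Finset.card_insert_of_notMem, Finset.card_insert_of_notMem, Finset.card_singleton] <;>
    simp [h1, h2, h3, h4, h5, h6]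

open Classical in
lemma sum_adjInd_mul_cod_eq :
    ∑ x, ∑ y, adjInd G x y * cod G x y = 6 * ((G.cliqueFinset 3).card : ℤ) := by
  have h1 : ∑ x, ∑ y, adjInd G x y * cod G x y =
      ((Finset.univ.filter fun p : V × V × V => IsTri G p.1 p.2.1 p.2.2).card : ℤ) := by
    rw [Finset.card_filter]
    push_cast
    rw [Fintype.sum_prod_type]
    refine Finset.sum_congr rfl fun x _ => ?_
    rw [Fintype.sum_prod_type]
    refine Finset.sum_congr rfl fun y _ => ?_
    rw [cod, Finset.mul_sum]
    refine Finset.sum_congr rfl fun z _ => ?_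
    by_cases h1 : G.Adj x y <;> by_cases h2 : G.Adj y z <;> by_cases h3 : G.Adj x z <;>
      simp [adjInd, IsTri, h1, h2, h3]
  rw [h1, Finset.card_eq_sum_card_fiberwise (t := G.cliqueFinset 3)
    (f := fun p : V × V × V => ({p.1, p.2.1, p.2.2} : Finset V))]
  · rw [Finset.sum_congr rfl fun s hs => card_fiber_eq_six hs]
    simp [mul_comm]
  · rintro ⟨x, y, z⟩ h
    simp only [Finset.coe_filter, Finset.mem_univ, true_and, Set.mem_ofPred_eq] at h
    simp only [Finset.mem_coe, SimpleGraph.mem_cliqueFinset_iff, SimpleGraph.is3Clique_iff]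
    exact ⟨x, y, z, h.1, h.2.2, h.2.1, rfl⟩

open Classical in
lemma sum_adjInd_eq : ∑ x, ∑ y, adjInd G x y = 2 * (G.edgeFinset.card : ℤ) := by
  have h := G.sum_degrees_eq_twice_card_edges
  have h2 : ∀ x, ∑ y, adjInd G x y = G.degree x := by
    intro x
    have := deg_eq_card (G := G) x
    rw [deg] at this
    rw [this, ← SimpleGraph.card_neighborFinset_eq_degree, SimpleGraph.neighborFinset_eq_filter]
  simp only [h2]
  exact_mod_cast h

lemma even_bareSum : Even (bareSum G) :=
  even_sum_symm _ bareInd_comm fun x => by simp [bareInd]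

/-- This integrality is what allows the real bound (n+1)²/8 to be rounded down. -/
lemma exists_excess_eq : ∃ m : ℤ, excess G = 6 * m := by
  obtain ⟨m, hm⟩ := even_bareSum (G := G)
  unfold excess
  rw [sum_adjInd_eq, sum_adjInd_mul_cod_eq]
  unfold bareSum at hm
  rw [hm]
  classical
  exact ⟨2 * G.edgeFinset.card - m - 2 * (G.cliqueFinset 3).card, by ring⟩

/-- The value of the maximum, for a vertex set of odd or even size. -/
lemma excess_le : excess G ≤ 12 * ((Fintype.card V + 1) ^ 2 / 8 : ℕ) := by
  obtain ⟨m, hm⟩ := exists_excess_eq (G := G)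
  have h := two_mul_excess_le (G := G)
  set n := Fintype.card V with hn
  have hcases : n % 4 = 0 ∨ n % 4 = 1 ∨ n % 4 = 2 ∨ n % 4 = 3 := by omega
  rcases hcases with h4 | h4 | h4 | h4
  · obtain ⟨k, hk⟩ : ∃ k, n = 4 * k := ⟨n / 4, by omega⟩
    have : (n + 1) ^ 2 / 8 = 2 * k ^ 2 + k := by
      rw [hk, show (4 * k + 1) ^ 2 = 1 + 8 * (2 * k ^ 2 + k) by ring]; omega
    rw [this]; push_cast
    rw [hk] at h; push_cast at h
    have : 4 * m ≤ 4 * (4 * k ^ 2 + 2 * k : ℤ) + 1 := by nlinarith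
    omega
  · obtain ⟨k, hk⟩ : ∃ k, n = 4 * k + 1 := ⟨n / 4, by omega⟩
    have : (n + 1) ^ 2 / 8 = 2 * k ^ 2 + 2 * k := by
      rw [hk, show (4 * k + 1 + 1) ^ 2 = 4 + 8 * (2 * k ^ 2 + 2 * k) by ring]; omega
    rw [this]; push_cast
    -- For n = 4k+1 the bound on `m` is 4k²+4k+1, one more than the claim, so a counterexample meets
    -- the real bound with equality and all degrees are 2k+1.
    by_contra hlt
    have hm' : 2 * excess G = 3 * ((n : ℤ) + 1) ^ 2 := by
      rw [hk] at h ⊢; push_cast at h ⊢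
      have h1 : m ≤ 4 * k ^ 2 + 4 * k + 1 := by nlinarith
      have h2 : 4 * (k : ℤ) ^ 2 + 4 * k + 1 ≤ m := by omega
      rw [hm]
      have : m = 4 * k ^ 2 + 4 * k + 1 := le_antisymm h1 h2
      rw [this]; ring
    obtain ⟨ht, h0, hd⟩ := isTight_of_excess_eq hm'
    have hpos : 0 < n := by omega
    obtain ⟨x⟩ := Fintype.card_pos_iff.1 hpos
    have hn4 : 4 ≤ n := by
      have h1 := hd x
      have h2 : deg G x ≠ 0 := by omega
      obtain ⟨y, hy⟩ : ∃ y, G.Adj x y := by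
        by_contra! hc
        exact h2 (Finset.sum_eq_zero fun y _ => adjInd_of_not_adj (hc y))
      obtain ⟨z, hz⟩ := exists_tri_of_bareSum h0 hy
      have := hz.three_le_card
      omega
    -- In the first case the degree n - |A| + 1 is even, but 2k+1 is odd; in the second 3(2k+1)
    -- would equal 4k+4.
    rcases ht.cases h0 hn4 ⟨x, by have := hd x; omega⟩ with ⟨A, y, hA, ⟨r, hr⟩, hy⟩ | ⟨-, y, z, w, hyz⟩
    · have := hd y
      omega
    · have := hd y
      have := hd z
      have := hd w
      omega
  · obtain ⟨k, hk⟩ : ∃ k, n = 4 * k + 2 := ⟨n / 4, by omega⟩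
    have : (n + 1) ^ 2 / 8 = 2 * k ^ 2 + 3 * k + 1 := by
      rw [hk, show (4 * k + 2 + 1) ^ 2 = 1 + 8 * (2 * k ^ 2 + 3 * k + 1) by ring]; omega
    rw [this]; push_cast
    rw [hk] at h; push_cast at h
    have : 4 * m ≤ 4 * (4 * k ^ 2 + 6 * k + 2 : ℤ) + 1 := by nlinarith
    omega
  · obtain ⟨k, hk⟩ : ∃ k, n = 4 * k + 3 := ⟨n / 4, by omega⟩
    have : (n + 1) ^ 2 / 8 = 2 * k ^ 2 + 4 * k + 2 := by
      rw [hk, show (4 * k + 3 + 1) ^ 2 = 8 * (2 * k ^ 2 + 4 * k + 2) by ring]; omega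
    rw [this]; push_cast
    rw [hk] at h; push_cast at h
    nlinarith

/-- The extremal graphs for vertex sets of even size. -/
theorem isKPlus_of_even (hn : Even (Fintype.card V)) (hn3 : 3 ≤ Fintype.card V)
    (h : excess G = 12 * ((Fintype.card V + 1) ^ 2 / 8 : ℕ)) :
    bareSum G = 0 ∧ ∃ A : Finset V, IsKPlus G A ∧ Even A.card ∧
      (2 * A.card = Fintype.card V ∨ 2 * A.card = Fintype.card V + 2) := by
  have h1 : 2 * excess G = 3 * (Fintype.card V + 1) ^ 2 - 3 := by
    obtain ⟨k, hk⟩ := hn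
    rcases Nat.even_or_odd' k with ⟨j, hj | hj⟩
    · have e : (Fintype.card V + 1) ^ 2 / 8 = 2 * j ^ 2 + j := by
        rw [hk, hj, show (2 * j + 2 * j + 1) ^ 2 = 1 + 8 * (2 * j ^ 2 + j) by ring]; omega
      rw [h, e, hk, hj]; push_cast; ring
    · have e : (Fintype.card V + 1) ^ 2 / 8 = 2 * j ^ 2 + 3 * j + 1 := by
        rw [hk, hj, show (2 * j + 1 + (2 * j + 1) + 1) ^ 2 = 1 + 8 * (2 * j ^ 2 + 3 * j + 1) by ring]
        omega
      rw [h, e, hk, hj]; push_cast; ring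
  obtain ⟨ht, h0, hd⟩ := isTight_of_excess_eq_of_even hn h1
  obtain ⟨x⟩ := Fintype.card_pos_iff.1 (by omega : 0 < Fintype.card V)
  have hn4 : 4 ≤ Fintype.card V := by
    obtain ⟨k, hk⟩ := hn
    omega
  rcases ht.cases h0 hn4 ⟨x, by have := hd x; omega⟩ with ⟨A, y, hA, hr, hy⟩ | ⟨he, y, z, w, hyz⟩
  · refine ⟨h0, A, hA, hr, ?_⟩
    have := hd y
    omega
  -- Three even degrees from {n/2, n/2 + 1} coincide, and a triple of sum n+3 then forces n = 6 and
  -- degree 3, which is odd.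
  · exfalso
    have h2 := hd y
    have h3 := hd z
    have h4 := hd w
    obtain ⟨a, ha⟩ := he y
    obtain ⟨b, hb⟩ := he z
    obtain ⟨c, hc⟩ := he w
    omega

/-- The extremal graphs for vertex sets of size `3` modulo `4`. -/
theorem isKPlus_of_three_mod_four (hn : Fintype.card V % 4 = 3)
    (h : excess G = 12 * ((Fintype.card V + 1) ^ 2 / 8 : ℕ)) :
    ∃ A : Finset V, IsKPlus G A ∧ 2 * A.card = Fintype.card V + 1 := by
  have h1 : 2 * excess G = 3 * (Fintype.card V + 1) ^ 2 := by
    obtain ⟨k, hk⟩ : ∃ k, Fintype.card V = 4 * k + 3 := ⟨Fintype.card V / 4, by omega⟩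
    have e : (Fintype.card V + 1) ^ 2 / 8 = 2 * k ^ 2 + 4 * k + 2 := by
      rw [hk, show (4 * k + 3 + 1) ^ 2 = 8 * (2 * k ^ 2 + 4 * k + 2) by ring]; omega
    rw [h, e, hk]; push_cast; ring
  obtain ⟨ht, h0, hd⟩ := isTight_of_excess_eq h1
  obtain ⟨x⟩ := Fintype.card_pos_iff.1 (by omega : 0 < Fintype.card V)
  by_cases hn4 : 4 ≤ Fintype.card V
  · rcases ht.cases h0 hn4 ⟨x, by have := hd x; omega⟩ with ⟨A, y, hA, hr, hy⟩ | ⟨he, y, z, w, hyz⟩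
    · refine ⟨A, hA, ?_⟩
      have := hd y
      omega
    · have := hd y
      have := hd z
      have := hd w
      omega
  -- Three vertices: the triple must be a triangle, which is K⁺ with any two of its vertices as the
  -- matched side.
  · classical
    have hn3 : Fintype.card V = 3 := by omega
    obtain ⟨y, hy⟩ : ∃ y, G.Adj x y := by
      by_contra! hc
      have : deg G x = 0 := Finset.sum_eq_zero fun y _ => adjInd_of_not_adj (hc y)
      have := hd x
      omega
    obtain ⟨z, hz⟩ := exists_tri_of_bareSum h0 hy
    have hcard : ({x, y, z} : Finset V).card = 3 := by
      rw [Finset.card_eq_three]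
      exact ⟨x, y, z, hz.1.ne, hz.2.2.ne, hz.2.1.ne, rfl⟩
    have huniv : ({x, y, z} : Finset V) = Finset.univ :=
      (Finset.card_eq_iff_eq_univ _).1 (by rw [hcard, hn3])
    have hmem : ∀ v, v = x ∨ v = y ∨ v = z := by
      intro v
      have : v ∈ ({x, y, z} : Finset V) := by rw [huniv]; simp
      simpa using this
    have hA : ∀ v, v ∉ ({x, y} : Finset V) → v = z := by
      intro v hv
      rcases hmem v with rfl | rfl | rfl
      · simp at hv
      · simp at hv
      · rfl
    refine ⟨{x, y}, ⟨?_, ?_, ?_, ?_⟩, ?_⟩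
    · intro v hv w hw
      rw [hA v hv, hA w hw]
      exact G.irrefl
    · intro v hv w hw
      rw [hA w hw]
      simp only [Finset.mem_insert, Finset.mem_singleton] at hv
      rcases hv with rfl | rfl
      · exact hz.2.2
      · exact hz.2.1
    · intro u hu v hv w hw huv huw
      have := huv.ne
      have := huw.ne
      simp only [Finset.mem_insert, Finset.mem_singleton] at hu hv hw
      rcases hu with rfl | rfl <;> rcases hv with rfl | rfl <;> rcases hw with rfl | rfl <;> simp_all
    · intro v hv w hw h3 h4
      simp only [Finset.mem_insert, Finset.mem_singleton] at hv hw
      rcases hv with rfl | rfl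
      · exact absurd hz.1 (h3 y (by simp))
      · exact absurd hz.1.symm (h3 x (by simp))
    · rw [Finset.card_pair hz.1.ne, hn3]

end Extremal
end LayerDomination

namespace LayerDomination

/-! ### Invariance under isomorphism and the effect of vertex moves on the excess -/

section Moves

set_option linter.unusedSectionVars false

variable {V W : Type*} [Fintype V] [Fintype W] {G : SimpleGraph V} {H : SimpleGraph W}

lemma adjInd_iso (φ : G ≃g H) (x y : V) : adjInd H (φ x) (φ y) = adjInd G x y := by
  by_cases h : G.Adj x y
  · rw [adjInd_of_adj h, adjInd_of_adj (φ.map_adj_iff.2 h)]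
  · rw [adjInd_of_not_adj h, adjInd_of_not_adj fun h' => h (φ.map_adj_iff.1 h')]

lemma sum_iso (φ : G ≃g H) (f : W → ℤ) : ∑ x, f (φ x) = ∑ y, f y :=
  Equiv.sum_comp φ.toEquiv f

lemma deg_iso (φ : G ≃g H) (x : V) : deg H (φ x) = deg G x := by
  unfold deg
  rw [← sum_iso φ]
  simp only [adjInd_iso]

lemma cod_iso (φ : G ≃g H) (x y : V) : cod H (φ x) (φ y) = cod G x y := by
  unfold cod
  rw [← sum_iso φ]
  simp only [adjInd_iso]

lemma bareInd_iso (φ : G ≃g H) (x y : V) : bareInd H (φ x) (φ y) = bareInd G x y := by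
  classical
  unfold bareInd
  exact if_congr (by rw [cod_iso, φ.map_adj_iff]) rfl rfl

lemma excess_iso (φ : G ≃g H) : excess H = excess G := by
  unfold excess
  rw [← sum_iso φ, ← sum_iso φ, ← sum_iso φ]
  have h1 : ∀ x, ∑ y, adjInd H (φ x) y = ∑ y, adjInd G x y := fun x => by
    rw [← sum_iso φ]; simp only [adjInd_iso]
  have h2 : ∀ x, ∑ y, bareInd H (φ x) y = ∑ y, bareInd G x y := fun x => by
    rw [← sum_iso φ]; simp only [bareInd_iso]
  have h3 : ∀ x, ∑ y, adjInd H (φ x) y * cod H (φ x) y = ∑ y, adjInd G x y * cod G x y :=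
    fun x => by rw [← sum_iso φ]; simp only [adjInd_iso, cod_iso]
  simp only [h1, h2, h3]

variable (G) in
/-- The number of edges at a vertex that lie in no triangle. -/
noncomputable def bareDeg (v : V) : ℤ := ∑ y, bareInd G v y

variable (G) in
/-- Twice the number of triangles at a vertex. -/
noncomputable def triDeg (v : V) : ℤ := ∑ y, adjInd G v y * cod G v y

variable (G) in
open Classical in
/-- The indicator of the edges that lie in exactly one triangle. -/
noncomputable def soleInd (x y : V) : ℤ := if G.Adj x y ∧ cod G x y = 1 then 1 else 0

variable (G) in
/-- Twice the number of edges that lie in exactly one triangle, which is a triangle at `v`, and do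
not contain `v`. -/
noncomputable def lostDeg (v : V) : ℤ :=
  ∑ y, ∑ z, adjInd G v y * adjInd G v z * soleInd G y z

lemma bareDeg_iso (φ : G ≃g H) (x : V) : bareDeg H (φ x) = bareDeg G x := by
  unfold bareDeg
  rw [← sum_iso φ]
  simp only [bareInd_iso]

lemma triDeg_iso (φ : G ≃g H) (x : V) : triDeg H (φ x) = triDeg G x := by
  unfold triDeg
  rw [← sum_iso φ]
  simp only [adjInd_iso, cod_iso]

lemma soleInd_iso (φ : G ≃g H) (x y : V) : soleInd H (φ x) (φ y) = soleInd G x y := by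
  classical
  unfold soleInd
  exact if_congr (by rw [cod_iso, φ.map_adj_iff]) rfl rfl

lemma lostDeg_iso (φ : G ≃g H) (x : V) : lostDeg H (φ x) = lostDeg G x := by
  unfold lostDeg
  rw [← sum_iso φ]
  have h : ∀ y, ∑ z, adjInd H (φ x) (φ y) * adjInd H (φ x) z * soleInd H (φ y) z =
      ∑ z, adjInd G x y * adjInd G x z * soleInd G y z := fun y => by
    rw [← sum_iso φ]
    simp only [adjInd_iso, soleInd_iso]
  simp only [h]

/-! ### Bookkeeping for one additional vertex -/

section Option

variable (K : SimpleGraph (Option V))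

lemma adjInd_comap_some (x y : V) :
    adjInd (K.comap some) x y = adjInd K (some x) (some y) := rfl

lemma cod_some_some (x y : V) : cod K (some x) (some y) =
    adjInd K none (some x) * adjInd K none (some y) + cod (K.comap some) x y := by
  unfold cod
  rw [Fintype.sum_option, adjInd_comm (some x) none, adjInd_comm (some y) none]
  rfl

lemma cod_none_some (y : V) : cod K none (some y) =
    ∑ x, adjInd K none (some x) * adjInd (K.comap some) y x := by
  unfold cod
  rw [Fintype.sum_option, adjInd_self, zero_mul, zero_add]
  rfl

lemma deg_none : deg K none = ∑ x, adjInd K none (some x) := by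
  unfold deg
  rw [Fintype.sum_option, adjInd_self, zero_add]

lemma triDeg_none : triDeg K none =
    ∑ x, ∑ y, adjInd K none (some x) * adjInd K none (some y) * adjInd (K.comap some) x y := by
  unfold triDeg
  rw [Fintype.sum_option, adjInd_self, zero_mul, zero_add]
  refine Finset.sum_congr rfl fun x _ => ?_
  rw [cod_none_some, Finset.mul_sum]
  exact Finset.sum_congr rfl fun y _ => by ring

lemma bareInd_self {U : Type*} [Fintype U] (L : SimpleGraph U) (x : U) : bareInd L x x = 0 := by
  simp [bareInd]

lemma bareDeg_none : bareDeg K none = ∑ x, bareInd K none (some x) := by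
  unfold bareDeg
  rw [Fintype.sum_option, bareInd_self, zero_add]

lemma lostDeg_none : lostDeg K none =
    ∑ x, ∑ y, adjInd K none (some x) * adjInd K none (some y) * bareInd (K.comap some) x y := by
  unfold lostDeg
  rw [Fintype.sum_option]
  simp only [adjInd_self, zero_mul, Finset.sum_const_zero, zero_add]
  refine Finset.sum_congr rfl fun x _ => ?_
  rw [Fintype.sum_option]
  simp only [adjInd_self, zero_mul, mul_zero, zero_add]
  refine Finset.sum_congr rfl fun y _ => ?_
  by_cases hx : K.Adj none (some x)
  · by_cases hy : K.Adj none (some y)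
    · classical
      rw [adjInd_of_adj hx, adjInd_of_adj hy, one_mul, one_mul, one_mul]
      unfold soleInd bareInd
      refine if_congr ?_ rfl rfl
      rw [cod_some_some, adjInd_of_adj hx, adjInd_of_adj hy]
      simp
    · simp [adjInd_of_not_adj hy]
  · simp [adjInd_of_not_adj hx]

lemma bareInd_some_some (x y : V) : bareInd K (some x) (some y) =
    bareInd (K.comap some) x y -
      adjInd K none (some x) * adjInd K none (some y) * bareInd (K.comap some) x y := by
  have h0 := cod_nonneg (G := K.comap some) x y
  by_cases hx : K.Adj none (some x)
  · by_cases hy : K.Adj none (some y)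
    · have : ¬ (K.Adj (some x) (some y) ∧ cod K (some x) (some y) = 0) := by
        rw [cod_some_some, adjInd_of_adj hx, adjInd_of_adj hy]
        omega
      rw [adjInd_of_adj hx, adjInd_of_adj hy, bareInd, if_neg this]
      ring
    · classical
      rw [adjInd_of_not_adj hy, mul_zero, zero_mul, sub_zero]
      unfold bareInd
      refine if_congr ?_ rfl rfl
      rw [cod_some_some, adjInd_of_not_adj hy]
      simp
  · classical
    rw [adjInd_of_not_adj hx, zero_mul, zero_mul, sub_zero]
    unfold bareInd
    refine if_congr ?_ rfl rfl
    rw [cod_some_some, adjInd_of_not_adj hx]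
    simp

/-- The vertex `none` brings its edges, its bare edges and its triangles; `lostDeg` returns the old
bare edges that the new triangles cover. As `triDeg` and `lostDeg` count twice, their coefficients
are halved. -/
lemma excess_option : excess K = excess (K.comap some) + 12 * deg K none - 6 * bareDeg K none -
    6 * triDeg K none + 3 * lostDeg K none := by
  have hE : ∑ x, ∑ y, adjInd K x y =
      2 * deg K none + ∑ x, ∑ y, adjInd (K.comap some) x y := by
    simp only [Fintype.sum_option, adjInd_self, zero_add, Finset.sum_add_distrib, deg_none,
      adjInd_comm (some _) none, adjInd_comap_some]
    ring
  have hB : ∑ x, ∑ y, bareInd K x y = 2 * bareDeg K none - lostDeg K none +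
      ∑ x, ∑ y, bareInd (K.comap some) x y := by
    simp only [Fintype.sum_option, bareInd_self, zero_add, Finset.sum_add_distrib, bareDeg_none,
      bareInd_comm (some _) none, bareInd_some_some, Finset.sum_sub_distrib, lostDeg_none]
    ring
  have hT : ∑ x, ∑ y, adjInd K x y * cod K x y = 3 * triDeg K none +
      ∑ x, ∑ y, adjInd (K.comap some) x y * cod (K.comap some) x y := by
    have h1 : ∑ x, ∑ y, adjInd K x y * cod K x y = 2 * triDeg K none +
        ∑ x, ∑ y, adjInd K (some x) (some y) * cod K (some x) (some y) := by
      simp only [triDeg, Fintype.sum_option, adjInd_self, zero_mul, zero_add,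
        Finset.sum_add_distrib, adjInd_comm (some _) none, cod_comm (some _) none]
      ring
    rw [h1, triDeg_none]
    simp only [cod_some_some, mul_add, Finset.sum_add_distrib, adjInd_comap_some]
    have : ∀ x y, adjInd K (some x) (some y) * (adjInd K none (some x) * adjInd K none (some y)) =
      adjInd K none (some x) * adjInd K none (some y) * adjInd K (some x) (some y) :=
      fun x y => by ring
    simp only [this]
    ring
  unfold excess
  rw [hE, hB, hT]
  ring

end Option

/-- The effect of the deletion of a vertex. -/
lemma excess_eq_remove [DecidableEq V] (v : V) :
    excess G = excess (G.comap (Subtype.val : {w // w ≠ v} → V)) + 12 * deg G v -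
      6 * bareDeg G v - 6 * triDeg G v + 3 * lostDeg G v := by
  let e : Option {w // w ≠ v} ≃ V := Equiv.optionSubtypeNe v
  let φ : G.comap e ≃g G := SimpleGraph.Iso.comap e G
  have hv : φ none = v := by simp [φ, e]
  have hc : (G.comap e).comap some = G.comap (Subtype.val : {w // w ≠ v} → V) := by
    ext x y; simp [e]
  have := excess_option (G.comap e)
  rw [hc, ← excess_iso φ, ← deg_iso φ, ← bareDeg_iso φ, ← triDeg_iso φ, ← lostDeg_iso φ, hv] at this
  exact this

variable (G) in
/-- The graph obtained by adding a vertex whose neighbourhood is `U`. -/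
def addVertex (U : Set V) : SimpleGraph (Option V) where
  Adj x y := match x, y with
    | none, none => False
    | none, some y => y ∈ U
    | some x, none => x ∈ U
    | some x, some y => G.Adj x y
  symm := ⟨by
    rintro (_ | x) (_ | y) h
    · exact h
    · exact h
    · exact h
    · exact SimpleGraph.Adj.symm h⟩
  loopless := ⟨by
    rintro (_ | x) h
    · exact h
    · exact G.irrefl h⟩

@[simp] lemma addVertex_some_some {U : Set V} {x y : V} :
    (addVertex G U).Adj (some x) (some y) ↔ G.Adj x y := Iff.rfl

lemma comap_addVertex (U : Set V) : (addVertex G U).comap some = G := by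
  ext x y; simp

end Moves
end LayerDomination

namespace LayerDomination

/-! ### Deleting a vertex of an extremal graph on 4k+1 vertices -/

section Reductions

set_option linter.unusedSectionVars false

variable {V W : Type*} [Fintype V] [Fintype W] {G : SimpleGraph V} {H : SimpleGraph W}

/-- The condition `hf` keeps the partner of each surviving matched vertex, so that no new unmatched
vertex appears. -/
lemma IsKPlus.comap {A : Finset W} (hA : IsKPlus H A) (f : V ↪ W)
    (hf : ∀ x, f x ∈ A → ∀ y ∈ A, H.Adj (f x) y → ∃ z, f z = y) {B : Finset V}
    (hB : ∀ x, x ∈ B ↔ f x ∈ A) : IsKPlus (H.comap f) B := by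
  refine ⟨?_, ?_, ?_, ?_⟩
  · intro x hx y hy
    rw [hB] at hx hy
    exact hA.indep _ hx _ hy
  · intro x hx y hy
    rw [hB] at hx hy
    exact hA.join _ hx _ hy
  · intro x hx y hy z hz hxy hxz
    rw [hB] at hx hy hz
    exact f.injective (hA.matching _ hx _ hy _ hz hxy hxz)
  · intro x hx y hy h1 h2
    rw [hB] at hx hy
    refine f.injective (hA.unmatched _ hx _ hy ?_ ?_)
    · intro z hz hxz
      obtain ⟨w, rfl⟩ := hf x hx z hz hxz
      exact h1 w ((hB w).2 hz) hxz
    · intro z hz hyz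
      obtain ⟨w, rfl⟩ := hf y hy z hz hyz
      exact h2 w ((hB w).2 hz) hyz

lemma IsKPlus.exists_partner {A : Finset V} (hA : IsKPlus G A) (h0 : bareSum G = 0)
    {b : V} (hb : b ∉ A) {a : V} (ha : a ∈ A) : ∃ c ∈ A, G.Adj a c := by
  obtain ⟨c, hc⟩ := exists_tri_of_bareSum h0 (hA.join a ha b hb)
  refine ⟨c, ?_, hc.2.2⟩
  by_contra hcA
  exact hA.indep b hb c hcA hc.2.1

lemma lostDeg_eq_zero {v : V} (h : ∀ y z, IsTri G v y z → cod G y z ≠ 1) : lostDeg G v = 0 := by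
  refine Finset.sum_eq_zero fun y _ => Finset.sum_eq_zero fun z _ => ?_
  by_cases hy : G.Adj v y
  · by_cases hz : G.Adj v z
    · have : ¬ (G.Adj y z ∧ cod G y z = 1) := fun hyz => h y z ⟨hy, hyz.1, hz⟩ hyz.2
      simp [soleInd, this]
    · simp [adjInd_of_not_adj hz]
  · simp [adjInd_of_not_adj hy]

/-- Twelve times the loss of the deletion of a vertex. -/
noncomputable def drop (G : SimpleGraph V) (v : V) : ℤ :=
  12 * deg G v - 6 * bareDeg G v - 6 * triDeg G v + 3 * lostDeg G v

/-- Twelve times the gain of the duplication of a vertex. -/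
noncomputable def gain (G : SimpleGraph V) (v : V) : ℤ :=
  12 * deg G v - 6 * bareDeg G v - 6 * triDeg G v

lemma bareDeg_nonneg (v : V) : 0 ≤ bareDeg G v := Finset.sum_nonneg fun y _ => bareInd_nonneg v y

lemma card_ne_eq [DecidableEq V] {k : ℕ} (hn : Fintype.card V = 4 * k + 1) (v : V) :
    Fintype.card {w // w ≠ v} = 4 * k := by
  rw [Fintype.card_subtype_compl, Fintype.card_subtype_eq, hn]
  rfl

lemma max_four_mul (k : ℕ) : (4 * k + 1) ^ 2 / 8 = 2 * k ^ 2 + k := by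
  rw [show (4 * k + 1) ^ 2 = 1 + 8 * (2 * k ^ 2 + k) by ring]; omega

lemma max_four_mul_add_one (k : ℕ) : (4 * k + 1 + 1) ^ 2 / 8 = 2 * k ^ 2 + 2 * k := by
  rw [show (4 * k + 1 + 1) ^ 2 = 4 + 8 * (2 * k ^ 2 + 2 * k) by ring]; omega

lemma max_four_mul_add_two (k : ℕ) : (4 * k + 1 + 1 + 1) ^ 2 / 8 = 2 * k ^ 2 + 3 * k + 1 := by
  rw [show (4 * k + 1 + 1 + 1) ^ 2 = 1 + 8 * (2 * k ^ 2 + 3 * k + 1) by ring]; omega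

lemma max_four_mul_add_three (k : ℕ) :
    (4 * k + 1 + 1 + 1 + 1) ^ 2 / 8 = 2 * k ^ 2 + 4 * k + 2 := by
  rw [show (4 * k + 1 + 1 + 1 + 1) ^ 2 = 8 * (2 * k ^ 2 + 4 * k + 2) by ring]; omega

/-- The maxima for 4k+1 and 4k vertices differ by 12k, and what remains cannot exceed the latter. -/
lemma drop_ge {k : ℕ} (hn : Fintype.card V = 4 * k + 1)
    (hex : excess G = 12 * (2 * k ^ 2 + 2 * k)) (v : V) : 12 * (k : ℤ) ≤ drop G v := by
  classical
  have h1 := excess_eq_remove (G := G) v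
  have h2 := excess_le (G := G.comap (Subtype.val : {w // w ≠ v} → V))
  rw [card_ne_eq hn, max_four_mul] at h2
  push_cast at h2
  unfold drop
  linarith

lemma two_mul_card_mul_card_le_triDeg [DecidableEq V] {v : V} {U B : Finset V}
    (hU : ∀ x ∈ U, G.Adj v x) (hB : ∀ x ∈ B, G.Adj v x) (hUB : ∀ x ∈ U, ∀ y ∈ B, G.Adj x y) :
    2 * (U.card * B.card : ℤ) ≤ triDeg G v := by
  have hdisj : Disjoint U B := by
    rw [Finset.disjoint_left]
    intro x hx hx'
    exact G.irrefl (hUB x hx x hx')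
  have h0 : ∀ y, 0 ≤ adjInd G v y * cod G v y := fun y =>
    mul_nonneg (adjInd_nonneg _ _) (cod_nonneg _ _)
  have h1 : ∑ y ∈ U ∪ B, adjInd G v y * cod G v y ≤ triDeg G v :=
    Finset.sum_le_univ_sum_of_nonneg h0
  rw [Finset.sum_union hdisj] at h1
  have h2 : (U.card * B.card : ℤ) ≤ ∑ y ∈ U, adjInd G v y * cod G v y := by
    have : ∀ y ∈ U, (B.card : ℤ) ≤ adjInd G v y * cod G v y := by
      intro y hy
      classical
      rw [adjInd_of_adj (hU y hy), one_mul, cod_eq_card]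
      refine Nat.cast_le.2 (Finset.card_le_card fun z hz => ?_)
      simp only [Finset.mem_filter, Finset.mem_univ, true_and]
      exact ⟨hB z hz, hUB y hy z hz⟩
    have := Finset.sum_le_sum this
    simpa using this
  have h3 : (U.card * B.card : ℤ) ≤ ∑ y ∈ B, adjInd G v y * cod G v y := by
    have : ∀ y ∈ B, (U.card : ℤ) ≤ adjInd G v y * cod G v y := by
      intro y hy
      classical
      rw [adjInd_of_adj (hB y hy), one_mul, cod_eq_card]
      refine Nat.cast_le.2 (Finset.card_le_card fun z hz => ?_)
      simp only [Finset.mem_filter, Finset.mem_univ, true_and]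
      exact ⟨hU z hz, (hUB z hz y hy).symm⟩
    have := Finset.sum_le_sum this
    rw [mul_comm]
    simpa using this
  linarith

lemma deg_le_bareDeg_add_triDeg (v : V) : deg G v ≤ bareDeg G v + triDeg G v := by
  unfold deg bareDeg triDeg
  rw [← Finset.sum_add_distrib]
  refine Finset.sum_le_sum fun y _ => ?_
  by_cases h : G.Adj v y
  · rw [adjInd_of_adj h]
    have h0 := cod_nonneg (G := G) v y
    by_cases hc : cod G v y = 0
    · simp [bareInd, h, hc]
    · have := bareInd_nonneg (G := G) v y
      omega
  · rw [adjInd_of_not_adj h]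
    have := bareInd_nonneg (G := G) v y
    omega

/-- If the deletion of a vertex of an extremal graph leaves an extremal graph. -/
lemma isKPlus_of_drop_eq {k : ℕ} (hk : 2 ≤ k) (hn : Fintype.card V = 4 * k + 1)
    (hex : excess G = 12 * (2 * k ^ 2 + 2 * k)) {v : V} (hv : drop G v = 12 * k) :
    ∃ A : Finset V, IsKPlus G A ∧ (A.card = 2 * k ∨ A.card = 2 * k + 1) := by
  classical
  have h1 := excess_eq_remove (G := G) v
  have hcard := card_ne_eq hn v
  have h2 : excess (G.comap (Subtype.val : {w // w ≠ v} → V)) =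
      12 * ((Fintype.card {w // w ≠ v} + 1) ^ 2 / 8 : ℕ) := by
    rw [hcard, max_four_mul]
    push_cast
    unfold drop at hv
    linarith
  obtain ⟨h0, A₀, hA₀, heven, hcA⟩ := isKPlus_of_even (by rw [hcard]; exact ⟨2 * k, by ring⟩)
    (by omega) h2
  have hA0card : A₀.card = 2 * k := by
    obtain ⟨r, hr⟩ := heven
    omega
  have hB0card : (A₀ᶜ).card = 2 * k := by
    rw [Finset.card_compl]; omega
  obtain ⟨b₀, hb₀⟩ : (A₀ᶜ).Nonempty := by rw [← Finset.card_pos]; omega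
  rw [Finset.mem_compl] at hb₀
  let A : Finset V := A₀.map ⟨Subtype.val, Subtype.val_injective⟩
  let B : Finset V := (A₀ᶜ).map ⟨Subtype.val, Subtype.val_injective⟩
  have hAcard : A.card = 2 * k := by rw [Finset.card_map, hA0card]
  have hBcard : B.card = 2 * k := by rw [Finset.card_map, hB0card]
  have memA : ∀ w : {w // w ≠ v}, w.1 ∈ A ↔ w ∈ A₀ := by
    intro w; simp [A]
  have memB : ∀ w : {w // w ≠ v}, w.1 ∈ B ↔ w ∉ A₀ := by
    intro w; simp [B]
  have hvA : v ∉ A := by simp [A]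
  have hvB : v ∉ B := by simp [B]
  have hcov : ∀ w, w ≠ v → w ∈ A ∨ w ∈ B := by
    intro w hw
    by_cases h : (⟨w, hw⟩ : {w // w ≠ v}) ∈ A₀
    · exact Or.inl ((memA ⟨w, hw⟩).2 h)
    · exact Or.inr ((memB ⟨w, hw⟩).2 h)
  have hne : ∀ {w}, w ∈ A ∨ w ∈ B → w ≠ v := by
    rintro w (h | h) rfl
    · exact hvA h
    · exact hvB h
  have indep : ∀ x ∈ B, ∀ y ∈ B, ¬ G.Adj x y := fun x hx y hy =>
    hA₀.indep ⟨x, hne (Or.inr hx)⟩ ((memB ⟨x, _⟩).1 hx) ⟨y, hne (Or.inr hy)⟩ ((memB ⟨y, _⟩).1 hy)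
  have join : ∀ x ∈ A, ∀ y ∈ B, G.Adj x y := fun x hx y hy =>
    hA₀.join ⟨x, hne (Or.inl hx)⟩ ((memA ⟨x, _⟩).1 hx) ⟨y, hne (Or.inr hy)⟩ ((memB ⟨y, _⟩).1 hy)
  have matching : ∀ x ∈ A, ∀ y ∈ A, ∀ z ∈ A, G.Adj x y → G.Adj x z → y = z := by
    intro x hx y hy z hz hxy hxz
    have := hA₀.matching ⟨x, hne (Or.inl hx)⟩ ((memA ⟨x, _⟩).1 hx) ⟨y, hne (Or.inl hy)⟩
      ((memA ⟨y, _⟩).1 hy) ⟨z, hne (Or.inl hz)⟩ ((memA ⟨z, _⟩).1 hz) hxy hxz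
    simpa using this
  have perfect : ∀ x ∈ A, ∃ y ∈ A, G.Adj x y := by
    intro x hx
    obtain ⟨c, hc, hxc⟩ := hA₀.exists_partner h0 hb₀ ((memA ⟨x, hne (Or.inl hx)⟩).1 hx)
    exact ⟨c.1, (memA c).2 hc, hxc⟩
  -- In the remaining K⁺ every edge already has a triangle avoiding `v`.
  have hlost : lostDeg G v = 0 := by
    refine lostDeg_eq_zero fun y z h hc => ?_
    have hyz : (G.comap (Subtype.val : {w // w ≠ v} → V)).Adj ⟨y, h.1.ne'⟩ ⟨z, h.2.2.ne'⟩ := h.2.1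
    obtain ⟨w, hw⟩ := exists_tri_of_bareSum h0 hyz
    exact w.2 (eq_of_cod_eq_one hc hw.2.2 hw.2.1 h.1.symm h.2.2.symm)
  unfold drop at hv
  rw [hlost] at hv
  have hbare := bareDeg_nonneg (G := G) v
  let U := A.filter fun x => G.Adj v x
  let C := B.filter fun x => G.Adj v x
  have hdeg : deg G v = U.card + C.card := by
    rw [deg_eq_card, ← Nat.cast_add, ← Finset.card_union_of_disjoint]
    · congr 2
      ext w
      simp only [U, C, Finset.mem_filter, Finset.mem_univ, true_and, Finset.mem_union]
      constructor
      · intro h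
        rcases hcov w h.ne' with h' | h'
        · exact Or.inl ⟨h', h⟩
        · exact Or.inr ⟨h', h⟩
      · rintro (h | h)
        · exact h.2
        · exact h.2
    · rw [Finset.disjoint_left]
      intro w hw hw'
      simp only [U, C, Finset.mem_filter] at hw hw'
      exact indep w hw'.1 w hw'.1 |> fun _ => G.irrefl (join w hw.1 w hw'.1)
  have htri : 2 * (U.card * C.card : ℤ) ≤ triDeg G v :=
    two_mul_card_mul_card_le_triDeg (fun x hx => (Finset.mem_filter.1 hx).2)
      (fun x hx => (Finset.mem_filter.1 hx).2)
      (fun x hx y hy => join x (Finset.mem_filter.1 hx).1 y (Finset.mem_filter.1 hy).1)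
  have hsum := deg_le_bareDeg_add_triDeg (G := G) v
  have hU : U.card ≤ 2 * k := hAcard ▸ Finset.card_filter_le _ _
  have hC : C.card ≤ 2 * k := hBcard ▸ Finset.card_filter_le _ _
  -- The drop condition reads 2 deg - bare - tri = 2k, and deg ≤ bare + tri gives deg ≥ 2k. So if
  -- `v` has neighbours on one side only, it sees all of that side: with neighbours only in `A` it
  -- joins the independent side, with neighbours only in `B` it becomes the unmatched vertex.
  by_cases hC0 : C.card = 0
  · have hUA : U = A := Finset.eq_of_subset_of_card_le (Finset.filter_subset _ _) (by omega)
    have hvadj : ∀ a ∈ A, G.Adj v a := by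
      intro a ha
      rw [← hUA] at ha
      exact (Finset.mem_filter.1 ha).2
    have hvnot : ∀ b ∈ B, ¬ G.Adj v b := by
      intro b hb hvb
      have : b ∈ C := Finset.mem_filter.2 ⟨hb, hvb⟩
      rw [Finset.card_eq_zero.1 hC0] at this
      simp at this
    have hnotA : ∀ x, x ∉ A → x = v ∨ x ∈ B := by
      intro x hx
      by_cases hxv : x = v
      · exact Or.inl hxv
      · exact Or.inr ((hcov x hxv).resolve_left hx)
    refine ⟨A, ⟨?_, ?_, matching, ?_⟩, Or.inl hAcard⟩
    · intro x hx y hy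
      rcases hnotA x hx with rfl | hx <;> rcases hnotA y hy with rfl | hy
      · exact G.irrefl
      · exact hvnot y hy
      · exact fun h => hvnot x hx h.symm
      · exact indep x hx y hy
    · intro x hx y hy
      rcases hnotA y hy with rfl | hy
      · exact (hvadj x hx).symm
      · exact join x hx y hy
    · intro x hx y hy h _
      obtain ⟨c, hc, hxc⟩ := perfect x hx
      exact absurd hxc (h c hc)
  · by_cases hU0 : U.card = 0
    · have hCB : C = B := Finset.eq_of_subset_of_card_le (Finset.filter_subset _ _) (by omega)
      have hvadj : ∀ b ∈ B, G.Adj v b := by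
        intro a ha
        rw [← hCB] at ha
        exact (Finset.mem_filter.1 ha).2
      have hvnot : ∀ a ∈ A, ¬ G.Adj v a := by
        intro b hb hvb
        have : b ∈ U := Finset.mem_filter.2 ⟨hb, hvb⟩
        rw [Finset.card_eq_zero.1 hU0] at this
        simp at this
      have hnot : ∀ x, x ∉ insert v A → x ∈ B := by
        intro x hx
        rw [Finset.mem_insert, not_or] at hx
        exact (hcov x hx.1).resolve_left hx.2
      refine ⟨insert v A, ⟨?_, ?_, ?_, ?_⟩, Or.inr (by rw [Finset.card_insert_of_notMem hvA, hAcard])⟩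
      · intro x hx y hy
        exact indep x (hnot x hx) y (hnot y hy)
      · intro x hx y hy
        rcases Finset.mem_insert.1 hx with rfl | hx
        · exact hvadj y (hnot y hy)
        · exact join x hx y (hnot y hy)
      · intro x hx y hy z hz hxy hxz
        rcases Finset.mem_insert.1 hx with rfl | hx
        · rcases Finset.mem_insert.1 hy with rfl | hy
          · exact absurd hxy G.irrefl
          · exact absurd hxy (hvnot y hy)
        · rcases Finset.mem_insert.1 hy with rfl | hy
          · exact absurd hxy.symm (hvnot x hx)
          · rcases Finset.mem_insert.1 hz with rfl | hz
            · exact absurd hxz.symm (hvnot x hx)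
            · exact matching x hx y hy z hz hxy hxz
      · have key : ∀ x ∈ insert v A, (∀ z ∈ insert v A, ¬ G.Adj x z) → x = v := by
          intro x hx h
          rcases Finset.mem_insert.1 hx with rfl | hx
          · rfl
          · obtain ⟨c, hc, hxc⟩ := perfect x hx
            exact absurd hxc (h c (Finset.mem_insert_of_mem hc))
        intro x hx y hy h h'
        rw [key x hx h, key y hy h']
    -- With u, c ≥ 1 neighbours on the two sides, k ≤ u + c - uc = 1 - (u-1)(c-1) ≤ 1.
    · exfalso
      have hU1 : (1 : ℤ) ≤ U.card := by omega
      have hC1 : (1 : ℤ) ≤ C.card := by omega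
      have hk' : (2 : ℤ) ≤ k := by exact_mod_cast hk
      have : (0 : ℤ) ≤ (U.card - 1) * (C.card - 1) := mul_nonneg (by omega) (by omega)
      nlinarith

end Reductions
end LayerDomination

namespace LayerDomination

/-! ### Adding a twin, or an adjacent pair over an independent set -/

section Additions

set_option linter.unusedSectionVars false

variable {V : Type*} [Fintype V] {G G' : SimpleGraph V}

open Classical in
lemma adjInd_addVertex (U : Set V) (x : V) :
    adjInd (addVertex G U) none (some x) = if x ∈ U then 1 else 0 := by
  by_cases h : x ∈ U
  · rw [if_pos h]; exact adjInd_of_adj h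
  · rw [if_neg h]; exact adjInd_of_not_adj h

/-- The new vertex is a non-adjacent twin of `w`. Edges inside the neighbourhood already form
triangles with `w`, so no old bare edge is repaired and `lostDeg` does not contribute. -/
lemma excess_twin (w : V) :
    excess (addVertex G {x | G.Adj w x}) = excess G + gain G w := by
  classical
  have hc : ∀ x, adjInd (addVertex G {x | G.Adj w x}) none (some x) = adjInd G w x := fun x => by
    rw [adjInd_addVertex]; rfl
  rw [excess_option, comap_addVertex, deg_none, triDeg_none, bareDeg_none, lostDeg_none,
    comap_addVertex]
  simp only [hc]
  have h1 : ∑ x, ∑ y, adjInd G w x * adjInd G w y * adjInd G x y = triDeg G w := by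
    unfold triDeg
    refine Finset.sum_congr rfl fun x _ => ?_
    rw [cod, Finset.mul_sum]
    exact Finset.sum_congr rfl fun y _ => by ring
  have h2 : ∑ x, bareInd (addVertex G {x | G.Adj w x}) none (some x) = bareDeg G w := by
    refine Finset.sum_congr rfl fun x _ => ?_
    have : cod (addVertex G {x | G.Adj w x}) none (some x) = cod G w x := by
      rw [cod_none_some, comap_addVertex]
      simp only [hc]
      rfl
    unfold bareInd
    rw [this]
    rfl
  have h3 : ∑ x, ∑ y, adjInd G w x * adjInd G w y * bareInd G x y = 0 := by
    refine Finset.sum_eq_zero fun x _ => Finset.sum_eq_zero fun y _ => ?_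
    by_cases hx : G.Adj w x
    · by_cases hy : G.Adj w y
      · have := cod_pos hx.symm hy.symm
        have : ¬ (G.Adj x y ∧ cod G x y = 0) := by omega
        simp [bareInd, this]
      · simp [adjInd_of_not_adj hy]
    · simp [adjInd_of_not_adj hx]
  rw [h1, h2, h3]
  unfold gain deg
  ring

lemma gain_le {k : ℕ} (hn : Fintype.card V = 4 * k + 1)
    (hex : excess G = 12 * (2 * k ^ 2 + 2 * k)) (w : V) : gain G w ≤ 12 * (k + 1) := by
  have h1 := excess_twin (G := G) w
  have h2 := excess_le (G := addVertex G {x | G.Adj w x})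
  rw [Fintype.card_option, hn, max_four_mul_add_two] at h2
  push_cast at h2
  linarith

/-- If the duplication of a vertex of an extremal graph yields an extremal graph. -/
lemma isKPlus_of_gain_eq {k : ℕ} (hk : 1 ≤ k) (hn : Fintype.card V = 4 * k + 1)
    (hex : excess G = 12 * (2 * k ^ 2 + 2 * k)) {w : V} (hw : gain G w = 12 * (k + 1)) :
    ∃ A : Finset V, IsKPlus G A ∧ A.card = 2 * k + 2 := by
  classical
  have hcard : Fintype.card (Option V) = 4 * k + 2 := by rw [Fintype.card_option, hn]
  have h2 : excess (addVertex G {x | G.Adj w x}) =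
      12 * ((Fintype.card (Option V) + 1) ^ 2 / 8 : ℕ) := by
    rw [excess_twin, hw, hex, Fintype.card_option, hn, max_four_mul_add_two]
    push_cast
    ring
  obtain ⟨h0, A', hA', ⟨r, hr⟩, hc⟩ :=
    isKPlus_of_even (by rw [hcard]; exact ⟨2 * k + 1, by ring⟩) (by omega) h2
  have hA'card : A'.card = 2 * k + 2 := by omega
  obtain ⟨b, hb⟩ : (A'ᶜ).Nonempty := by
    rw [← Finset.card_pos, Finset.card_compl]; omega
  rw [Finset.mem_compl] at hb
  -- If the twin were on the matched side, so would be `w`, to which it is not adjacent; the partner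
  -- of the twin is also adjacent to `w` and would have two partners.
  have hnone : none ∉ A' := by
    intro hmem
    have hwA : some w ∈ A' := by
      by_contra hwA
      have h3 : w ∈ {x | G.Adj w x} := hA'.join none hmem _ hwA
      exact G.irrefl h3
    obtain ⟨p, hp, hnp⟩ := hA'.exists_partner h0 hb hmem
    cases p with
    | none => exact (SimpleGraph.irrefl _) hnp
    | some q =>
      have h3 : (addVertex G {x | G.Adj w x}).Adj (some q) (some w) := SimpleGraph.Adj.symm hnp
      have := hA'.matching (some q) hp (some w) hwA none hmem h3 hnp.symm
      simp at this
  have hcomap := hA'.comap (V := V) Function.Embedding.some (by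
    intro x _ y hy _
    cases y with
    | none => exact absurd hy hnone
    | some q => exact ⟨q, rfl⟩) (B := A'.preimage some (Option.some_injective _).injOn)
    (by intro x; simp)
  have hG : (addVertex G {x | G.Adj w x}).comap (Function.Embedding.some : V ↪ Option V) = G :=
    comap_addVertex _
  rw [hG] at hcomap
  refine ⟨_, hcomap, ?_⟩
  rw [← hA'card]
  refine Finset.card_nbij some (by intro x; simp) (Option.some_injective _).injOn ?_
  intro y hy
  cases y with
  | none => exact absurd hy hnone
  | some q => exact ⟨q, by simpa using hy, rfl⟩

/-- The effect of adding two adjacent vertices joined to an independent set. -/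
lemma excess_add_pair (I : Finset V) (hI : ∀ x ∈ I, ∀ y ∈ I, ¬ G.Adj x y) (hne : I.Nonempty) :
    excess (addVertex (addVertex G (I : Set V)) {o | ∀ x, o = some x → x ∈ I}) =
      excess G + 12 * (I.card + 1) := by
  classical
  set G₁ := addVertex G (I : Set V) with hG₁
  set J : Set (Option V) := {o | ∀ x, o = some x → x ∈ I} with hJ
  have hnoneJ : none ∈ J := by simp [hJ]
  have hsomeJ : ∀ x, some x ∈ J ↔ x ∈ I := by simp [hJ]
  have c1 : ∀ x, adjInd G₁ none (some x) = if x ∈ I then 1 else 0 := fun x => by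
    rw [hG₁, adjInd_addVertex]; simp
  have zero1 : ∀ x y, (if x ∈ I then (1 : ℤ) else 0) * (if y ∈ I then 1 else 0) * adjInd G x y = 0 := by
    intro x y
    by_cases hx : x ∈ I
    · by_cases hy : y ∈ I
      · simp [adjInd_of_not_adj (hI x hx y hy)]
      · simp [hy]
    · simp [hx]
  have zero2 : ∀ x y, (if x ∈ I then (1 : ℤ) else 0) * (if y ∈ I then 1 else 0) * bareInd G x y = 0 := by
    intro x y
    by_cases hx : x ∈ I
    · by_cases hy : y ∈ I
      · simp [bareInd, hI x hx y hy]
      · simp [hy]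
    · simp [hx]
  have b1 : ∀ x, bareInd G₁ none (some x) = if x ∈ I then 1 else 0 := by
    intro x
    by_cases hx : x ∈ I
    · have h1 : G₁.Adj none (some x) := hx
      have h2 : cod G₁ none (some x) = 0 := by
        rw [cod_none_some, hG₁, comap_addVertex]
        refine Finset.sum_eq_zero fun y _ => ?_
        rw [← hG₁, c1]
        by_cases hy : y ∈ I
        · simp [adjInd_of_not_adj (hI x hx y hy)]
        · simp [hy]
      simp [bareInd, h1, h2, hx]
    · have h1 : ¬ G₁.Adj none (some x) := hx
      simp [bareInd, h1, hx]
  have hsumI : ∑ x : V, (if x ∈ I then (1 : ℤ) else 0) = I.card := by simp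
  -- Over an independent set the edges at the first new vertex are all bare, so each counts 12 - 6.
  have e1 : excess G₁ = excess G + 6 * I.card := by
    rw [excess_option, deg_none, triDeg_none, bareDeg_none, lostDeg_none]
    simp only [c1, b1, hsumI]
    rw [hG₁, comap_addVertex]
    simp only [zero1, zero2, Finset.sum_const_zero]
    ring
  set G₂ := addVertex G₁ J with hG₂
  have c2n : adjInd G₂ none (some none) = 1 := by rw [hG₂, adjInd_addVertex, if_pos hnoneJ]
  have c2s : ∀ x, adjInd G₂ none (some (some x)) = if x ∈ I then 1 else 0 := fun x => by
    rw [hG₂, adjInd_addVertex]; simp [hsomeJ]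
  have hcomap : G₂.comap some = G₁ := comap_addVertex _
  have b2 : bareDeg G₂ none = 0 := by
    rw [bareDeg_none]
    refine Finset.sum_eq_zero fun o _ => ?_
    have : G₂.Adj none (some o) → cod G₂ none (some o) ≠ 0 := by
      intro ho
      cases o with
      | none =>
        obtain ⟨i, hi⟩ := hne
        have h1 : G₂.Adj none (some (some i)) := (hsomeJ i).2 hi
        have h2 : G₂.Adj (some none) (some (some i)) := hi
        have := cod_pos h1 h2
        omega
      | some x =>
        have hx : x ∈ I := (hsomeJ x).1 ho
        have h1 : G₂.Adj none (some none) := hnoneJ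
        have h2 : G₂.Adj (some (some x)) (some none) := hx
        have := cod_pos h1 h2
        omega
    have h3 : ¬ (G₂.Adj none (some o) ∧ cod G₂ none (some o) = 0) := fun h => this h.1 h.2
    simp [bareInd, h3]
  have d2 : deg G₂ none = I.card + 1 := by
    rw [deg_none, Fintype.sum_option, c2n]
    simp only [c2s, hsumI]
    ring
  have hsq : ∀ x, (if x ∈ I then (1 : ℤ) else 0) * (if x ∈ I then 1 else 0) =
    if x ∈ I then 1 else 0 := fun x => by split_ifs <;> simp
  have t2 : triDeg G₂ none = 2 * I.card := by
    rw [triDeg_none, hcomap]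
    simp only [Fintype.sum_option, c2n, c2s, adjInd_self, c1, adjInd_comm (some _) none, mul_one,
      one_mul, mul_zero, zero_add, Finset.sum_add_distrib, hsq, hsumI, ← adjInd_comap_some]
    rw [hG₁, comap_addVertex]
    simp only [zero1, Finset.sum_const_zero]
    ring
  have l2 : lostDeg G₂ none = 2 * I.card := by
    have hz : ∀ x y, (if x ∈ I then (1 : ℤ) else 0) * (if y ∈ I then 1 else 0) *
        bareInd G₁ (some x) (some y) = 0 := by
      intro x y
      by_cases hx : x ∈ I
      · by_cases hy : y ∈ I
        · have : ¬ G₁.Adj (some x) (some y) := hI x hx y hy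
          simp [bareInd, this]
        · simp [hy]
      · simp [hx]
    rw [lostDeg_none, hcomap]
    simp only [Fintype.sum_option, c2n, c2s, bareInd_self, b1, bareInd_comm (some _) none, mul_one,
      one_mul, mul_zero, zero_add, Finset.sum_add_distrib, hsq, hsumI, hz, Finset.sum_const_zero]
    ring
  -- The second vertex contributes 12(|I|+1) - 12|I| + 6|I|: its triangles repair all the bare edges
  -- created by the first.
  rw [excess_option, hcomap, b2, d2, t2, l2, e1]
  ring

/-- An independent set that is as large as possible. -/
lemma isKPlus_of_indep {k : ℕ} (hk : 1 ≤ k) (hn : Fintype.card V = 4 * k + 1)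
    (hex : excess G = 12 * (2 * k ^ 2 + 2 * k)) (I : Finset V)
    (hI : ∀ x ∈ I, ∀ y ∈ I, ¬ G.Adj x y) (hIc : 2 * k + 1 ≤ I.card) :
    ∃ A : Finset V, IsKPlus G A ∧ A.card = 2 * k := by
  classical
  have hpos : 0 < I.card := by omega
  have h1 := excess_add_pair I hI (Finset.card_pos.1 hpos)
  set K := addVertex (addVertex G (I : Set V)) {o | ∀ x, o = some x → x ∈ I} with hK
  have hcard : Fintype.card (Option (Option V)) = 4 * k + 1 + 1 + 1 := by
    rw [Fintype.card_option, Fintype.card_option, hn]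
  -- The maxima for 4k+1 and 4k+3 vertices differ by 12(2k+2), which is what |I| ≥ 2k+1 supplies.
  have h2 : excess K = 12 * ((Fintype.card (Option (Option V)) + 1) ^ 2 / 8 : ℕ) := by
    have h3 := excess_le (G := K)
    rw [hcard, max_four_mul_add_three] at h3 ⊢
    push_cast at h3 ⊢
    refine le_antisymm h3 ?_
    rw [h1, hex]
    have : (2 * k + 1 : ℤ) ≤ I.card := by exact_mod_cast hIc
    linarith
  obtain ⟨A', hA', hc⟩ := isKPlus_of_three_mod_four (by omega) h2
  have hA'card : A'.card = 2 * k + 2 := by omega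
  have hab : K.Adj none (some none) := by
    change none ∈ {o : Option V | ∀ x, o = some x → x ∈ I}
    simp
  have hai : ∀ i ∈ I, K.Adj none (some (some i)) := by
    intro i hi
    change some i ∈ {o : Option V | ∀ x, o = some x → x ∈ I}
    simpa using hi
  have hbi : ∀ i ∈ I, K.Adj (some none) (some (some i)) := fun i hi => hi
  obtain ⟨i, hi, j, hj, hij⟩ := Finset.one_lt_card.1 (by omega : 1 < I.card)
  have hsome : ∀ {x y : V}, (some (some x) : Option (Option V)) = some (some y) → x = y := by
    intro x y h; simpa using h
  -- Were one of the new vertices on the independent side, all of `I` would be matched to the other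
  -- one, but `I` has two elements. So the new vertices form a matched pair, which can be removed.
  have hb : some none ∈ A' := by
    by_contra hb
    have ha : none ∈ A' := by
      by_contra ha
      exact hA'.indep _ ha _ hb hab
    have hiA : ∀ i ∈ I, some (some i) ∈ A' := by
      intro i hi
      by_contra h
      exact hA'.indep _ hb _ h (hbi i hi)
    exact hij (hsome (hA'.matching none ha _ (hiA i hi) _ (hiA j hj) (hai i hi) (hai j hj)))
  have ha : none ∈ A' := by
    by_contra ha
    have hiA : ∀ i ∈ I, some (some i) ∈ A' := by
      intro i hi
      by_contra h
      exact hA'.indep _ ha _ h (hai i hi)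
    exact hij (hsome (hA'.matching _ hb _ (hiA i hi) _ (hiA j hj) (hbi i hi) (hbi j hj)))
  let f : V ↪ Option (Option V) :=
    ⟨fun x => some (some x), fun x y h => hsome h⟩
  have hf : ∀ x, f x = some (some x) := fun _ => rfl
  have hcomap := hA'.comap f (by
    intro x hx y hy hxy
    rcases y with _ | _ | y
    · have h3 := hA'.matching none ha _ hx _ hb hxy.symm hab
      simp [hf] at h3
    · have h3 := hA'.matching (some none) hb _ hx _ ha hxy.symm hab.symm
      simp [hf] at h3
    · exact ⟨y, rfl⟩) (B := A'.preimage f f.injective.injOn) (by intro x; simp)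
  have hG : K.comap f = G := by
    ext x y
    rfl
  rw [hG] at hcomap
  refine ⟨_, hcomap, ?_⟩
  have hmap : (A'.preimage f f.injective.injOn).map f = (A'.erase none).erase (some none) := by
    ext o
    simp only [Finset.mem_map, Finset.mem_preimage, Finset.mem_erase]
    constructor
    · rintro ⟨x, hx, rfl⟩
      exact ⟨by simp [hf], by simp [hf], hx⟩
    · rintro ⟨h3, h4, h5⟩
      rcases o with _ | _ | o
      · exact absurd rfl h4
      · exact absurd rfl h3
      · exact ⟨o, h5, rfl⟩
  have := congrArg Finset.card hmap
  rw [Finset.card_map, Finset.card_erase_of_mem (by simp [hb]), Finset.card_erase_of_mem ha,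
    hA'card] at this
  omega

end Additions
end LayerDomination

namespace LayerDomination

/-! ### Adding or deleting an edge -/

section Edges

set_option linter.unusedSectionVars false

variable {V : Type*} [Fintype V] {G G' : SimpleGraph V}

/-- `G'` arises from `G` by adding the edge `xy`. -/
structure IsAddEdge (G G' : SimpleGraph V) (x y : V) : Prop where
  ne : x ≠ y
  not_adj : ¬ G.Adj x y
  adj_iff : ∀ u v, G'.Adj u v ↔ G.Adj u v ∨ (u = x ∧ v = y) ∨ (u = y ∧ v = x)

open Classical in
lemma IsAddEdge.adjInd_eq {x y : V} (h : IsAddEdge G G' x y) (u v : V) :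
    adjInd G' u v = adjInd G u v + (if u = x then (if v = y then 1 else 0) else 0) +
      (if u = y then (if v = x then 1 else 0) else 0) := by
  have hxy := h.ne
  have hyx := h.ne.symm
  have h2 : ¬ G.Adj y x := fun h' => h.not_adj h'.symm
  by_cases hux : u = x
  · subst hux
    by_cases hv : v = y
    · subst hv
      simp [adjInd, h.adj_iff, hxy, h.not_adj]
    · simp [adjInd, h.adj_iff, hxy, hv]
  · by_cases huy : u = y
    · subst huy
      by_cases hv : v = x
      · subst hv
        simp [adjInd, h.adj_iff, hux, h2]
      · simp [adjInd, h.adj_iff, hux, hv]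
    · simp [adjInd, h.adj_iff, hux, huy]

open Classical in
lemma IsAddEdge.cod_eq {x y : V} (h : IsAddEdge G G' x y) {u v : V} (huv : u ≠ v) :
    cod G' u v = cod G u v + (if u = x then adjInd G v y else 0) +
      (if u = y then adjInd G v x else 0) + (if v = x then adjInd G u y else 0) +
      (if v = y then adjInd G u x else 0) := by
  have hxy := h.ne
  have hyx := h.ne.symm
  unfold cod
  simp only [h.adjInd_eq, add_mul, mul_add, Finset.sum_add_distrib]
  have e1 : ∀ (p q : V) (f : V → ℤ), ∑ z, (if p = x then (if z = y then 1 else 0) else 0) * f z =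
      if p = x then f y else 0 := by
    intro p q f; split_ifs <;> simp
  have e2 : ∀ (p q : V) (f : V → ℤ), ∑ z, (if p = y then (if z = x then 1 else 0) else 0) * f z =
      if p = y then f x else 0 := by
    intro p q f; split_ifs <;> simp
  have e3 : ∀ (p q : V) (f : V → ℤ), ∑ z, f z * (if p = x then (if z = y then 1 else 0) else 0) =
      if p = x then f y else 0 := by
    intro p q f; split_ifs <;> simp
  have e4 : ∀ (p q : V) (f : V → ℤ), ∑ z, f z * (if p = y then (if z = x then 1 else 0) else 0) =
      if p = y then f x else 0 := by
    intro p q f; split_ifs <;> simp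
  rw [e1 u u, e2 u u, e3 v v, e4 v v, e1 u u, e2 u u, e1 u u, e2 u u]
  have z1 : (if u = x then (if v = x then (if y = y then (1:ℤ) else 0) else 0) else 0) = 0 := by
    split_ifs with h1 h2 <;> first | rfl | exact absurd (h1.trans h2.symm) huv
  have z2 : (if u = y then (if v = y then (if x = x then (1:ℤ) else 0) else 0) else 0) = 0 := by
    split_ifs with h1 h2 <;> first | rfl | exact absurd (h1.trans h2.symm) huv
  have z3 : (if u = x then (if v = y then (if y = x then (1:ℤ) else 0) else 0) else 0) = 0 := by
    simp [hyx]
  have z4 : (if u = y then (if v = x then (if x = y then (1:ℤ) else 0) else 0) else 0) = 0 := by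
    simp [hxy]
  rw [z1, z2, z3, z4]
  ring

lemma adjInd_mul_bareInd (x y : V) : adjInd G x y * bareInd G x y = bareInd G x y := by
  by_cases h : G.Adj x y
  · simp [adjInd_of_adj h]
  · simp [bareInd, h]

open Classical in
lemma IsAddEdge.bareInd_eq {x y : V} (h : IsAddEdge G G' x y) (u v : V) :
    bareInd G' u v = bareInd G u v +
      (if u = x then (if v = y then (if cod G x y = 0 then 1 else 0) else 0) else 0) +
      (if u = y then (if v = x then (if cod G x y = 0 then 1 else 0) else 0) else 0) -
      (if u = x then adjInd G y v * bareInd G x v else 0) -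
      (if v = x then adjInd G y u * bareInd G x u else 0) -
      (if u = y then adjInd G x v * bareInd G y v else 0) -
      (if v = y then adjInd G x u * bareInd G y u else 0) := by
  have hxy := h.ne
  have hyx := h.ne.symm
  have hnb : bareInd G x y = 0 := by simp [bareInd, h.not_adj]
  have hnb' : bareInd G y x = 0 := by rw [bareInd_comm, hnb]
  by_cases huv : u = v
  · subst huv
    rw [bareInd_self, bareInd_self]
    have e1 : adjInd G y x * bareInd G x x = 0 := by rw [bareInd_self, mul_zero]
    have e2 : adjInd G x y * bareInd G y y = 0 := by rw [bareInd_self, mul_zero]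
    by_cases hux : u = x
    · subst hux; simp [hxy, bareInd_self]
    · by_cases huy : u = y
      · subst huy; simp [hyx, bareInd_self]
      · simp [hux, huy]
  have key : ∀ (p q : V) (c : ℤ), (G'.Adj p q ↔ G.Adj p q) → (c = 0 ∨ c = 1) →
      cod G' p q = cod G p q + c → bareInd G' p q = bareInd G p q - c * bareInd G p q := by
    intro p q c h1 h2 h3
    have h4 := cod_nonneg (G := G) p q
    unfold bareInd
    rcases h2 with rfl | rfl
    · rw [h3, add_zero, zero_mul, sub_zero]
      exact if_congr (by rw [h1]) rfl rfl
    · rw [if_neg (by omega)]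
      ring
  have h01 : ∀ p q : V, adjInd G p q = 0 ∨ adjInd G p q = 1 := by
    intro p q
    have := adjInd_nonneg (G := G) p q
    have := adjInd_le_one (G := G) p q
    omega
  have hcod := h.cod_eq huv
  have hadj := h.adj_iff u v
  by_cases hux : u = x
  · subst hux
    by_cases hvy : v = y
    · subst hvy
      simp only [if_true, hxy, hyx, if_false, adjInd_self, add_zero] at hcod
      have h1 : G'.Adj u v := hadj.2 (by simp)
      simp only [if_true, hxy, hyx, if_false, adjInd_self, zero_mul, sub_zero, add_zero, hnb,
        zero_add]
      unfold bareInd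
      rw [hcod]
      exact if_congr (by simp [h1]) rfl rfl
    · have hvx : v ≠ u := Ne.symm huv
      simp only [if_true, hxy, hvx, hvy, if_false, add_zero] at hcod
      simp only [if_true, hxy, hvx, hvy, if_false, add_zero, sub_zero]
      rw [adjInd_comm y v]
      exact key u v _ (by rw [hadj]; simp [hvy, hxy]) (h01 _ _) hcod
  · by_cases huy : u = y
    · subst huy
      by_cases hvx : v = x
      · subst hvx
        simp only [if_true, hxy, hyx, if_false, adjInd_self, add_zero] at hcod
        have h1 : G'.Adj u v := hadj.2 (by simp)
        simp only [if_true, hxy, hyx, if_false, adjInd_self, zero_mul, sub_zero, add_zero, hnb',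
          zero_add]
        unfold bareInd
        rw [hcod, cod_comm]
        exact if_congr (by simp [h1]) rfl rfl
      · have hvy : v ≠ u := Ne.symm huv
        simp only [if_true, hux, hvx, hvy, if_false, add_zero] at hcod
        simp only [if_true, hux, hvx, hvy, if_false, add_zero, sub_zero]
        rw [adjInd_comm x v]
        exact key u v _ (by rw [hadj]; simp [hvx, hux]) (h01 _ _) hcod
    · have hadj' : G'.Adj u v ↔ G.Adj u v := by rw [hadj]; simp [hux, huy]
      by_cases hvx : v = x
      · subst hvx
        simp only [if_true, hux, huy, hxy, if_false, add_zero] at hcod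
        simp only [if_true, hux, huy, hxy, if_false, add_zero, sub_zero]
        rw [adjInd_comm y u, bareInd_comm v u]
        exact key u v _ hadj' (h01 _ _) hcod
      · by_cases hvy : v = y
        · subst hvy
          simp only [if_true, hux, huy, hvx, if_false, add_zero] at hcod
          simp only [if_true, hux, huy, hvx, if_false, add_zero, sub_zero]
          rw [adjInd_comm x u, bareInd_comm v u]
          exact key u v _ hadj' (h01 _ _) hcod
        · simp only [hux, huy, hvx, hvy, if_false, add_zero] at hcod
          simp only [hux, huy, hvx, hvy, if_false, add_zero, sub_zero]
          have := key u v 0 hadj' (Or.inl rfl) (by rw [hcod, add_zero])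
          rw [this]; ring

open Classical in
/-- The effect of the addition of an edge. -/
lemma IsAddEdge.excess_eq {x y : V} (h : IsAddEdge G G' x y) :
    excess G' = excess G + 12 - 12 * cod G x y - 6 * (if cod G x y = 0 then 1 else 0) +
      6 * ∑ z, adjInd G x z * adjInd G y z * (bareInd G x z + bareInd G y z) := by
  have hxy := h.ne
  have hyx := h.ne.symm
  have hE : ∑ u, ∑ v, adjInd G' u v = ∑ u, ∑ v, adjInd G u v + 2 := by
    simp only [h.adjInd_eq, Finset.sum_add_distrib]
    have e1 : ∑ u : V, ∑ v : V, (if u = x then (if v = y then (1 : ℤ) else 0) else 0) = 1 := by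
      rw [Finset.sum_eq_single x] <;> simp +contextual
    have e2 : ∑ u : V, ∑ v : V, (if u = y then (if v = x then (1 : ℤ) else 0) else 0) = 1 := by
      rw [Finset.sum_eq_single y] <;> simp +contextual
    rw [e1, e2]; ring
  have hT : ∑ u, ∑ v, adjInd G' u v * cod G' u v =
      ∑ u, ∑ v, adjInd G u v * cod G u v + 6 * cod G x y := by
    have e : ∀ u v, adjInd G' u v * cod G' u v = adjInd G u v * cod G u v +
        (if u = x then adjInd G x v * adjInd G v y else 0) +
        (if u = y then adjInd G y v * adjInd G v x else 0) +
        (if v = x then adjInd G u x * adjInd G u y else 0) +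
        (if v = y then adjInd G u y * adjInd G u x else 0) +
        (if u = x then (if v = y then cod G x y else 0) else 0) +
        (if u = y then (if v = x then cod G x y else 0) else 0) := by
      intro u v
      have hnxy : adjInd G x y = 0 := adjInd_of_not_adj h.not_adj
      have hnyx : adjInd G y x = 0 := by rw [adjInd_comm, hnxy]
      by_cases huv : u = v
      · subst huv
        rw [adjInd_self, adjInd_self]
        by_cases hux : u = x
        · subst hux; simp [hxy]
        · by_cases huy : u = y
          · subst huy; simp [hyx]
          · simp [hux, huy]
      · rw [h.adjInd_eq, h.cod_eq huv]
        by_cases hux : u = x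
        · subst hux
          have hvu : v ≠ u := Ne.symm huv
          by_cases hvy : v = y
          · subst hvy; simp [hxy, hyx, hnxy]
          · simp [hxy, hvy, hvu]; ring
        · by_cases huy : u = y
          · subst huy
            have hvu : v ≠ u := Ne.symm huv
            by_cases hvx : v = x
            · subst hvx; simp [hxy, hyx, hnyx, cod_comm u v]
            · simp [hyx, hvx, hvu]; ring
          · by_cases hvx : v = x
            · subst hvx; simp [hux, huy, hxy]; ring
            · by_cases hvy : v = y
              · subst hvy; simp [hux, huy, hyx]; ring
              · simp [hux, huy, hvx, hvy]
    have s1 : ∑ u : V, ∑ v : V, (if u = x then adjInd G x v * adjInd G v y else 0) = cod G x y := by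
      rw [Finset.sum_eq_single x]
      · simp only [if_true, cod, adjInd_comm y]
      · intro u _ hu; simp [hu]
      · simp
    have s2 : ∑ u : V, ∑ v : V, (if u = y then adjInd G y v * adjInd G v x else 0) = cod G x y := by
      rw [Finset.sum_eq_single y]
      · simp only [if_true, cod, adjInd_comm x, mul_comm]
      · intro u _ hu; simp [hu]
      · simp
    have s3 : ∑ u : V, ∑ v : V, (if v = x then adjInd G u x * adjInd G u y else 0) = cod G x y := by
      simp only [Finset.sum_ite_eq', Finset.mem_univ, if_true, cod, adjInd_comm x, adjInd_comm y]
    have s4 : ∑ u : V, ∑ v : V, (if v = y then adjInd G u y * adjInd G u x else 0) = cod G x y := by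
      simp only [Finset.sum_ite_eq', Finset.mem_univ, if_true, cod, adjInd_comm x, adjInd_comm y,
        mul_comm]
    have s5 : ∑ u : V, ∑ v : V, (if u = x then (if v = y then cod G x y else 0) else 0) =
        cod G x y := by
      rw [Finset.sum_eq_single x] <;> simp +contextual
    have s6 : ∑ u : V, ∑ v : V, (if u = y then (if v = x then cod G x y else 0) else 0) =
        cod G x y := by
      rw [Finset.sum_eq_single y] <;> simp +contextual
    simp only [e, Finset.sum_add_distrib, s1, s2, s3, s4, s5, s6]
    ring
  have hB : ∑ u, ∑ v, bareInd G' u v = ∑ u, ∑ v, bareInd G u v +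
      2 * (if cod G x y = 0 then 1 else 0) -
      2 * ∑ z, adjInd G x z * adjInd G y z * (bareInd G x z + bareInd G y z) := by
    have s1 : ∑ u : V, ∑ v : V, (if u = x then adjInd G y v * bareInd G x v else 0) =
        ∑ z, adjInd G x z * adjInd G y z * bareInd G x z := by
      rw [Finset.sum_eq_single x]
      · simp only [if_true]
        refine Finset.sum_congr rfl fun v _ => ?_
        rw [← adjInd_mul_bareInd x v]; linear_combination
          - (adjInd G y v * bareInd G x v) * adjInd_mul_self (G := G) x v
      · intro u _ hu; simp [hu]
      · simp
    have s2 : ∑ u : V, ∑ v : V, (if v = x then adjInd G y u * bareInd G x u else 0) =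
        ∑ z, adjInd G x z * adjInd G y z * bareInd G x z := by
      rw [← s1, Finset.sum_comm]
    have s3 : ∑ u : V, ∑ v : V, (if u = y then adjInd G x v * bareInd G y v else 0) =
        ∑ z, adjInd G x z * adjInd G y z * bareInd G y z := by
      rw [Finset.sum_eq_single y]
      · simp only [if_true]
        refine Finset.sum_congr rfl fun v _ => ?_
        rw [← adjInd_mul_bareInd y v]; linear_combination
          - (adjInd G x v * bareInd G y v) * adjInd_mul_self (G := G) y v
      · intro u _ hu; simp [hu]
      · simp
    have s4 : ∑ u : V, ∑ v : V, (if v = y then adjInd G x u * bareInd G y u else 0) =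
        ∑ z, adjInd G x z * adjInd G y z * bareInd G y z := by
      rw [← s3, Finset.sum_comm]
    have s5 : ∑ u : V, ∑ v : V,
        (if u = x then (if v = y then (if cod G x y = 0 then (1 : ℤ) else 0) else 0) else 0) =
        if cod G x y = 0 then 1 else 0 := by
      rw [Finset.sum_eq_single x] <;> simp +contextual
    have s6 : ∑ u : V, ∑ v : V,
        (if u = y then (if v = x then (if cod G x y = 0 then (1 : ℤ) else 0) else 0) else 0) =
        if cod G x y = 0 then 1 else 0 := by
      rw [Finset.sum_eq_single y] <;> simp +contextual
    simp only [h.bareInd_eq, Finset.sum_add_distrib, Finset.sum_sub_distrib, s1, s2, s3, s4, s5, s6,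
      mul_add]
    ring
  unfold excess
  rw [hE, hT, hB]
  ring

/-- The deletion of an edge `xy` of a triangle whose other edges lie in several triangles does not
decrease the excess. -/
lemma IsAddEdge.excess_le_of_two_le_cod {x y z : V} (h : IsAddEdge G G' x y)
    (ht : IsTri G' x y z) (hx : 2 ≤ cod G' x z) (hy : 2 ≤ cod G' y z) : excess G' ≤ excess G := by
  classical
  have hzx : z ≠ x := ht.2.2.ne'
  have hzy : z ≠ y := ht.2.1.ne'
  have axz : G.Adj x z := by
    have := (h.adj_iff x z).1 ht.2.2
    simpa [hzx, hzy] using this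
  have ayz : G.Adj y z := by
    have := (h.adj_iff y z).1 ht.2.1
    simpa [hzx, hzy] using this
  have c1 : 1 ≤ cod G x z := by
    have := h.cod_eq (u := x) (v := z) hzx.symm
    simp only [if_true, h.ne, hzx, hzy, if_false] at this
    have := adjInd_le_one (G := G) z y
    omega
  have c2 : 1 ≤ cod G y z := by
    have := h.cod_eq (u := y) (v := z) hzy.symm
    simp only [if_true, h.ne.symm, hzx, hzy, if_false] at this
    have := adjInd_le_one (G := G) z x
    omega
  have hc : 1 ≤ cod G x y := cod_pos axz ayz
  have hb1 : ∀ u v : V, bareInd G u v ≤ 1 := by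
    intro u v; unfold bareInd; split_ifs <;> simp
  -- Each common neighbour has at most two bare edges to `x`, `y`, and `z` has none. With c common
  -- neighbours the edge changes the excess by at most 12 - 12c + 12(c-1) = 0.
  have hsum : ∑ w, adjInd G x w * adjInd G y w * (bareInd G x w + bareInd G y w) ≤
      2 * (cod G x y - 1) := by
    have e1 : ∀ w, adjInd G x w * adjInd G y w * (bareInd G x w + bareInd G y w) ≤
        2 * (adjInd G x w * adjInd G y w) - if w = z then 2 else 0 := by
      intro w
      by_cases hw : w = z
      · subst hw
        have b1 : bareInd G x w = 0 := by
          have : cod G x w ≠ 0 := by omega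
          simp [bareInd, this]
        have b2 : bareInd G y w = 0 := by
          have : cod G y w ≠ 0 := by omega
          simp [bareInd, this]
        simp [b1, b2, adjInd_of_adj axz, adjInd_of_adj ayz]
      · simp only [hw, if_false, sub_zero]
        have := mul_nonneg (adjInd_nonneg (G := G) x w) (adjInd_nonneg (G := G) y w)
        nlinarith [hb1 x w, hb1 y w]
    refine (Finset.sum_le_sum fun w _ => e1 w).trans ?_
    rw [Finset.sum_sub_distrib, ← Finset.mul_sum]
    simp only [Finset.sum_ite_eq', Finset.mem_univ, if_true]
    rw [cod]; linarith
  rw [h.excess_eq, if_neg (by omega)]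
  linarith

lemma bareInd_le_one (u v : V) : bareInd G u v ≤ 1 := by
  unfold bareInd; split_ifs <;> simp

/-- An extremal graph `K⁺` stays extremal under no addition of an edge. -/
lemma IsKPlus.excess_lt_of_isAddEdge {A : Finset V} (hA : IsKPlus G A) (hs : 4 ≤ A.card)
    (hN : A.card + 3 ≤ Fintype.card V) {x y : V} (h : IsAddEdge G G' x y) :
    excess G' < excess G := by
  classical
  rw [h.excess_eq]
  by_cases hx : x ∈ A
  · have hy : y ∈ A := by
      by_contra hy
      exact h.not_adj (hA.join x hx y hy)
    have hcod : cod G x y = (Aᶜ).card := by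
      rw [cod_eq_card]
      congr 2
      ext z
      simp only [Finset.mem_filter, Finset.mem_univ, true_and, Finset.mem_compl]
      constructor
      · intro hz hzA
        exact h.ne (hA.matching z hzA x hx y hy hz.1.symm hz.2.symm)
      · intro hz
        exact ⟨hA.join x hx z hz, hA.join y hy z hz⟩
    have hcard : (3 : ℤ) ≤ cod G x y := by
      rw [hcod, Finset.card_compl]; omega
    rw [if_neg (by omega)]
    -- Only the unmatched vertex has bare edges, and `x`, `y` are not both unmatched; so each common
    -- neighbour repairs at most one edge, and 12 - 6c < 0 as c ≥ 3.
    have hle : ∑ z, adjInd G x z * adjInd G y z * (bareInd G x z + bareInd G y z) ≤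
        cod G x y := by
      refine Finset.sum_le_sum fun z _ => ?_
      by_cases hxz : G.Adj x z
      · by_cases hyz : G.Adj y z
        · rw [adjInd_of_adj hxz, adjInd_of_adj hyz]
          have hzA : z ∉ A := fun hzA =>
            h.ne (hA.matching z hzA x hx y hy hxz.symm hyz.symm)
          have : bareInd G x z = 0 ∨ bareInd G y z = 0 := by
            by_contra! hc
            have bare_imp : ∀ w ∈ A, bareInd G w z ≠ 0 → ∀ u ∈ A, ¬ G.Adj w u := by
              intro w hw hb u hu hwu
              apply hb
              have := cod_pos hwu (hA.join u hu z hzA).symm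
              have : ¬ (G.Adj w z ∧ cod G w z = 0) := by omega
              simp [bareInd, this]
            exact h.ne (hA.unmatched x hx y hy (bare_imp x hx hc.1) (bare_imp y hy hc.2))
          have := bareInd_le_one (G := G) x z
          have := bareInd_le_one (G := G) y z
          omega
        · simp [adjInd_of_not_adj hyz]
      · simp [adjInd_of_not_adj hxz]
    linarith
  · have hy : y ∉ A := fun hy => h.not_adj (hA.join y hy x hx).symm
    have hcod : cod G x y = A.card := by
      rw [cod_eq_card]
      congr 2
      ext z
      simp only [Finset.mem_filter, Finset.mem_univ, true_and]
      constructor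
      · intro hz
        by_contra hzA
        exact hA.indep x hx z hzA hz.1
      · intro hz
        exact ⟨(hA.join z hz x hx).symm, (hA.join z hz y hy).symm⟩
    rw [if_neg (by omega)]
    -- Only the unmatched vertex, if there is one, contributes. The change is at most 12 - 12·4 + 12
    -- < 0.
    have hle : ∑ z, adjInd G x z * adjInd G y z * (bareInd G x z + bareInd G y z) ≤ 2 := by
      have bare_imp : ∀ w, w ∉ A → ∀ z, bareInd G w z ≠ 0 → z ∈ A ∧ ∀ u ∈ A, ¬ G.Adj z u := by
        intro w hw z hb
        have hwz : G.Adj w z ∧ cod G w z = 0 := by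
          by_contra hc; exact hb (by simp [bareInd, hc])
        have hz : z ∈ A := by
          by_contra hz; exact hA.indep w hw z hz hwz.1
        refine ⟨hz, fun u hu hzu => ?_⟩
        have := cod_pos (hA.join u hu w hw).symm hzu
        omega
      by_cases hex : ∃ z₀, bareInd G x z₀ + bareInd G y z₀ ≠ 0
      · obtain ⟨z₀, hz₀⟩ := hex
        have hz₀' : z₀ ∈ A ∧ ∀ u ∈ A, ¬ G.Adj z₀ u := by
          by_cases hb : bareInd G x z₀ = 0
          · exact bare_imp y hy z₀ fun h => hz₀ (by rw [hb, h, add_zero])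
          · exact bare_imp x hx z₀ hb
        rw [Finset.sum_eq_single z₀]
        · have h1 := bareInd_le_one (G := G) x z₀
          have h2 := bareInd_le_one (G := G) y z₀
          rw [adjInd_of_adj (hA.join z₀ hz₀'.1 x hx).symm,
            adjInd_of_adj (hA.join z₀ hz₀'.1 y hy).symm]
          linarith
        · intro z _ hz
          have hb1 : bareInd G x z = 0 := by
            by_contra hb
            have := bare_imp x hx z hb
            exact hz (hA.unmatched z this.1 z₀ hz₀'.1 this.2 hz₀'.2)
          have hb2 : bareInd G y z = 0 := by
            by_contra hb
            have := bare_imp y hy z hb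
            exact hz (hA.unmatched z this.1 z₀ hz₀'.1 this.2 hz₀'.2)
          rw [hb1, hb2]; ring
        · simp
      · push Not at hex
        rw [Finset.sum_eq_zero fun z _ => by rw [hex z, mul_zero]]
        norm_num
    have : (4 : ℤ) ≤ A.card := by exact_mod_cast hs
    linarith

/-- The strongly regular graphs with the parameters of the `3`-by-`3` rook's graph. -/
structure IsRook (G : SimpleGraph V) : Prop where
  card : Fintype.card V = 9
  deg_eq : ∀ x, deg G x = 4
  cod_adj : ∀ x y, G.Adj x y → cod G x y = 1
  cod_not_adj : ∀ x y, x ≠ y → ¬ G.Adj x y → cod G x y = 2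

/-- The edge gains 12, its two triangles cost 24, and there are no bare edges to repair. -/
lemma IsRook.excess_lt_of_isAddEdge (hG : IsRook G) {x y : V} (h : IsAddEdge G G' x y) :
    excess G' < excess G := by
  classical
  have hb : ∀ u v, bareInd G u v = 0 := by
    intro u v
    have : ¬ (G.Adj u v ∧ cod G u v = 0) := fun h' => by
      have := hG.cod_adj u v h'.1
      omega
    simp [bareInd, this]
  rw [h.excess_eq, hG.cod_not_adj x y h.ne h.not_adj]
  simp [hb]
  omega

end Edges
end LayerDomination

namespace LayerDomination

/-! ### Books, isolated triangles and degrees in good graphs -/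

section Books

set_option linter.unusedSectionVars false

variable {V : Type*} [Fintype V] {G : SimpleGraph V}

/-- In every triangle, at least two edges lie in no other triangle. -/
def IsGood (G : SimpleGraph V) : Prop := ∀ x y z, IsTri G x y z → IsGoodTri G x y z

variable (G) in
open Classical in
/-- The indicator of the triangles `xyz` such that `xy` lies in several triangles. -/
noncomputable def bookInd (x y z : V) : ℤ := if IsTri G x y z ∧ 2 ≤ cod G x y then 1 else 0

variable (G) in
open Classical in
/-- The indicator of the triangles that share no edge with another triangle. -/
noncomputable def isoInd (x y z : V) : ℤ :=
  if IsTri G x y z ∧ cod G x y = 1 ∧ cod G y z = 1 ∧ cod G x z = 1 then 1 else 0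

variable (G) in
open Classical in
/-- The indicator of the edges that lie in several triangles. -/
noncomputable def spineInd (x y : V) : ℤ := if G.Adj x y ∧ 2 ≤ cod G x y then 1 else 0

variable (G) in
/-- The number of edges at `v` that lie in several triangles. -/
noncomputable def spineDeg (v : V) : ℤ := ∑ y, spineInd G v y

variable (G) in
/-- The number of triangles at `v` on an edge at `v` that lies in several triangles. -/
noncomputable def leafDeg (v : V) : ℤ := ∑ y, ∑ z, bookInd G v y z

variable (G) in
/-- Twice the number of triangles at `v` whose edge opposite to `v` lies in several triangles. -/
noncomputable def pageDeg (v : V) : ℤ := ∑ y, ∑ z, bookInd G y z v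

variable (G) in
/-- Twice the number of triangles at `v` that share no edge with another triangle. -/
noncomputable def isoDeg (v : V) : ℤ := ∑ y, ∑ z, isoInd G v y z

lemma bookInd_swap (x y z : V) : bookInd G x y z = bookInd G y x z := by
  classical
  unfold bookInd
  exact if_congr ⟨fun h => ⟨h.1.swap, by rw [cod_comm]; exact h.2⟩,
    fun h => ⟨h.1.swap, by rw [cod_comm]; exact h.2⟩⟩ rfl rfl

lemma isoInd_rotate (x y z : V) : isoInd G x y z = isoInd G y z x := by
  classical
  unfold isoInd
  refine if_congr ?_ rfl rfl
  rw [cod_comm z x, cod_comm y x]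
  constructor
  · rintro ⟨h1, h2, h3, h4⟩
    exact ⟨h1.rotate, h3, h4, h2⟩
  · rintro ⟨h1, h2, h3, h4⟩
    exact ⟨h1.rotate.rotate, h4, h2, h3⟩

lemma isoInd_swap (x y z : V) : isoInd G x y z = isoInd G y x z := by
  classical
  unfold isoInd
  refine if_congr ?_ rfl rfl
  rw [cod_comm y x]
  constructor
  · rintro ⟨h1, h2, h3, h4⟩
    exact ⟨h1.swap, h2, h4, h3⟩
  · rintro ⟨h1, h2, h3, h4⟩
    exact ⟨h1.swap, h2, h4, h3⟩

lemma spineInd_comm (x y : V) : spineInd G x y = spineInd G y x := by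
  classical
  unfold spineInd
  refine if_congr ?_ rfl rfl
  rw [G.adj_comm, cod_comm]

lemma spineInd_nonneg (x y : V) : 0 ≤ spineInd G x y := by unfold spineInd; split_ifs <;> simp

lemma bookInd_nonneg (x y z : V) : 0 ≤ bookInd G x y z := by unfold bookInd; split_ifs <;> simp

lemma isoInd_nonneg (x y z : V) : 0 ≤ isoInd G x y z := by unfold isoInd; split_ifs <;> simp

lemma spineDeg_nonneg (v : V) : 0 ≤ spineDeg G v := Finset.sum_nonneg fun _ _ => spineInd_nonneg _ _

lemma pageDeg_nonneg (v : V) : 0 ≤ pageDeg G v :=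
  Finset.sum_nonneg fun _ _ => Finset.sum_nonneg fun _ _ => bookInd_nonneg _ _ _

lemma isoDeg_nonneg (v : V) : 0 ≤ isoDeg G v :=
  Finset.sum_nonneg fun _ _ => Finset.sum_nonneg fun _ _ => isoInd_nonneg _ _ _

lemma even_pageDeg (v : V) : Even (pageDeg G v) :=
  even_sum_symm _ (fun y z => bookInd_swap y z v) fun y => by simp [bookInd, IsTri]

lemma even_isoDeg (v : V) : Even (isoDeg G v) :=
  even_sum_symm _ (fun y z => by rw [isoInd_rotate, isoInd_swap, ← isoInd_rotate, isoInd_rotate,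
    isoInd_swap, isoInd_rotate, isoInd_swap])
    fun y => by simp [isoInd, IsTri]

open Classical in
lemma sum_isTri (x y : V) : ∑ z, (if IsTri G x y z then (1 : ℤ) else 0) =
    adjInd G x y * cod G x y := by
  rw [cod, Finset.mul_sum]
  refine Finset.sum_congr rfl fun z _ => ?_
  by_cases h1 : G.Adj x y <;> by_cases h2 : G.Adj y z <;> by_cases h3 : G.Adj x z <;>
      simp [adjInd, IsTri, h1, h2, h3]

lemma sum_bookInd (x y : V) : ∑ z, bookInd G x y z = spineInd G x y * cod G x y := by
  classical
  by_cases h : 2 ≤ cod G x y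
  · have : ∀ z, bookInd G x y z = if IsTri G x y z then (1 : ℤ) else 0 := by
      intro z; unfold bookInd; exact if_congr (by simp [h]) rfl rfl
    simp only [this, sum_isTri]
    congr 1
    unfold adjInd spineInd
    exact if_congr (by simp [h]) rfl rfl
  · simp [bookInd, spineInd, h]

lemma leafDeg_eq (v : V) : leafDeg G v = ∑ y, spineInd G v y * cod G v y := by
  simp only [leafDeg, sum_bookInd]

lemma leafDeg_eq' (v : V) : leafDeg G v = ∑ y, ∑ z, bookInd G v z y := by
  rw [leafDeg, Finset.sum_comm]

-- A triangle of a good graph has at most one edge of codegree above 1; the four terms record which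
-- edge this is, or that there is none.
open Classical in
lemma IsGood.sum_eq_one (hG : IsGood G) (x y z : V) :
    bookInd G x y z + bookInd G x z y + bookInd G y z x + isoInd G x y z = if IsTri G x y z then 1 else 0 := by
  by_cases h : IsTri G x y z
  · have h1 := h.cod_pos
    have h2 := h.rotate.cod_pos
    have h3 := h.rotate.rotate.cod_pos
    rw [cod_comm z x] at h3
    have t1 : IsTri G x z y := ⟨h.2.2, h.2.1.symm, h.1⟩
    have t2 := h.rotate
    simp only [bookInd, isoInd, h, t1, t2, true_and, if_true]
    rcases hG x y z h with h' | h' | h'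
    · by_cases h4 : cod G x y = 1
      · simp [h4, h'.1, h'.2]
      · have : 2 ≤ cod G x y := by omega
        simp [h4, h'.1, h'.2, this]
    · by_cases h4 : cod G y z = 1
      · simp [h4, h'.1, h'.2]
      · have : 2 ≤ cod G y z := by omega
        simp [h4, h'.1, h'.2, this]
    · by_cases h4 : cod G x z = 1
      · simp [h4, h'.1, h'.2]
      · have : 2 ≤ cod G x z := by omega
        simp [h4, h'.1, h'.2, this]
  · have t1 : ¬ IsTri G x z y := fun t => h ⟨t.2.2, t.2.1.symm, t.1⟩
    have t2 : ¬ IsTri G y z x := fun t => h t.rotate.rotate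
    simp [bookInd, isoInd, h, t1, t2]

lemma IsGood.triDeg_eq (hG : IsGood G) (v : V) :
    triDeg G v = 2 * leafDeg G v + pageDeg G v + isoDeg G v := by
  classical
  have : ∀ y, adjInd G v y * cod G v y = ∑ z, (bookInd G v y z + bookInd G v z y +
      bookInd G y z v + isoInd G v y z) := by
    intro y
    rw [← sum_isTri]
    exact Finset.sum_congr rfl fun z _ => (hG.sum_eq_one v y z).symm
  simp only [triDeg, this, Finset.sum_add_distrib]
  rw [← leafDeg_eq', ← leafDeg, ← pageDeg, ← isoDeg]
  ring

lemma IsGood.lostDeg_eq (hG : IsGood G) (v : V) : lostDeg G v = 2 * leafDeg G v + isoDeg G v := by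
  classical
  have : ∀ y z, adjInd G v y * adjInd G v z * soleInd G y z = bookInd G v y z + bookInd G v z y +
      isoInd G v y z := by
    intro y z
    have h1 := hG.sum_eq_one v y z
    by_cases h : IsTri G v y z
    · rw [if_pos h] at h1
      rw [adjInd_of_adj h.1, adjInd_of_adj h.2.2]
      have h2 := h.rotate.cod_pos
      by_cases h3 : cod G y z = 1
      · have h4 : bookInd G y z v = 0 := by simp [bookInd, h3]
        have h5 : soleInd G y z = 1 := by simp [soleInd, h.2.1, h3]
        rw [h5]; linarith
      · have h4 : bookInd G y z v = 1 := by
          have : 2 ≤ cod G y z := by omega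
          simp [bookInd, h.rotate, this]
        have h5 : soleInd G y z = 0 := by simp [soleInd, h3]
        rw [h5]; linarith
    · rw [if_neg h] at h1
      have a1 := bookInd_nonneg (G := G) v y z
      have a2 := bookInd_nonneg (G := G) v z y
      have a3 := bookInd_nonneg (G := G) y z v
      have a4 := isoInd_nonneg (G := G) v y z
      have : adjInd G v y * adjInd G v z * soleInd G y z = 0 := by
        by_cases b1 : G.Adj v y
        · by_cases b2 : G.Adj v z
          · have b3 : ¬ G.Adj y z := fun b3 => h ⟨b1, b3, b2⟩
            simp [soleInd, b3]
          · simp [adjInd_of_not_adj b2]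
        · simp [adjInd_of_not_adj b1]
      linarith
  simp only [lostDeg, this, Finset.sum_add_distrib]
  rw [← leafDeg_eq', ← leafDeg, ← isoDeg]
  ring

/-- An edge at `v` is bare, a spine, or in a single triangle. A book triangle whose spine contains
`v` has one further edge at `v`; page and isolated triangles have two, in accordance with the
doubled counts. -/
lemma IsGood.deg_eq (hG : IsGood G) (v : V) :
    deg G v = bareDeg G v + spineDeg G v + leafDeg G v + pageDeg G v + isoDeg G v := by
  classical
  have key : ∀ y, adjInd G v y = bareInd G v y + spineInd G v y +
      ∑ z, (bookInd G v z y + bookInd G y z v + isoInd G v y z) := by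
    intro y
    have h1 : ∑ z, (bookInd G v y z + bookInd G v z y + bookInd G y z v + isoInd G v y z) =
        adjInd G v y * cod G v y := by
      rw [← sum_isTri]
      exact Finset.sum_congr rfl fun z _ => hG.sum_eq_one v y z
    have h2 : ∑ z, (bookInd G v y z + bookInd G v z y + bookInd G y z v + isoInd G v y z) =
        ∑ z, bookInd G v y z + ∑ z, (bookInd G v z y + bookInd G y z v + isoInd G v y z) := by
      rw [← Finset.sum_add_distrib]
      exact Finset.sum_congr rfl fun z _ => by ring
    rw [h2, sum_bookInd] at h1
    by_cases h : G.Adj v y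
    · rw [adjInd_of_adj h, one_mul] at h1
      rw [adjInd_of_adj h]
      have h0 := cod_nonneg (G := G) v y
      by_cases c0 : cod G v y = 0
      · have b1 : bareInd G v y = 1 := by simp [bareInd, h, c0]
        have b2 : spineInd G v y = 0 := by simp [spineInd, c0]
        rw [b2, c0] at h1
        rw [b1, b2]; linarith
      · by_cases c1 : cod G v y = 1
        · have b1 : bareInd G v y = 0 := by simp [bareInd, c1]
          have b2 : spineInd G v y = 0 := by simp [spineInd, c1]
          rw [b2, c1] at h1
          rw [b1, b2]; linarith
        · have c2 : 2 ≤ cod G v y := by omega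
          have b1 : bareInd G v y = 0 := by simp [bareInd, c0]
          have b2 : spineInd G v y = 1 := by simp [spineInd, h, c2]
          rw [b2] at h1
          rw [b1, b2]; linarith
    · have b1 : bareInd G v y = 0 := by simp [bareInd, h]
      have b2 : spineInd G v y = 0 := by simp [spineInd, h]
      rw [adjInd_of_not_adj h, b2] at h1
      rw [adjInd_of_not_adj h, b1, b2]; linarith
  simp only [deg, key, Finset.sum_add_distrib]
  rw [← bareDeg, ← spineDeg, ← leafDeg_eq', ← pageDeg, ← isoDeg]
  ring

/-- Eliminating the other local counts through `IsGood.deg_eq` makes the deletion bound a lower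
bound on the degree. -/
lemma IsGood.drop_eq (hG : IsGood G) (v : V) :
    drop G v = 6 * deg G v + 6 * spineDeg G v + 3 * isoDeg G v := by
  rw [drop, hG.triDeg_eq, hG.lostDeg_eq]
  linarith [hG.deg_eq v]

/-- All coefficients are nonnegative, so the duplication bound limits every kind of edge and
triangle at `v`, except those counted by `leafDeg`. -/
lemma IsGood.gain_eq (hG : IsGood G) (v : V) :
    gain G v = 6 * bareDeg G v + 12 * spineDeg G v + 6 * pageDeg G v + 6 * isoDeg G v := by
  rw [gain, hG.triDeg_eq]
  linarith [hG.deg_eq v]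

lemma two_mul_spineDeg_le_leafDeg (v : V) : 2 * spineDeg G v ≤ leafDeg G v := by
  rw [leafDeg_eq, spineDeg, Finset.mul_sum]
  refine Finset.sum_le_sum fun y _ => ?_
  unfold spineInd
  split_ifs with h
  · linarith [h.2]
  · simp

lemma leafDeg_le {m : ℤ} (hm : ∀ x y, G.Adj x y → 2 ≤ cod G x y → cod G x y ≤ m) (v : V) :
    leafDeg G v ≤ m * spineDeg G v := by
  rw [leafDeg_eq, spineDeg, Finset.mul_sum]
  refine Finset.sum_le_sum fun y _ => ?_
  unfold spineInd
  split_ifs with h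
  · linarith [hm v y h.1 h.2]
  · simp

/-- Both sums count each triangle once for every orientation of an edge of it that lies in several
triangles. -/
lemma sum_pageDeg : ∑ v, pageDeg G v = ∑ v, leafDeg G v := by
  unfold pageDeg leafDeg
  rw [Finset.sum_comm]
  refine Finset.sum_congr rfl fun y _ => ?_
  rw [Finset.sum_comm]

lemma even_sum_spineDeg : Even (∑ v, spineDeg G v) :=
  even_sum_symm _ spineInd_comm fun x => by simp [spineInd]

lemma even_sum_leafDeg : Even (∑ v, leafDeg G v) := by
  simp only [leafDeg_eq]
  exact even_sum_symm _ (fun x y => by rw [spineInd_comm, cod_comm]) fun x => by simp [spineInd]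

lemma IsGood.excess_eq (hG : IsGood G) : excess G = 3 * bareSum G + 6 * ∑ v, spineDeg G v +
    6 * ∑ v, leafDeg G v + 4 * ∑ v, isoDeg G v := by
  have h1 : ∑ x, ∑ y, adjInd G x y = ∑ v, deg G v := rfl
  have h2 : ∑ x, ∑ y, bareInd G x y = ∑ v, bareDeg G v := rfl
  have h3 : ∑ x, ∑ y, adjInd G x y * cod G x y = ∑ v, triDeg G v := rfl
  have h4 : bareSum G = ∑ v, bareDeg G v := rfl
  unfold excess
  rw [h1, h2, h3, h4]
  simp only [hG.deg_eq, hG.triDeg_eq, Finset.sum_add_distrib, ← Finset.mul_sum, sum_pageDeg]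
  ring

lemma IsGood.sum_deg_eq (hG : IsGood G) :
    ∑ v, deg G v = bareSum G + ∑ v, spineDeg G v + 2 * ∑ v, leafDeg G v +
    ∑ v, isoDeg G v := by
  have h4 : bareSum G = ∑ v, bareDeg G v := rfl
  rw [h4]
  simp only [hG.deg_eq, Finset.sum_add_distrib, sum_pageDeg]
  ring

end Books
end LayerDomination

namespace LayerDomination

/-! ### Residual graphs: local inequalities and global counts -/

section Residual

set_option linter.unusedSectionVars false

variable {V : Type*} [Fintype V] {G : SimpleGraph V} {k : ℕ}

variable (G) in
/-- The number of several-triangle edges at `v` plus the number of isolated triangles at `v`. -/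
noncomputable def load (v : V) : ℤ := spineDeg G v + isoDeg G v / 2

variable (G k) in
/-- The deviation of the degree from `(n + 1) / 2`, where `n = 4 * k + 1`. -/
noncomputable def dev (v : V) : ℤ := deg G v - (2 * k + 1)

/-- An extremal graph on `4 * k + 1` vertices to which no extension or deletion argument applies. -/
structure IsResidual (G : SimpleGraph V) (k : ℕ) : Prop where
  good : IsGood G
  card : Fintype.card V = 4 * k + 1
  excess : excess G = 12 * (2 * k ^ 2 + 2 * k)
  dev_ge : ∀ v, -load G v ≤ dev G k v
  weight_le : ∀ v, bareDeg G v + 2 * load G v + pageDeg G v ≤ 2 * k + 1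
  cod_le : ∀ x y, G.Adj x y → 2 ≤ cod G x y → cod G x y ≤ 2 * k

lemma isoDeg_eq (v : V) : isoDeg G v = 2 * (isoDeg G v / 2) := by
  have := even_isoDeg (G := G) v
  grind

lemma IsGood.cod_eq_one (hG : IsGood G) {x y z : V} (h : IsTri G x y z) (hp : 2 ≤ cod G x y) :
    cod G x z = 1 ∧ cod G y z = 1 := by
  rcases hG x y z h with h' | h' | h'
  · exact ⟨h'.2, h'.1⟩
  · omega
  · omega

/-- The three bounds express strictness in deletion, duplication and the pair extension; equality in
one of these moves already gives K⁺. -/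
theorem isResidual_of_isGood (hG : IsGood G) (hk : 2 ≤ k) (hn : Fintype.card V = 4 * k + 1)
    (hex : LayerDomination.excess G = 12 * (2 * k ^ 2 + 2 * k)) :
    (∃ A : Finset V, IsKPlus G A ∧ 2 * k ≤ A.card ∧ A.card ≤ 2 * k + 2) ∨ IsResidual G k := by
  classical
  by_cases hA : ∃ A : Finset V, IsKPlus G A ∧ 2 * k ≤ A.card ∧ A.card ≤ 2 * k + 2
  · exact Or.inl hA
  refine Or.inr ⟨hG, hn, hex, ?_, ?_, ?_⟩
  · intro v
    have h1 := drop_ge hn hex v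
    have h2 : drop G v ≠ 12 * k := fun h => by
      obtain ⟨A, h1, h2⟩ := isKPlus_of_drop_eq hk hn hex h
      exact hA ⟨A, h1, by omega, by omega⟩
    rw [hG.drop_eq] at h1 h2
    have h3 := isoDeg_eq (G := G) v
    unfold load dev
    omega
  · intro v
    have h1 := gain_le hn hex v
    have h2 : gain G v ≠ 12 * (k + 1) := fun h => by
      obtain ⟨A, h1, h2⟩ := isKPlus_of_gain_eq (by omega) hn hex h
      exact hA ⟨A, h1, by omega, by omega⟩
    rw [hG.gain_eq] at h1 h2
    have h3 := isoDeg_eq (G := G) v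
    unfold load
    omega
  · intro x y hxy hp
    by_contra hc
    rw [cod_eq_card] at hc
    -- The pages of a book form an independent set, since an edge between two of them would put a
    -- non-spine edge into a second triangle.
    obtain ⟨A, h1, h2⟩ := isKPlus_of_indep (by omega) hn hex
      (Finset.univ.filter fun z => G.Adj x z ∧ G.Adj y z) (by
        intro z hz w hw hzw
        simp only [Finset.mem_filter, Finset.mem_univ, true_and] at hz hw
        have h1 := (hG.cod_eq_one ⟨hxy, hz.2, hz.1⟩ hp).1
        exact hw.2.ne (eq_of_cod_eq_one h1 hxy hz.2.symm hw.1 hzw)) (by omega)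
    exact hA ⟨A, h1, by omega, by omega⟩

lemma sum_map_le_sum {f : V → ℤ} (hf : ∀ v, 0 ≤ f v) {l : List V} (hl : l.Nodup) :
    (l.map f).sum ≤ ∑ v, f v := by
  classical
  rw [← List.sum_toFinset _ hl]
  exact Finset.sum_le_univ_sum_of_nonneg hf

lemma one_le_spineDeg {x y : V} (h : G.Adj x y) (hp : 2 ≤ cod G x y) : 1 ≤ spineDeg G x := by
  have := Finset.single_le_sum (f := fun y => spineInd G x y)
    (fun _ _ => spineInd_nonneg _ _) (Finset.mem_univ y)
  have h1 : spineInd G x y = 1 := if_pos ⟨h, hp⟩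
  rw [← spineDeg, h1] at this
  exact this

lemma cod_le_leafDeg {x y : V} (h : G.Adj x y) (hp : 2 ≤ cod G x y) :
    cod G x y + 2 * (spineDeg G x - 1) ≤ leafDeg G x := by
  have h1 := Finset.single_le_sum (f := fun y => spineInd G x y * (cod G x y - 2))
    (fun y _ => by
      by_cases h : G.Adj x y ∧ 2 ≤ cod G x y
      · exact mul_nonneg (spineInd_nonneg _ _) (by linarith [h.2])
      · simp [spineInd, h]) (Finset.mem_univ y)
  have h2 : spineInd G x y = 1 := if_pos ⟨h, hp⟩
  simp only [mul_sub, Finset.sum_sub_distrib, ← leafDeg_eq, ← Finset.sum_mul] at h1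
  rw [h2, ← spineDeg] at h1
  linarith

lemma exists_of_one_le_spineDeg {x : V} (h : 1 ≤ spineDeg G x) :
    ∃ y, G.Adj x y ∧ 2 ≤ cod G x y := by
  by_contra! hc
  have : spineDeg G x = 0 := Finset.sum_eq_zero fun y _ => by
    unfold spineInd
    rw [if_neg]
    rintro ⟨h1, h2⟩
    exact absurd (hc y h1) (not_lt.2 h2)
  omega

lemma exists_of_two_le_spineDeg {x : V} (h : 2 ≤ spineDeg G x) :
    ∃ y w, y ≠ w ∧ G.Adj x y ∧ 2 ≤ cod G x y ∧ G.Adj x w ∧ 2 ≤ cod G x w := by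
  classical
  have h1 : spineDeg G x = (Finset.univ.filter fun y => G.Adj x y ∧ 2 ≤ cod G x y).card := by
    simp only [spineDeg, spineInd, Finset.card_filter]
    push_cast
    rfl
  rw [h1] at h
  have h' : 1 < (Finset.univ.filter fun y => G.Adj x y ∧ 2 ≤ cod G x y).card := by exact_mod_cast h
  obtain ⟨y, hy, w, hw, hne⟩ := Finset.one_lt_card.1 h'
  simp only [Finset.mem_filter, Finset.mem_univ, true_and] at hy hw
  exact ⟨y, w, hne, hy.1, hy.2, hw.1, hw.2⟩

variable (G) in
/-- A triangle sharing no edge with another triangle. -/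
def IsIsoTri (x y z : V) : Prop :=
  IsTri G x y z ∧ cod G x y = 1 ∧ cod G y z = 1 ∧ cod G x z = 1

lemma IsIsoTri.rotate {x y z : V} (h : IsIsoTri G x y z) : IsIsoTri G y z x :=
  ⟨h.1.rotate, h.2.2.1, by rw [cod_comm]; exact h.2.2.2, by rw [cod_comm]; exact h.2.1⟩

lemma exists_of_one_le_isoDeg {x : V} (h : 1 ≤ isoDeg G x) : ∃ y z, IsIsoTri G x y z := by
  by_contra! hc
  have : isoDeg G x = 0 := Finset.sum_eq_zero fun y _ => Finset.sum_eq_zero fun z _ => by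
    unfold isoInd
    rw [if_neg]
    exact hc y z
  omega

lemma IsIsoTri.isoDeg {x y z : V} (h : IsIsoTri G x y z) : 1 ≤ isoDeg G x := by
  classical
  have h1 := Finset.single_le_sum (f := fun z => isoInd G x y z)
    (fun _ _ => isoInd_nonneg _ _ _) (Finset.mem_univ z)
  have h2 := Finset.single_le_sum (f := fun y => ∑ z, isoInd G x y z)
    (fun _ _ => Finset.sum_nonneg fun _ _ => isoInd_nonneg _ _ _) (Finset.mem_univ y)
  have h3 : isoInd G x y z = 1 := if_pos h
  change _ ≤ LayerDomination.isoDeg G x at h2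
  omega

lemma two_le_pageDeg {x y z : V} (h : IsTri G x y z) (hp : 2 ≤ cod G x y) : 2 ≤ pageDeg G z := by
  classical
  have h1 := Finset.single_le_sum (f := fun y => bookInd G x y z)
    (fun _ _ => bookInd_nonneg _ _ _) (Finset.mem_univ y)
  have h2 := Finset.single_le_sum (f := fun x => ∑ y, bookInd G x y z)
    (fun _ _ => Finset.sum_nonneg fun _ _ => bookInd_nonneg _ _ _) (Finset.mem_univ x)
  have h3 : bookInd G x y z = 1 := if_pos ⟨h, hp⟩
  have h4 := even_pageDeg (G := G) z
  change _ ≤ pageDeg G z at h2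
  obtain ⟨c, hc⟩ := h4
  omega

lemma exists_bare_of_one_le_bareDeg {x : V} (h : 1 ≤ bareDeg G x) :
    ∃ y, G.Adj x y ∧ cod G x y = 0 := by
  by_contra! hc
  have : bareDeg G x = 0 := Finset.sum_eq_zero fun y _ => by
    unfold bareInd
    rw [if_neg]
    rintro ⟨h1, h2⟩
    exact hc y h1 h2
  omega

namespace IsResidual

lemma dev_tri (hR : IsResidual G k) {x y z : V} (h : IsTri G x y z) (hp : 2 ≤ cod G x y) :
    dev G k x + dev G k y + dev G k z ≤ cod G x y - 2 * k := by
  have h1 := triple_slack_nonneg (G := G) x y z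
  obtain ⟨h2, h3⟩ := hR.good.cod_eq_one h hp
  rw [hR.card, h2, h3] at h1
  push_cast at h1
  unfold dev
  linarith

lemma dev_iso (hR : IsResidual G k) {x y z : V} (h : IsIsoTri G x y z) :
    dev G k x + dev G k y + dev G k z ≤ 1 - 2 * k := by
  have h1 := triple_slack_nonneg (G := G) x y z
  rw [hR.card, h.2.1, h.2.2.1, h.2.2.2] at h1
  push_cast at h1
  unfold dev
  linarith

lemma dev_bare (hR : IsResidual G k) {x y : V} (h : cod G x y = 0) :
    dev G k x + dev G k y ≤ -1 := by
  have h1 := pair_slack_nonneg (G := G) x y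
  rw [hR.card, h] at h1
  push_cast at h1
  unfold dev
  linarith

lemma load_nonneg (v : V) : 0 ≤ load G v := by
  unfold load
  have := spineDeg_nonneg (G := G) v
  have := isoDeg_nonneg (G := G) v
  omega

lemma dev_add (hR : IsResidual G k) (v : V) : dev G k v + (2 * k + 1) =
    bareDeg G v + spineDeg G v + leafDeg G v + pageDeg G v + 2 * (isoDeg G v / 2) := by
  rw [← isoDeg_eq, ← hR.good.deg_eq]
  unfold dev
  ring

/-- Only bare and page edges remain, so the degree is at least 2k+1 by `dev_ge` and at most 2k+1 by
`weight_le`. As `pageDeg` is even, the number of bare edges is odd. -/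
lemma of_load_eq_zero (hR : IsResidual G k) {v : V} (h : load G v = 0) :
    dev G k v = 0 ∧ 1 ≤ bareDeg G v := by
  have h1 := hR.dev_add v
  have h2 := hR.dev_ge v
  have h3 := hR.weight_le v
  have h4 := spineDeg_nonneg (G := G) v
  have h5 := isoDeg_nonneg (G := G) v
  have h6 := leafDeg_le hR.cod_le v
  have h7 := two_mul_spineDeg_le_leafDeg (G := G) v
  obtain ⟨c, hc⟩ := even_pageDeg (G := G) v
  unfold load at *
  have h8 : spineDeg G v = 0 := by omega
  rw [h8, mul_zero] at h6
  rw [h8] at *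
  have h9 := bareDeg_nonneg (G := G) v
  omega

lemma load_pos_of_dev_ne (hR : IsResidual G k) {v : V} (h : dev G k v ≠ 0) : 1 ≤ load G v := by
  by_contra hc
  exact h (hR.of_load_eq_zero (by have := load_nonneg (G := G) v; omega)).1

/-- The vertices of load zero are matched into the others by the edges in no triangle. -/
lemma two_mul_sum_bareDeg_le (hR : IsResidual G k) :
    2 * ∑ v, (1 - min (load G v) 1) * bareDeg G v ≤ bareSum G ∧
    (∀ x u, G.Adj x u → cod G x u = 0 → 1 ≤ load G x → 1 ≤ load G u →
      2 * ∑ v, (1 - min (load G v) 1) * bareDeg G v + 2 ≤ bareSum G) := by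
  classical
  have h1 : 2 * ∑ v, (1 - min (load G v) 1) * bareDeg G v =
      ∑ v, ∑ u, ((1 - min (load G v) 1) + (1 - min (load G u) 1)) * bareInd G v u := by
    simp only [add_mul, Finset.sum_add_distrib]
    have : ∑ v, ∑ u, (1 - min (load G u) 1) * bareInd G v u =
        ∑ v, ∑ u, (1 - min (load G v) 1) * bareInd G v u := by
      rw [Finset.sum_comm]
      simp only [bareInd_comm]
    rw [this, two_mul]
    simp only [bareDeg, Finset.mul_sum]
  -- The factor 1 - min(load, 1) indicates load zero. A bare edge cannot have both ends of load
  -- zero: their deviations vanish, but `dev_bare` requires a negative sum.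
  have h2 : ∀ v u, ((1 - min (load G v) 1) + (1 - min (load G u) 1)) * bareInd G v u ≤
      bareInd G v u := by
    intro v u
    unfold bareInd
    split_ifs with h
    · have a1 := load_nonneg (G := G) v
      have a2 := load_nonneg (G := G) u
      have a3 := hR.dev_bare h.2
      by_cases b1 : load G v = 0
      · by_cases b2 : load G u = 0
        · have := (hR.of_load_eq_zero b1).1
          have := (hR.of_load_eq_zero b2).1
          omega
        · omega
      · omega
    · simp
  rw [h1]
  refine ⟨Finset.sum_le_sum fun v _ => Finset.sum_le_sum fun u _ => h2 v u, ?_⟩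
  intro x u hxu hc hx hu
  have h3 : ∀ v, 0 ≤ ∑ u, (bareInd G v u -
      ((1 - min (load G v) 1) + (1 - min (load G u) 1)) * bareInd G v u) :=
    fun v => Finset.sum_nonneg fun u _ => sub_nonneg.2 (h2 v u)
  have h4 : ∀ x u, G.Adj x u → cod G x u = 0 → 1 ≤ load G x → 1 ≤ load G u →
      1 ≤ ∑ y, (bareInd G x y -
      ((1 - min (load G x) 1) + (1 - min (load G y) 1)) * bareInd G x y) := by
    intro x u hxu hc hx hu
    refine le_trans ?_ (Finset.single_le_sum (fun y _ => sub_nonneg.2 (h2 x y))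
      (Finset.mem_univ u))
    have : bareInd G x u = 1 := if_pos ⟨hxu, hc⟩
    rw [this, min_eq_right hx, min_eq_right hu]
    simp
  have h5 := Finset.add_le_sum (s := Finset.univ) (fun v _ => h3 v) (Finset.mem_univ x)
    (Finset.mem_univ u) hxu.ne
  have h6 := h4 x u hxu hc hx hu
  have h7 := h4 u x hxu.symm (by rw [cod_comm]; exact hc) hu hx
  simp only [Finset.sum_sub_distrib] at h5 h6 h7
  unfold bareSum
  linarith

/-- Every vertex of load zero has a bare edge. Together with `two_mul_sum_bareDeg_le` this bounds
the number of such vertices by the number of bare edges. -/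
lemma sum_min_le (hR : IsResidual G k) : 4 * k + 1 - ∑ v, min (load G v) 1 ≤
    ∑ v, (1 - min (load G v) 1) * bareDeg G v := by
  have h : (4 * k + 1 : ℤ) = ∑ v : V, 1 := by simp [hR.card]
  rw [h, ← Finset.sum_sub_distrib]
  refine Finset.sum_le_sum fun v _ => ?_
  by_cases h0 : load G v = 0
  · rw [h0]
    simpa using (hR.of_load_eq_zero h0).2
  · have := load_nonneg (G := G) v
    rw [min_eq_right (by omega)]
    simp

/-- There are 2f bare edges, r spines, m book triangles and q isolated triangles. The excess, the
degree sum, the loads and the quadratic bound become relations between these four numbers. -/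
lemma exists_counts (hR : IsResidual G k) : ∃ f r m q : ℤ,
    bareSum G = 4 * f ∧ ∑ v, spineDeg G v = 2 * r ∧ ∑ v, leafDeg G v = 2 * m ∧
    ∑ v, isoDeg G v = 6 * q ∧ 0 ≤ f ∧ 0 ≤ r ∧ 0 ≤ q ∧ f + r + m + 2 * q = 2 * k ^ 2 + 2 * k ∧
    2 * r ≤ m ∧ m ≤ 2 * k * r ∧ ∑ v, dev G k v = 2 * k - 1 - 2 * r - 2 * q ∧
    ∑ v, load G v = 2 * r + 3 * q ∧ ∑ v, dev G k v ^ 2 + 4 * f ≤ 4 * k + 1 ∧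
    (∑ v, dev G k v ^ 2 + 4 * f = 4 * k + 1 → IsTight G) := by
  obtain ⟨r, hr⟩ := even_sum_spineDeg (G := G)
  obtain ⟨m, hm⟩ := even_sum_leafDeg (G := G)
  have hE := hR.good.excess_eq
  have hD := hR.good.sum_deg_eq
  obtain ⟨c, hc⟩ : Even (∑ v, isoDeg G v) := by
    rw [even_iff_two_dvd]
    exact Finset.dvd_sum fun v _ => (even_isoDeg v).two_dvd
  rw [hR.excess, hr, hm, hc] at hE
  rw [hr, hm, hc] at hD
  have hS0 := Finset.sum_nonneg fun v (_ : v ∈ Finset.univ) => spineDeg_nonneg (G := G) v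
  have hI0 := Finset.sum_nonneg fun v (_ : v ∈ Finset.univ) => isoDeg_nonneg (G := G) v
  have hB0 := bareSum_nonneg (G := G)
  have hL1 := Finset.sum_le_sum fun v (_ : v ∈ Finset.univ) =>
    two_mul_spineDeg_le_leafDeg (G := G) v
  have hL2 := Finset.sum_le_sum fun v (_ : v ∈ Finset.univ) => leafDeg_le hR.cod_le v
  rw [← Finset.mul_sum] at hL1 hL2
  rw [hr, hm] at hL1 hL2
  -- Divisibility is read off from the excess equation, modulo 3 here and modulo 4 for `f`.
  obtain ⟨q, hq⟩ : ∃ q, c = 3 * q := ⟨c / 3, by omega⟩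
  obtain ⟨f, hf⟩ : ∃ f, bareSum G = 4 * f := ⟨bareSum G / 4, by omega⟩
  have hdev : ∑ v, dev G k v = 2 * k - 1 - 2 * r - 2 * q := by
    unfold dev
    rw [Finset.sum_sub_distrib, hD]
    simp only [Finset.sum_const, Finset.card_univ, hR.card, nsmul_eq_mul]
    push_cast
    linarith
  have hload : ∑ v, load G v = 2 * r + 3 * q := by
    have h1 : 2 * ∑ v, load G v = 2 * ∑ v, spineDeg G v + ∑ v, isoDeg G v := by
      simp only [Finset.mul_sum, ← Finset.sum_add_distrib]
      refine Finset.sum_congr rfl fun v _ => ?_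
      unfold load
      have := isoDeg_eq (G := G) v
      omega
    rw [hr, hc] at h1
    omega
  have hT := excess_le_and_isTight (G := G)
  have hsq : ∑ x, (2 * deg G x - ((Fintype.card V : ℤ) + 1)) ^ 2 = 4 * ∑ v, dev G k v ^ 2 := by
    rw [Finset.mul_sum]
    refine Finset.sum_congr rfl fun v _ => ?_
    rw [hR.card]
    unfold dev
    push_cast
    ring
  rw [hsq, hR.excess, hR.card, hf] at hT
  push_cast at hT
  refine ⟨f, r, m, q, hf, by linarith, by linarith, by linarith, by omega, by omega, by omega,
    by linarith, by linarith, by linarith, hdev, hload, ?_, ?_⟩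
  · nlinarith [hT.1]
  · intro h
    refine hT.2 ?_
    have : ∑ v, dev G k v ^ 2 = 4 * k + 1 - 4 * f := by linarith
    rw [this]
    ring

end IsResidual
end Residual
end LayerDomination

namespace LayerDomination

/-! ### No residual graph has thirteen or more vertices -/

section ResidualLarge

set_option linter.unusedSectionVars false

variable {V : Type*} [Fintype V] {G : SimpleGraph V} {k : ℕ}

namespace IsResidual

lemma not_adj_of_spine (hG : IsGood G) {v y₁ y₂ u : V} (h₁ : G.Adj v y₁) (hp₁ : 2 ≤ cod G v y₁)
    (hne : y₁ ≠ y₂) (hu : G.Adj v u) (hu₁ : G.Adj y₁ u) (h₂ : G.Adj v y₂) : ¬ G.Adj y₂ u :=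
  fun hu₂ => hne (eq_of_cod_eq_one (hG.cod_eq_one ⟨h₁, hu₁, hu⟩ hp₁).1 h₁ hu₁.symm h₂ hu₂.symm)

/-- Two books with a common spine vertex force small degrees. -/
lemma dev_bowtie (hR : IsResidual G k) {v y₁ z₁ y₂ z₂ : V} (h₁ : IsTri G v y₁ z₁)
    (hp₁ : 2 ≤ cod G v y₁) (h₂ : IsTri G v y₂ z₂) (hp₂ : 2 ≤ cod G v y₂) (hne : y₁ ≠ y₂) :
    dev G k v + dev G k y₁ + dev G k z₁ + dev G k y₂ + dev G k z₂ ≤ -(2 * k + 1) := by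
  classical
  obtain ⟨a₁, b₁⟩ := hR.good.cod_eq_one h₁ hp₁
  obtain ⟨a₂, b₂⟩ := hR.good.cod_eq_one h₂ hp₂
  -- No vertex sees more than two of the five, except `v`, which sees four. So the five degrees sum
  -- to at most 2n + 2.
  have key : ∀ u, adjInd G v u + adjInd G y₁ u + adjInd G z₁ u + adjInd G y₂ u + adjInd G z₂ u ≤
      2 + if u = v then 2 else 0 := by
    intro u
    have l0 := adjInd_le_one (G := G) v u
    have l1 := adjInd_le_one (G := G) y₁ u
    have l2 := adjInd_le_one (G := G) z₁ u
    have l3 := adjInd_le_one (G := G) y₂ u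
    have l4 := adjInd_le_one (G := G) z₂ u
    by_cases huv : u = v
    · subst huv
      rw [if_pos rfl, adjInd_self]
      linarith
    rw [if_neg huv]
    have c1 : G.Adj y₁ u → G.Adj z₁ u → False := fun e1 e2 =>
      huv (eq_of_cod_eq_one b₁ e1 e2 h₁.1.symm h₁.2.2.symm)
    have c2 : G.Adj y₂ u → G.Adj z₂ u → False := fun e1 e2 =>
      huv (eq_of_cod_eq_one b₂ e1 e2 h₂.1.symm h₂.2.2.symm)
    have d1 : adjInd G y₁ u + adjInd G z₁ u ≤ 1 := by
      by_cases e1 : G.Adj y₁ u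
      · rw [adjInd_of_not_adj (c1 e1)]; linarith
      · rw [adjInd_of_not_adj e1]; linarith
    have d2 : adjInd G y₂ u + adjInd G z₂ u ≤ 1 := by
      by_cases e1 : G.Adj y₂ u
      · rw [adjInd_of_not_adj (c2 e1)]; linarith
      · rw [adjInd_of_not_adj e1]; linarith
    by_cases hv : G.Adj v u
    · by_cases e1 : G.Adj z₁ u
      · have hu : u = y₁ := eq_of_cod_eq_one a₁ hv e1 h₁.1 h₁.2.1.symm
        subst hu
        have f1 : ¬ G.Adj y₂ u := fun hc => by
          have := (hR.good.cod_eq_one ⟨h₁.1, hc.symm, h₂.1⟩ hp₁).1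
          omega
        have f2 : ¬ G.Adj z₂ u := fun hc => hne (eq_of_cod_eq_one a₂ hv hc h₂.1 h₂.2.1.symm)
        rw [adjInd_of_not_adj f1, adjInd_of_not_adj f2]
        linarith
      by_cases e2 : G.Adj z₂ u
      · have hu : u = y₂ := eq_of_cod_eq_one a₂ hv e2 h₂.1 h₂.2.1.symm
        subst hu
        have f1 : ¬ G.Adj y₁ u := fun hc => by
          have := (hR.good.cod_eq_one ⟨h₂.1, hc.symm, h₁.1⟩ hp₂).1
          omega
        rw [adjInd_of_not_adj f1, adjInd_of_not_adj e1]
        linarith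
      · rw [adjInd_of_not_adj e1, adjInd_of_not_adj e2]
        by_cases e3 : G.Adj y₁ u
        · rw [adjInd_of_not_adj (not_adj_of_spine hR.good h₁.1 hp₁ hne hv e3 h₂.1)]
          linarith
        · rw [adjInd_of_not_adj e3]
          linarith
    · rw [adjInd_of_not_adj hv]
      linarith
  have h := Finset.sum_le_sum fun u (_ : u ∈ Finset.univ) => key u
  simp only [Finset.sum_add_distrib] at h
  have e : ∑ u : V, (2 : ℤ) + ∑ u, (if u = v then (2 : ℤ) else 0) = 2 * (4 * k + 1) + 2 := by
    simp [hR.card]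
    ring
  rw [e] at h
  unfold dev deg
  linarith

lemma nodup_bowtie (hR : IsResidual G k) {v y₁ z₁ y₂ z₂ : V} (h₁ : IsTri G v y₁ z₁)
    (hp₁ : 2 ≤ cod G v y₁) (h₂ : IsTri G v y₂ z₂) (hp₂ : 2 ≤ cod G v y₂) (hne : y₁ ≠ y₂) :
    [v, y₁, z₁, y₂, z₂].Nodup := by
  obtain ⟨a₁, b₁⟩ := hR.good.cod_eq_one h₁ hp₁
  obtain ⟨a₂, b₂⟩ := hR.good.cod_eq_one h₂ hp₂
  have c1 : y₁ ≠ z₂ := by rintro rfl; omega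
  have c2 : z₁ ≠ y₂ := by rintro rfl; omega
  have c3 : z₁ ≠ z₂ := by
    rintro rfl
    exact not_adj_of_spine hR.good h₁.1 hp₁ hne h₁.2.2 h₁.2.1 h₂.1 h₂.2.1
  have := h₁.1.ne
  have := h₁.2.1.ne
  have := h₁.2.2.ne
  have := h₂.1.ne
  have := h₂.2.1.ne
  have := h₂.2.2.ne
  simp_all

lemma sum_map_le_sum_map {f g : V → ℤ} (h : ∀ v, f v ≤ g v) (l : List V) :
    (l.map f).sum ≤ (l.map g).sum := List.sum_le_sum fun v _ => h v

/-- An isolated triangle, or two books with a common spine vertex, supplies a list with this much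
negative deviation. It costs squares, which bounds the counts from above, and it forces loads beyond
1, which bounds them from below. -/
lemma counts_of_list (hR : IsResidual G k) {l : List V} (hl : l.Nodup)
    (h : 2 * (k : ℤ) - 4 ≤ (l.map fun v => -dev G k v - 1).sum) {f r q : ℤ}
    (hf : bareSum G = 4 * f) (hdev : ∑ v, dev G k v = 2 * k - 1 - 2 * r - 2 * q)
    (hload : ∑ v, load G v = 2 * r + 3 * q) (hsq : ∑ v, dev G k v ^ 2 + 4 * f ≤ 4 * k + 1) :
    r + q + 2 * f ≤ k + 4 ∧ 6 * k - 3 - 2 * f ≤ 2 * r + 3 * q := by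
  constructor
  · have h1 : (l.map fun v => dev G k v ^ 2 + dev G k v).sum ≤
        ∑ v, (dev G k v ^ 2 + dev G k v) := by
      refine sum_map_le_sum (fun v => ?_) hl
      rcases le_or_gt 0 (dev G k v) with h | h
      · positivity
      · nlinarith
    -- The difference is (d+1)(d+2), which is nonnegative for integers d.
    have h2 : (l.map fun v => 2 * (-dev G k v - 1)).sum ≤
        (l.map fun v => dev G k v ^ 2 + dev G k v).sum := by
      refine sum_map_le_sum_map (fun v => ?_) l
      rcases le_or_gt (-1) (dev G k v) with h | h
      · nlinarith
      · nlinarith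
    rw [List.sum_map_mul_left] at h2
    rw [Finset.sum_add_distrib, hdev] at h1
    linarith
  · have h1 : (l.map fun v => load G v - min (load G v) 1).sum ≤
        ∑ v, (load G v - min (load G v) 1) :=
      sum_map_le_sum (fun v => by omega) hl
    have h2 : (l.map fun v => -dev G k v - 1).sum ≤
        (l.map fun v => load G v - min (load G v) 1).sum :=
      sum_map_le_sum_map (fun v => by have := hR.dev_ge v; omega) l
    rw [Finset.sum_sub_distrib, hload] at h1
    have h3 := hR.sum_min_le
    have h4 := hR.two_mul_sum_bareDeg_le.1
    rw [hf] at h4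
    linarith

/-- With thirteen vertices, a vertex of low degree lies on one isolated triangle and is a spine
vertex of a book with two pages. -/
lemma exists_book_of_dev (hR : IsResidual G 3) (h0 : bareSum G = 0) {x : V}
    (hx : dev G 3 x = -2) : ∃ y z w, z ≠ w ∧ 2 ≤ cod G x y ∧ IsTri G x y z ∧ IsTri G x y w ∧
      3 ≤ dev G 3 y ^ 2 + dev G 3 z ^ 2 + dev G 3 w ^ 2 := by
  have h1 := hR.dev_add x
  have h2 := hR.dev_ge x
  obtain ⟨c, hc⟩ := even_pageDeg (G := G) x
  have h3 := pageDeg_nonneg (G := G) x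
  have h4 := spineDeg_nonneg (G := G) x
  have h5 := isoDeg_nonneg (G := G) x
  have h6 := two_mul_spineDeg_le_leafDeg (G := G) x
  have h7 : bareDeg G x = 0 := Finset.sum_eq_zero fun y _ => by
    have := bareInd_le_bareSum (G := G) x y
    have := bareInd_nonneg (G := G) x y
    omega
  unfold load at h2
  have h9 := leafDeg_le hR.cod_le x
  have hS : spineDeg G x = 1 ∧ leafDeg G x = 2 := by
    push_cast at *
    rcases (by omega : spineDeg G x = 0 ∨ 1 ≤ spineDeg G x) with h | h <;> omega
  obtain ⟨y, hy, hp⟩ := exists_of_one_le_spineDeg (by omega : 1 ≤ spineDeg G x)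
  have h8 := cod_le_leafDeg hy hp
  have hp2 : cod G x y = 2 := by omega
  obtain ⟨z, w, hne, hz, hz', hw, hw'⟩ := exists_two_of_two_le_cod hp
  -- With deviation -2 at `x` and two pages, the deviation of `y` plus that of either page is at
  -- most -2. Over the integers the three squares then sum to at least 3.
  have e1 := hR.dev_tri ⟨hy, hz', hz⟩ hp
  have e2 := hR.dev_tri ⟨hy, hw', hw⟩ hp
  rw [hp2, hx] at e1 e2
  push_cast at e1 e2
  refine ⟨y, z, w, hne, hp, ⟨hy, hz', hz⟩, ⟨hy, hw', hw⟩, ?_⟩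
  generalize dev G 3 y = a at *
  generalize dev G 3 z = b at *
  generalize dev G 3 w = c at *
  rcases le_or_gt a (-2) with h | h
  · nlinarith [sq_nonneg b, sq_nonneg c]
  · rcases le_or_gt a (-1) with h | h
    · nlinarith
    · nlinarith [sq_nonneg a]

lemma neg_two_le_dev (hR : IsResidual G 3) (x : V) : -2 ≤ dev G 3 x := by
  have h1 := hR.dev_add x
  have h2 := hR.dev_ge x
  have h3 := pageDeg_nonneg (G := G) x
  have h4 := spineDeg_nonneg (G := G) x
  have h5 := isoDeg_nonneg (G := G) x
  have h6 := two_mul_spineDeg_le_leafDeg (G := G) x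
  have h7 := bareDeg_nonneg (G := G) x
  unfold load at h2
  push_cast at *
  omega

/-- Each of `x`, `y` has a two-page book, and these books meet the triangle only in `x` and `y` and
are disjoint. The nine vertices carry squares of total at least 4 + 4 + 1 + 3 + 3 = 15 > 13. -/
lemma false_of_isIsoTri_aux (hR : IsResidual G 3) (h0 : bareSum G = 0) {x y z : V}
    (h : IsIsoTri G x y z) (hx : dev G 3 x = -2) (hy : dev G 3 y = -2)
    (hsq : ∑ v, dev G 3 v ^ 2 ≤ 13) : False := by
  have hz := hR.dev_iso h
  have hz' := hR.neg_two_le_dev z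
  rw [hx, hy] at hz
  push_cast at hz
  obtain ⟨a, b, c, hbc, hp, hab, hac, hs⟩ := hR.exists_book_of_dev h0 hx
  obtain ⟨a', b', c', hbc', hp', hab', hac', hs'⟩ := hR.exists_book_of_dev h0 hy
  have hxy := h.1.1
  have hyz := h.1.2.1
  have hxz := h.1.2.2
  have cxy : ∀ u, G.Adj x u → G.Adj y u → u = z := fun u h1 h2 =>
    eq_of_cod_eq_one h.2.1 h1 h2 hxz hyz
  have cxz : ∀ u, G.Adj x u → G.Adj z u → u = y := fun u h1 h2 =>
    eq_of_cod_eq_one h.2.2.2 h1 h2 hxy hyz.symm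
  have cyz : ∀ u, G.Adj y u → G.Adj z u → u = x := fun u h1 h2 =>
    eq_of_cod_eq_one h.2.2.1 h1 h2 hxy.symm hxz.symm
  have nay : a ≠ y := by rintro rfl; have := h.2.1; omega
  have naz : a ≠ z := by rintro rfl; have := h.2.2.2; omega
  have na'x : a' ≠ x := by rintro rfl; have := h.2.1; rw [cod_comm] at this; omega
  have na'z : a' ≠ z := by rintro rfl; have := h.2.2.1; omega
  have page : ∀ b, IsTri G x a b → b ≠ x ∧ b ≠ y ∧ b ≠ z ∧ b ≠ a := by
    intro b hb
    refine ⟨hb.2.2.ne', ?_, ?_, hb.2.1.ne'⟩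
    · rintro rfl
      exact naz (cxy a hb.1 hb.2.1.symm)
    · rintro rfl
      exact nay (cxz a hb.1 hb.2.1.symm)
  have page' : ∀ b, IsTri G y a' b → b ≠ x ∧ b ≠ y ∧ b ≠ z ∧ b ≠ a' := by
    intro b hb
    refine ⟨?_, hb.2.2.ne', ?_, hb.2.1.ne'⟩
    · rintro rfl
      exact na'z (cxy a' hb.2.1.symm hb.1)
    · rintro rfl
      exact na'x (cyz a' hb.1 hb.2.1.symm)
  obtain ⟨b1, b2, b3, b4⟩ := page b hab
  obtain ⟨c1, c2, c3, c4⟩ := page c hac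
  obtain ⟨b1', b2', b3', b4'⟩ := page' b' hab'
  obtain ⟨c1', c2', c3', c4'⟩ := page' c' hac'
  have disj : ∀ u w, G.Adj x u → u ≠ z → G.Adj y w → u ≠ w := by
    rintro u w hu hz hw rfl
    exact hz (cxy u hu hw)
  have ax := hab.1
  have bx := hab.2.2
  have cx := hac.2.2
  have ay := hab'.1
  have b_y := hab'.2.2
  have cy := hac'.2.2
  have d1 := disj a a' ax naz ay
  have d2 := disj a b' ax naz b_y
  have d3 := disj a c' ax naz cy
  have d4 := disj b a' bx b3 ay
  have d5 := disj b b' bx b3 b_y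
  have d6 := disj b c' bx b3 cy
  have d7 := disj c a' cx c3 ay
  have d8 := disj c b' cx c3 b_y
  have d9 := disj c c' cx c3 cy
  have hl : [x, y, z, a, b, c, a', b', c'].Nodup := by
    have := hxy.ne
    have := hyz.ne
    have := hxz.ne
    have := ax.ne
    have := ay.ne
    simp only [List.nodup_cons, List.mem_cons, List.not_mem_nil, or_false, not_or, not_false_eq_true,
      List.nodup_nil, and_true]
    refine ⟨⟨?_, ?_, ?_, ?_, ?_, ?_, ?_, ?_⟩, ⟨?_, ?_, ?_, ?_, ?_, ?_, ?_⟩, ⟨?_, ?_, ?_, ?_, ?_, ?_⟩,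
      ⟨?_, ?_, ?_, ?_, ?_⟩, ⟨?_, ?_, ?_, ?_⟩, ⟨?_, ?_, ?_⟩, ⟨?_, ?_⟩, ?_⟩ <;>
      first | assumption | (apply Ne.symm; assumption)
  have hsum := sum_map_le_sum (f := fun v => dev G 3 v ^ 2) (fun v => sq_nonneg _) hl
  simp only [List.map_cons, List.map_nil, List.sum_cons, List.sum_nil, hx, hy] at hsum
  have : 1 ≤ dev G 3 z ^ 2 := by nlinarith
  linarith

lemma false_of_isIsoTri (hR : IsResidual G 3) (h0 : bareSum G = 0) {x y z : V}
    (h : IsIsoTri G x y z) (hsq : ∑ v, dev G 3 v ^ 2 ≤ 13) : False := by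
  have h1 := hR.dev_iso h
  push_cast at h1
  have hx := hR.neg_two_le_dev x
  have hy := hR.neg_two_le_dev y
  have hz := hR.neg_two_le_dev z
  by_cases ex : dev G 3 x = -2
  · by_cases ey : dev G 3 y = -2
    · exact false_of_isIsoTri_aux hR h0 h ex ey hsq
    · exact false_of_isIsoTri_aux hR h0 h.rotate.rotate (by omega) ex hsq
  · exact false_of_isIsoTri_aux hR h0 h.rotate (by omega) (by omega) hsq

lemma exists_isIsoTri {q : ℤ} (hq : ∑ v, isoDeg G v = 6 * q) (h : 1 ≤ q) :
    ∃ x y z, IsIsoTri G x y z := by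
  by_contra! hc
  have : ∑ v, isoDeg G v = 0 := Finset.sum_eq_zero fun v _ => by
    by_contra h0
    have := isoDeg_nonneg (G := G) v
    obtain ⟨y, z, h⟩ := exists_of_one_le_isoDeg (by omega : 1 ≤ isoDeg G v)
    exact hc v y z h
  omega

/-- The two bounds of `counts_of_list` give r ≤ 15 - 3k - 4f, leaving k ≤ 5. The counts exclude 4
and 5; for k = 3 they force an isolated triangle and no bare edges, which `false_of_isIsoTri`
excludes. -/
lemma false_of_list (hR : IsResidual G k) (hk : 3 ≤ k) {l : List V} (hl : l.Nodup)
    (h : 2 * (k : ℤ) - 4 ≤ (l.map fun v => -dev G k v - 1).sum) : False := by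
  obtain ⟨f, r, m, q, hf, hr, hm, hq, hf0, hr0, hq0, hE, -, hm2, hdev, hload, hsq, -⟩ :=
    hR.exists_counts
  obtain ⟨h1, h2⟩ := hR.counts_of_list hl h hf hdev hload hsq
  have hr1 : r ≤ 15 - 3 * k - 4 * f := by linarith
  have hk5 : k < 6 := by
    by_contra
    omega
  interval_cases k
  · push_cast at *
    have h3 : f = 0 ∧ 1 ≤ q := by omega
    obtain ⟨x, y, z, ht⟩ := exists_isIsoTri hq h3.2
    exact false_of_isIsoTri hR (by omega) ht (by linarith [h3.1])
  · push_cast at *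
    omega
  · push_cast at *
    omega

/-- After `false_of_list` there are no isolated triangles and the spines are disjoint, so all loads
are 0 or 1 and all deviations are at least -1. Then every book is large, and there are too many book
triangles. -/
lemma false_of_three_le (hR : IsResidual G k) (hk : 3 ≤ k) : False := by
  by_cases hI : ∃ x y z, IsIsoTri G x y z
  · obtain ⟨x, y, z, h⟩ := hI
    refine hR.false_of_list hk (l := [x, y, z]) ?_ ?_
    · have := h.1.1.ne
      have := h.1.2.1.ne
      have := h.1.2.2.ne
      simp_all
    · have := hR.dev_iso h
      simp only [List.map_cons, List.map_nil, List.sum_cons, List.sum_nil]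
      linarith
  by_cases hS : ∃ v, 2 ≤ spineDeg G v
  · obtain ⟨v, hv⟩ := hS
    obtain ⟨y₁, y₂, hne, h₁, hp₁, h₂, hp₂⟩ := exists_of_two_le_spineDeg hv
    obtain ⟨z₁, hz₁, hz₁'⟩ := exists_of_cod_pos (by omega : cod G v y₁ ≠ 0)
    obtain ⟨z₂, hz₂, hz₂'⟩ := exists_of_cod_pos (by omega : cod G v y₂ ≠ 0)
    have t₁ : IsTri G v y₁ z₁ := ⟨h₁, hz₁', hz₁⟩
    have t₂ : IsTri G v y₂ z₂ := ⟨h₂, hz₂', hz₂⟩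
    refine hR.false_of_list hk (hR.nodup_bowtie t₁ hp₁ t₂ hp₂ hne) ?_
    have := hR.dev_bowtie t₁ hp₁ t₂ hp₂ hne
    simp only [List.map_cons, List.map_nil, List.sum_cons, List.sum_nil]
    linarith
  push Not at hS
  obtain ⟨f, r, m, q, hf, hr, hm, hq, hf0, hr0, hq0, hE, -, hm2, hdev, hload, hsq, -⟩ :=
    hR.exists_counts
  have hI0 : ∀ v, isoDeg G v = 0 := by
    intro v
    by_contra h0
    have := isoDeg_nonneg (G := G) v
    obtain ⟨y, z, h⟩ := exists_of_one_le_isoDeg (by omega : 1 ≤ isoDeg G v)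
    exact hI ⟨v, y, z, h⟩
  have hq' : q = 0 := by
    have : ∑ v, isoDeg G v = 0 := Finset.sum_eq_zero fun v _ => hI0 v
    omega
  have hl : ∀ v, load G v = spineDeg G v := fun v => by simp [load, hI0 v]
  have hS0 : ∀ v, spineDeg G v = 0 ∨ spineDeg G v = 1 := fun v => by
    have := spineDeg_nonneg (G := G) v
    have := hS v
    omega
  have hge : ∀ v, -1 ≤ dev G k v := fun v => by
    have := hR.dev_ge v
    have := hS v
    rw [hl] at *
    omega
  have hSdev : ∀ v, spineDeg G v * dev G k v = dev G k v := fun v => by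
    rcases hS0 v with h | h
    · rw [h, (hR.of_load_eq_zero (by rw [hl, h])).1]; simp
    · rw [h, one_mul]
  -- By `dev_tri` with a page of deviation at least -1, a spine has at least 2k - 1 + dev v + dev y
  -- pages; the sum over both ends reaches every vertex of nonzero deviation exactly once.
  have hL : 2 * ((2 * k - 1) * r + ∑ v, dev G k v) ≤ ∑ v, leafDeg G v := by
    have e1 : ∑ v, leafDeg G v = ∑ v, ∑ y, spineInd G v y * cod G v y := by
      simp only [leafDeg_eq]
    have e2 : ∀ v y, spineInd G v y * (2 * k - 1 + dev G k v + dev G k y) ≤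
        spineInd G v y * cod G v y := by
      intro v y
      by_cases h : G.Adj v y ∧ 2 ≤ cod G v y
      · refine mul_le_mul_of_nonneg_left ?_ (spineInd_nonneg _ _)
        obtain ⟨z, hz, hz'⟩ := exists_of_cod_pos (by omega : cod G v y ≠ 0)
        have := hR.dev_tri ⟨h.1, hz', hz⟩ h.2
        have := hge z
        linarith
      · simp [spineInd, h]
    have e3 : ∑ v, ∑ y, spineInd G v y * (2 * k - 1 + dev G k v + dev G k y) =
        (2 * k - 1) * ∑ v, spineDeg G v + 2 * ∑ v, spineDeg G v * dev G k v := by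
      have a1 : ∑ v, ∑ y, spineInd G v y * dev G k y = ∑ v, spineDeg G v * dev G k v := by
        rw [Finset.sum_comm]
        refine Finset.sum_congr rfl fun v _ => ?_
        rw [← Finset.sum_mul, spineDeg]
        simp only [spineInd_comm]
      have a2 : ∑ v, ∑ y, spineInd G v y * dev G k v = ∑ v, spineDeg G v * dev G k v := by
        simp only [← Finset.sum_mul, spineDeg]
      simp only [mul_add, Finset.sum_add_distrib]
      rw [a1, a2]
      simp only [← Finset.sum_mul, spineDeg]
      ring
    simp only [hSdev, hr] at e3
    have e4 := Finset.sum_le_sum fun v (_ : v ∈ Finset.univ) =>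
      Finset.sum_le_sum fun y (_ : y ∈ Finset.univ) => e2 v y
    rw [e3, ← e1] at e4
    linarith
  have hmin : ∑ v, min (load G v) 1 = 2 * r := by
    rw [← hr]
    refine Finset.sum_congr rfl fun v _ => ?_
    rw [hl]
    rcases hS0 v with h | h <;> simp [h]
  have h3 := hR.sum_min_le
  have h4 := hR.two_mul_sum_bareDeg_le.1
  rw [hmin] at h3
  rw [hf] at h4
  rw [hdev, hm] at hL
  have hsq' : -∑ v, dev G k v ≤ ∑ v, dev G k v ^ 2 := by
    rw [← Finset.sum_neg_distrib]
    refine Finset.sum_le_sum fun v _ => ?_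
    rcases le_or_gt 0 (dev G k v) with h | h
    · nlinarith
    · nlinarith
  rw [hdev] at hsq'
  subst hq'
  have h5 : 2 * k + 1 ≤ f + r := by omega
  -- From r ≤ 3k - 2f, by squares, and f ≥ 2k + 1 - r. With `h7` this gives 2k ≤ 5, against k ≥ 3.
  have h6 : (k : ℤ) + 2 ≤ r := by linarith
  have h7 : (2 * k - 2) * r ≤ 2 * (k : ℤ) ^ 2 + 1 - f := by linarith
  have hk' : (3 : ℤ) ≤ k := by exact_mod_cast hk
  nlinarith

end IsResidual
end ResidualLarge
end LayerDomination

namespace LayerDomination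

/-! ### Residual graphs on nine vertices -/

section ResidualNine

set_option linter.unusedSectionVars false

variable {V : Type*} [Fintype V] {G : SimpleGraph V}

lemma leafDeg_le_cod_add {m : ℤ} (hm : ∀ x y, G.Adj x y → 2 ≤ cod G x y → cod G x y ≤ m) {x y : V}
    (h : G.Adj x y) (hp : 2 ≤ cod G x y) :
    leafDeg G x ≤ cod G x y + m * (spineDeg G x - 1) := by
  have h1 := Finset.single_le_sum (f := fun y => spineInd G x y * (m - cod G x y))
    (fun y _ => by
      by_cases h : G.Adj x y ∧ 2 ≤ cod G x y
      · exact mul_nonneg (spineInd_nonneg _ _) (by linarith [hm x y h.1 h.2])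
      · simp [spineInd, h]) (Finset.mem_univ y)
  have h2 : spineInd G x y = 1 := if_pos ⟨h, hp⟩
  simp only [mul_sub, Finset.sum_sub_distrib, ← leafDeg_eq, ← Finset.sum_mul] at h1
  rw [h2, ← spineDeg] at h1
  linarith

lemma mul_spineDeg_le_leafDeg {m : ℤ} (hm : ∀ x y, G.Adj x y → 2 ≤ cod G x y → m ≤ cod G x y)
    (v : V) : m * spineDeg G v ≤ leafDeg G v := by
  rw [leafDeg_eq, spineDeg, Finset.mul_sum]
  refine Finset.sum_le_sum fun y _ => ?_
  unfold spineInd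
  split_ifs with h
  · linarith [hm v y h.1 h.2]
  · simp

lemma exists_spine {r : ℤ} (hr : ∑ v, spineDeg G v = 2 * r) (h : 1 ≤ r) :
    ∃ x y, G.Adj x y ∧ 2 ≤ cod G x y := by
  by_contra! hc
  have : ∑ v, spineDeg G v = 0 := Finset.sum_eq_zero fun v _ => by
    by_contra h0
    have := spineDeg_nonneg (G := G) v
    obtain ⟨y, h1, h2⟩ := exists_of_one_le_spineDeg (by omega : 1 ≤ spineDeg G v)
    exact absurd (hc v y h1) (not_lt.2 h2)
  omega

lemma bareDeg_eq_zero (h0 : bareSum G = 0) (x : V) : bareDeg G x = 0 :=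
  Finset.sum_eq_zero fun y _ => by
    have := bareInd_le_bareSum (G := G) x y
    have := bareInd_nonneg (G := G) x y
    omega

lemma neg_sum_le_sum_sq (f : V → ℤ) : -∑ v, f v ≤ ∑ v, f v ^ 2 := by
  rw [← Finset.sum_neg_distrib]
  refine Finset.sum_le_sum fun v _ => ?_
  rcases le_or_gt 0 (f v) with h | h <;> nlinarith

/-- If all edges lie in one triangle, all degrees are four and there are nine vertices, then the
graph is the rook's graph. -/
lemma isRook_of_deg_eq (hn : Fintype.card V = 9) (hd : ∀ x, deg G x = 4)
    (hc : ∀ x y, G.Adj x y → cod G x y = 1) : IsRook G := by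
  refine ⟨hn, hd, hc, fun x y hne hxy => ?_⟩
  -- The triple slack 9 + 3 - 12 is zero, so `y` sees a corner of each triangle `x a b`; it does not
  -- see `x`, nor both `a` and `b`. Hence each of the two triangles at `x` contributes one common
  -- neighbour.
  have key : ∀ a b, adjInd G x a * adjInd G a b * adjInd G x b * (adjInd G y a + adjInd G y b) =
      adjInd G x a * (adjInd G x b * adjInd G a b) := by
    intro a b
    by_cases h1 : G.Adj x a
    · by_cases h2 : G.Adj a b
      · by_cases h3 : G.Adj x b
        · have hs := triple_slack_eq (G := G) x a b
          rw [hn, hd, hd, hd, hc _ _ h1, hc _ _ h2, hc _ _ h3] at hs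
          have h4 := Finset.single_le_sum (f := fun v => (1 - adjInd G x v) * (1 - adjInd G a v) *
            (1 - adjInd G b v) + adjInd G x v * adjInd G a v * adjInd G b v) (fun v _ => by
              have := adjInd_le_one (G := G) x v
              have := adjInd_le_one (G := G) a v
              have := adjInd_le_one (G := G) b v
              have := adjInd_nonneg (G := G) x v
              have := adjInd_nonneg (G := G) a v
              have := adjInd_nonneg (G := G) b v
              have : 0 ≤ 1 - adjInd G x v := by linarith
              have : 0 ≤ 1 - adjInd G a v := by linarith
              have : 0 ≤ 1 - adjInd G b v := by linarith
              positivity) (Finset.mem_univ y)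
          rw [← hs, adjInd_of_not_adj hxy] at h4
          rw [adjInd_of_adj h1, adjInd_of_adj h2, adjInd_of_adj h3]
          rw [adjInd_comm y a, adjInd_comm y b]
          by_cases h5 : G.Adj a y
          · by_cases h6 : G.Adj b y
            · exact absurd (eq_of_cod_eq_one (hc _ _ h2) h1.symm h3.symm h5 h6) hne
            · rw [adjInd_of_adj h5, adjInd_of_not_adj h6]; norm_num
          · rw [adjInd_of_not_adj h5] at h4 ⊢
            by_cases h6 : G.Adj b y
            · rw [adjInd_of_adj h6]; norm_num
            · rw [adjInd_of_not_adj h6] at h4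
              norm_num at h4
        · rw [adjInd_of_not_adj h3]; ring
      · rw [adjInd_of_not_adj h2]; ring
    · rw [adjInd_of_not_adj h1]; ring
  have hone : ∀ a, adjInd G x a * cod G x a = adjInd G x a := by
    intro a
    by_cases h1 : G.Adj x a
    · rw [hc _ _ h1, mul_one]
    · rw [adjInd_of_not_adj h1, zero_mul]
  have h1 : ∑ a, ∑ b, adjInd G x a * adjInd G a b * adjInd G x b *
      (adjInd G y a + adjInd G y b) = 4 := by
    rw [← hd x, deg]
    refine Finset.sum_congr rfl fun a _ => ?_
    simp only [key, ← Finset.mul_sum]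
    exact hone a
  have h2 : ∑ a, ∑ b, adjInd G x a * adjInd G a b * adjInd G x b * adjInd G y a = cod G x y := by
    rw [cod]
    refine Finset.sum_congr rfl fun a _ => ?_
    have e : adjInd G x a * adjInd G y a = adjInd G x a * cod G x a * adjInd G y a := by rw [hone]
    rw [e, cod, Finset.mul_sum, Finset.sum_mul]
    exact Finset.sum_congr rfl fun b _ => by ring
  have h3 : ∑ a, ∑ b, adjInd G x a * adjInd G a b * adjInd G x b * adjInd G y b = cod G x y := by
    rw [← h2, Finset.sum_comm]
    refine Finset.sum_congr rfl fun a _ => Finset.sum_congr rfl fun b _ => ?_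
    rw [adjInd_comm b a]
    ring
  simp only [mul_add, Finset.sum_add_distrib] at h1
  linarith

namespace IsResidual

lemma dev_pair_of_isTight (hR : IsResidual G 2) (ht : IsTight G) {x y z : V}
    (h : IsTri G x y z) (hp : 2 ≤ cod G x y) : dev G 2 x = -dev G 2 z ∧ dev G 2 y = -dev G 2 z ∧
      dev G 2 x + dev G 2 y + dev G 2 z = cod G x y - 4 := by
  obtain ⟨h1, h2⟩ := hR.good.cod_eq_one h hp
  have h3 := ht.pair x y z h h1 hp
  have h4 := ht.pair y x z h.swap h2 (by rw [cod_comm]; exact hp)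
  have h5 := ht.triple x y z h
  rw [h1, h2, hR.card] at h5
  rw [hR.card] at h3 h4
  unfold dev
  push_cast at *
  omega

/-- The sums force all deviations into {0, -1}, with exactly four zeros. But tightness makes a spine
and its pages have deviation 0 and gives four pages, hence six zeros. -/
lemma false_of_isTight (hR : IsResidual G 2) (ht : IsTight G) {r : ℤ}
    (hr : ∑ v, spineDeg G v = 2 * r) (hr1 : 1 ≤ r) (hdev : ∑ v, dev G 2 v = -5)
    (hsq : ∑ v, dev G 2 v ^ 2 = 5) : False := by
  have hnn : ∀ v, 0 ≤ dev G 2 v ^ 2 + dev G 2 v := fun v => by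
    rcases le_or_gt 0 (dev G 2 v) with h | h <;> nlinarith
  have h0 : ∑ v, (dev G 2 v ^ 2 + dev G 2 v) = 0 := by
    rw [Finset.sum_add_distrib]; omega
  rw [Finset.sum_eq_zero_iff_of_nonneg fun v _ => hnn v] at h0
  have h1 : ∀ v, dev G 2 v = 0 ∨ dev G 2 v = -1 := fun v => by
    have h2 := h0 v (Finset.mem_univ v)
    have h3 : dev G 2 v * (dev G 2 v + 1) = 0 := by linarith
    rcases mul_eq_zero.1 h3 with h | h <;> omega
  obtain ⟨x, y, hxy, hp⟩ := exists_spine hr hr1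
  have hpage : ∀ z, IsTri G x y z → dev G 2 z = 0 ∧ dev G 2 x = 0 ∧ dev G 2 y = 0 ∧
      cod G x y = 4 := by
    intro z hz
    have := hR.dev_pair_of_isTight ht hz hp
    have := h1 z
    have := h1 x
    omega
  obtain ⟨z, hz, hz'⟩ := exists_of_cod_pos (by omega : cod G x y ≠ 0)
  obtain ⟨-, hx, hy, hc⟩ := hpage z ⟨hxy, hz', hz⟩
  have e1 : ∑ u, adjInd G x u * adjInd G y u * (1 + dev G 2 u) = 4 := by
    rw [← hc, cod]
    refine Finset.sum_congr rfl fun u _ => ?_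
    by_cases h1 : G.Adj x u
    · by_cases h2 : G.Adj y u
      · rw [(hpage u ⟨hxy, h2, h1⟩).1]; ring
      · rw [adjInd_of_not_adj h2]; ring
    · rw [adjInd_of_not_adj h1]; ring
  have e2 := Finset.add_le_sum (f := fun u => (1 - adjInd G x u * adjInd G y u) * (1 + dev G 2 u))
    (s := Finset.univ) (fun u _ => mul_nonneg (by
      have := adjInd_le_one (G := G) x u
      have := adjInd_le_one (G := G) y u
      have := adjInd_nonneg (G := G) x u
      have := adjInd_nonneg (G := G) y u
      nlinarith) (by have := h1 u; omega)) (Finset.mem_univ x) (Finset.mem_univ y) hxy.ne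
  rw [hx, hy] at e2
  simp only [sub_mul, Finset.sum_sub_distrib, e1, one_mul, Finset.sum_add_distrib, hdev,
    adjInd_self] at e2
  simp [hR.card] at e2

/-- The end of a three-page spine, if all loads are at most one and the edges in no triangle join
vertices of load zero to the others. -/
lemma dev_ne_of_cod_eq_three (hR : IsResidual G 2) (hl : ∀ v, load G v ≤ 1)
    (hbare : ∀ x u, G.Adj x u → cod G x u = 0 → 1 ≤ load G x → 1 ≤ load G u → False)
    {x y : V} (h : G.Adj x y) (hp : cod G x y = 3) : dev G 2 x ≠ 0 ∧ isoDeg G x = 0 := by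
  have h1 := one_le_spineDeg h (by omega)
  have h2 := isoDeg_nonneg (G := G) x
  have h3 := isoDeg_eq (G := G) x
  have h4 := hl x
  unfold load at h4
  have hS : spineDeg G x = 1 := by omega
  have hI : isoDeg G x = 0 := by omega
  have h5 := leafDeg_le_cod_add hR.cod_le h (by omega)
  have h6 := cod_le_leafDeg h (by omega)
  have h7 := hR.dev_add x
  have h8 := bareDeg_nonneg (G := G) x
  have h9 := pageDeg_nonneg (G := G) x
  obtain ⟨c, hc⟩ := even_pageDeg (G := G) x
  rw [hS] at *
  push_cast at *
  -- A bare edge would make the deviation of `x` nonnegative, hence that of the other end negative,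
  -- so that both ends would have positive load.
  have hZ : bareDeg G x = 0 := by
    by_contra hZ
    obtain ⟨u, hu, hu'⟩ := exists_bare_of_one_le_bareDeg (by omega : 1 ≤ bareDeg G x)
    have h10 := hR.dev_bare hu'
    refine hbare x u hu hu' ?_ (hR.load_pos_of_dev_ne (by omega))
    unfold load
    omega
  exact ⟨by omega, hI⟩

lemma three_le_of_add_le {a b c : ℤ} (h : a + b + c ≤ -3) : 3 ≤ a ^ 2 + b ^ 2 + c ^ 2 := by
  nlinarith [sq_nonneg (a + 1), sq_nonneg (b + 1), sq_nonneg (c + 1)]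

lemma nine_le_of_add_le {a b c : ℤ} (h : a + b + c ≤ -3) (ha : a = 1) :
    9 ≤ a ^ 2 + b ^ 2 + c ^ 2 := by
  subst ha
  nlinarith [sq_nonneg (b + 2), sq_nonneg (c + 2)]

/-- The spine ends have nonzero deviation and the isolated triangle needs squares of sum at least 3.
That exhausts the budget 5, so the graph is tight; then a page has deviation 1 and exceeds the
budget. -/
lemma false_of_cod_eq_three (hR : IsResidual G 2) (hl : ∀ v, load G v ≤ 1)
    (hbare : ∀ x u, G.Adj x u → cod G x u = 0 → 1 ≤ load G x → 1 ≤ load G u → False)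
    (hsq : ∑ v, dev G 2 v ^ 2 ≤ 5) (ht : ∑ v, dev G 2 v ^ 2 = 5 → IsTight G)
    {x y : V} (h : G.Adj x y) (hp : cod G x y = 3) {a b c : V} (hI : IsIsoTri G a b c) : False := by
  obtain ⟨x1, x2⟩ := hR.dev_ne_of_cod_eq_three hl hbare h hp
  obtain ⟨y1, y2⟩ := hR.dev_ne_of_cod_eq_three hl hbare h.symm (by rw [cod_comm]; exact hp)
  have ia := hI.isoDeg
  have ib := hI.rotate.isoDeg
  have ic := hI.rotate.rotate.isoDeg
  have nx : ∀ u, 1 ≤ isoDeg G u → u ≠ x := by rintro u hu rfl; omega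
  have ny : ∀ u, 1 ≤ isoDeg G u → u ≠ y := by rintro u hu rfl; omega
  have sx : 1 ≤ dev G 2 x ^ 2 := by
    have := sq_nonneg (dev G 2 x)
    have : dev G 2 x ^ 2 ≠ 0 := pow_ne_zero 2 x1
    omega
  have sy : 1 ≤ dev G 2 y ^ 2 := by
    have := sq_nonneg (dev G 2 y)
    have : dev G 2 y ^ 2 ≠ 0 := pow_ne_zero 2 y1
    omega
  have hd := hR.dev_iso hI
  push_cast at hd
  have habc := three_le_of_add_le (by linarith : dev G 2 a + dev G 2 b + dev G 2 c ≤ -3)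
  have hnd : [x, y, a, b, c].Nodup := by
    have := h.ne
    have := hI.1.1.ne
    have := hI.1.2.1.ne
    have := hI.1.2.2.ne
    have := (nx a ia).symm
    have := (nx b ib).symm
    have := (nx c ic).symm
    have := (ny a ia).symm
    have := (ny b ib).symm
    have := (ny c ic).symm
    simp_all
  have hs := sum_map_le_sum (f := fun v => dev G 2 v ^ 2) (fun v => sq_nonneg _) hnd
  simp only [List.map_cons, List.map_nil, List.sum_cons, List.sum_nil] at hs
  have htight := ht (by omega)
  obtain ⟨z, hz, hz'⟩ := exists_of_cod_pos (by omega : cod G x y ≠ 0)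
  have e := hR.dev_pair_of_isTight htight ⟨h, hz', hz⟩ (by omega)
  rw [hp] at e
  have ez : dev G 2 z = 1 := by omega
  have za : z ≠ a := by
    rintro rfl
    have := nine_le_of_add_le (by linarith : dev G 2 z + dev G 2 b + dev G 2 c ≤ -3) ez
    omega
  have zb : z ≠ b := by
    rintro rfl
    have := nine_le_of_add_le (by linarith : dev G 2 z + dev G 2 a + dev G 2 c ≤ -3) ez
    omega
  have zc : z ≠ c := by
    rintro rfl
    have := nine_le_of_add_le (by linarith : dev G 2 z + dev G 2 a + dev G 2 b ≤ -3) ez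
    omega
  have hnd' : [z, x, y, a, b, c].Nodup := by
    rw [List.nodup_cons]
    refine ⟨?_, hnd⟩
    have := hz.ne'
    have := hz'.ne'
    simp_all
  have hs := sum_map_le_sum (f := fun v => dev G 2 v ^ 2) (fun v => sq_nonneg _) hnd'
  simp only [List.map_cons, List.map_nil, List.sum_cons, List.sum_nil, ez] at hs
  omega

/-- Two spines of at most four pages with seven pages in total have three and four. -/
lemma exists_cod_eq_three (hR : IsResidual G 2) (hr : ∑ v, spineDeg G v = 4)
    (hm : ∑ v, leafDeg G v = 14) : ∃ x y, G.Adj x y ∧ cod G x y = 3 := by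
  have h1 : ∃ x y, G.Adj x y ∧ 2 ≤ cod G x y ∧ cod G x y ≤ 3 := by
    by_contra! hc
    have := Finset.sum_le_sum fun v (_ : v ∈ Finset.univ) => mul_spineDeg_le_leafDeg (m := 4)
      (fun x y h1 h2 => by have := hc x y h1 h2; omega) v
    rw [← Finset.mul_sum] at this
    omega
  obtain ⟨x, y, h, hp, hp'⟩ := h1
  refine ⟨x, y, h, ?_⟩
  have h2 := Finset.add_le_sum (f := fun v => 4 * spineDeg G v - leafDeg G v) (s := Finset.univ)
    (fun v _ => by have := leafDeg_le hR.cod_le v; push_cast at this; linarith)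
    (Finset.mem_univ x) (Finset.mem_univ y) h.ne
  rw [Finset.sum_sub_distrib, ← Finset.mul_sum, hr, hm] at h2
  have h3 := leafDeg_le_cod_add hR.cod_le h hp
  have h4 := leafDeg_le_cod_add hR.cod_le h.symm (by rw [cod_comm]; exact hp)
  rw [cod_comm y x] at h4
  push_cast at *
  omega

/-- The ends of a two-page spine have nonnegative deviation, so its page has deviation at most -2
and load at least 2; with its page triangle this violates `weight_le`. -/
lemma three_le_cod (hR : IsResidual G 2) (h0 : bareSum G = 0) {x y : V} (h : G.Adj x y)
    (hp : 2 ≤ cod G x y) : 3 ≤ cod G x y := by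
  by_contra hc
  have hp2 : cod G x y = 2 := by omega
  have key : ∀ x y, G.Adj x y → cod G x y = 2 → 0 ≤ dev G 2 x := by
    intro x y h hp
    have h1 := one_le_spineDeg h (by omega)
    have h2 := isoDeg_nonneg (G := G) x
    have h3 := hR.weight_le x
    have h4 := hR.dev_ge x
    have h5 := leafDeg_le_cod_add hR.cod_le h (by omega)
    have h6 := cod_le_leafDeg h (by omega)
    have h7 := hR.dev_add x
    have h8 := bareDeg_eq_zero h0 x
    have h9 := pageDeg_nonneg (G := G) x
    obtain ⟨c, hc⟩ := even_pageDeg (G := G) x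
    unfold load at *
    push_cast at *
    rcases (by omega : spineDeg G x = 1 ∨ spineDeg G x = 2) with hS | hS <;> omega
  obtain ⟨z, hz, hz'⟩ := exists_of_cod_pos (by omega : cod G x y ≠ 0)
  have h1 := hR.dev_tri ⟨h, hz', hz⟩ hp
  have h2 := key x y h hp2
  have h3 := key y x h.symm (by rw [cod_comm]; exact hp2)
  have h4 := two_le_pageDeg ⟨h, hz', hz⟩ hp
  have h5 := hR.weight_le z
  have h6 := hR.dev_ge z
  have h8 := bareDeg_eq_zero h0 z
  push_cast at *
  omega

/-- Three pages per spine make every deviation odd. So the nine squares reach the bound 9 and the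
graph is tight, with deviation -1 at spine ends and 1 at pages; but `weight_le` makes a page a spine
end. -/
lemma false_of_all_three (hR : IsResidual G 2) (h0 : bareSum G = 0) {r : ℤ}
    (hr : ∑ v, spineDeg G v = 2 * r) (hr1 : 1 ≤ r) (hm : ∑ v, leafDeg G v = 6 * r)
    (hsq : ∑ v, dev G 2 v ^ 2 ≤ 9) (ht : ∑ v, dev G 2 v ^ 2 = 9 → IsTight G) : False := by
  have hL : ∀ v, leafDeg G v = 3 * spineDeg G v := by
    have h1 : ∑ v, (leafDeg G v - 3 * spineDeg G v) = 0 := by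
      rw [Finset.sum_sub_distrib, ← Finset.mul_sum, hr, hm]; ring
    rw [Finset.sum_eq_zero_iff_of_nonneg] at h1
    · intro v
      have := h1 v (Finset.mem_univ v)
      omega
    · intro v _
      have := mul_spineDeg_le_leafDeg (fun x y h1 h2 => hR.three_le_cod h0 h1 h2) v
      omega
  have hodd : ∀ v, dev G 2 v + 5 = 4 * spineDeg G v + pageDeg G v + 2 * (isoDeg G v / 2) := by
    intro v
    have h1 := hR.dev_add v
    rw [hL, bareDeg_eq_zero h0] at h1
    push_cast at h1
    linarith
  have hsq1 : ∀ v, 1 ≤ dev G 2 v ^ 2 := by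
    intro v
    obtain ⟨c, hc⟩ := even_pageDeg (G := G) v
    have h1 := hodd v
    have h2 : dev G 2 v ≠ 0 := by omega
    have := sq_nonneg (dev G 2 v)
    have : dev G 2 v ^ 2 ≠ 0 := pow_ne_zero 2 h2
    omega
  have h9 : ∑ v : V, (1 : ℤ) = 9 := by simp [hR.card]
  have hs := Finset.sum_le_sum fun v (_ : v ∈ Finset.univ) => hsq1 v
  have htight := ht (by linarith)
  have key : ∀ x y, G.Adj x y → 2 ≤ cod G x y → dev G 2 x = -1 ∧ ∃ z, IsTri G x y z ∧
      dev G 2 z = 1 := by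
    intro x y h hp
    obtain ⟨z, hz, hz'⟩ := exists_of_cod_pos (by omega : cod G x y ≠ 0)
    have e := hR.dev_pair_of_isTight htight ⟨h, hz', hz⟩ hp
    have h1 := hR.three_le_cod h0 h hp
    have h2 := hR.cod_le x y h hp
    have h3 := hsq1 z
    have h5 := hsq1 x
    push_cast at h2
    have h4 : dev G 2 z ≠ 0 := fun h => by rw [h] at h3; norm_num at h3
    exact ⟨by omega, z, ⟨h, hz', hz⟩, by omega⟩
  obtain ⟨x, y, hxy, hp⟩ := exists_spine hr hr1
  obtain ⟨-, z, hz, hz1⟩ := key x y hxy hp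
  have h1 := two_le_pageDeg hz hp
  have h2 := hodd z
  have h3 := hR.weight_le z
  have h4 := bareDeg_eq_zero h0 z
  have h5 : 1 ≤ load G z := hR.load_pos_of_dev_ne (by omega)
  have h6 := spineDeg_nonneg (G := G) z
  have h7 := isoDeg_nonneg (G := G) z
  unfold load at *
  push_cast at *
  obtain ⟨y', hy, hp'⟩ := exists_of_one_le_spineDeg (by omega : 1 ≤ spineDeg G z)
  have := (key z y' hy hp').1
  omega

lemma isRook_of_sum_spineDeg (hR : IsResidual G 2) (h0 : bareSum G = 0)
    (hr : ∑ v, spineDeg G v = 0)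
    (hdev : ∑ v, dev G 2 v = -9) (hsq : ∑ v, dev G 2 v ^ 2 ≤ 9) : IsRook G := by
  have h1 : ∑ v, (dev G 2 v + 1) ^ 2 ≤ 0 := by
    have : ∑ v, (dev G 2 v + 1) ^ 2 = ∑ v, dev G 2 v ^ 2 + 2 * ∑ v, dev G 2 v + ∑ v : V, 1 := by
      rw [Finset.mul_sum, ← Finset.sum_add_distrib, ← Finset.sum_add_distrib]
      exact Finset.sum_congr rfl fun v _ => by ring
    rw [this, hdev]
    simp only [Finset.sum_const, Finset.card_univ, hR.card]
    norm_num
    linarith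
  have h2 : ∀ v, dev G 2 v = -1 := by
    have h3 := le_antisymm h1 (Finset.sum_nonneg fun v _ => sq_nonneg _)
    rw [Finset.sum_eq_zero_iff_of_nonneg fun v _ => sq_nonneg _] at h3
    intro v
    have := pow_eq_zero_iff (two_ne_zero) |>.1 (h3 v (Finset.mem_univ v))
    omega
  rw [Finset.sum_eq_zero_iff_of_nonneg fun v _ => spineDeg_nonneg v] at hr
  refine isRook_of_deg_eq hR.card (fun x => ?_) fun x y h => ?_
  · have := h2 x
    unfold dev at this
    push_cast at this
    omega
  · obtain ⟨z, hz⟩ := exists_tri_of_bareSum h0 h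
    have h3 := hz.cod_pos
    by_contra hc
    have h4 := one_le_spineDeg h (by omega)
    have h5 := hr x (Finset.mem_univ x)
    omega

/-- Arithmetic leaves few values of (f, r, m, q). With f = 0 and r = 0 all deviations are -1, which
is the rook's graph; every other solution falls to one of the preceding lemmas. -/
theorem isRook (hR : IsResidual G 2) : IsRook G := by
  obtain ⟨f, r, m, q, hf, hr, hm, hq, hf0, hr0, hq0, hE, hm1, hm2, hdev, hload, hsq, ht⟩ :=
    hR.exists_counts
  have h1 := hR.sum_min_le
  have h2 := hR.two_mul_sum_bareDeg_le
  have h3 : ∑ v, min (load G v) 1 ≤ ∑ v, load G v := Finset.sum_le_sum fun v _ => min_le_left _ _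
  have h4 := neg_sum_le_sum_sq (dev G 2)
  rw [hdev] at h4
  rw [hf] at h2
  push_cast at *
  have hsq0 := Finset.sum_nonneg fun v (_ : v ∈ Finset.univ) => sq_nonneg (dev G 2 v)
  rcases (by omega : f = 0 ∨ f = 1 ∨ f = 2) with rfl | rfl | rfl
  · have h5 := Finset.sum_le_sum fun v (_ : v ∈ Finset.univ) =>
      mul_spineDeg_le_leafDeg (fun x y h1 h2 => hR.three_le_cod (by omega) h1 h2) v
    rw [← Finset.mul_sum] at h5
    rcases (by omega : (r = 0 ∧ q = 6) ∨ (1 ≤ r ∧ m = 3 * r)) with ⟨rfl, rfl⟩ | ⟨h6, rfl⟩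
    · exact hR.isRook_of_sum_spineDeg (by omega) (by omega) (by omega) (by omega)
    · exact (hR.false_of_all_three (by omega) hr h6 (by omega) (by omega)
        fun h => ht (by omega)).elim
  · exfalso
    rcases (by omega : (r + q = 4 ∧ 1 ≤ r) ∨ (r = 2 ∧ q = 1)) with ⟨h5, h6⟩ | ⟨rfl, rfl⟩
    · exact hR.false_of_isTight (ht (by omega)) hr h6 (by omega) (by omega)
    · obtain ⟨x, y, hxy, hp⟩ := hR.exists_cod_eq_three (by omega) (by omega)
      obtain ⟨a, b, c, hI⟩ := exists_isIsoTri hq le_rfl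
      refine hR.false_of_cod_eq_three ?_ ?_ (by omega) (fun h => ht (by omega)) hxy hp hI
      · have h5 : ∑ v, (load G v - min (load G v) 1) ≤ 0 := by
          rw [Finset.sum_sub_distrib]; omega
        have h6 := le_antisymm h5 (Finset.sum_nonneg fun v _ => by omega)
        rw [Finset.sum_eq_zero_iff_of_nonneg fun v _ => by omega] at h6
        intro v
        have := h6 v (Finset.mem_univ v)
        omega
      · intro x u e1 e2 e3 e4
        have := h2.2 x u e1 e2 e3 e4
        omega
  · omega

end IsResidual
end ResidualNine
end LayerDomination

namespace LayerDomination

/-! ### Reduction to good graphs by deleting edges -/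

section Induction

set_option linter.unusedSectionVars false

variable {V : Type*} [Fintype V] {G : SimpleGraph V} {k : ℕ}

lemma isAddEdge_deleteEdges {x y : V} (h : G.Adj x y) :
    IsAddEdge (G.deleteEdges {s(x, y)}) G x y := by
  refine ⟨h.ne, by simp, fun u v => ?_⟩
  simp only [SimpleGraph.deleteEdges_adj, Set.mem_singleton_iff, Sym2.eq_iff]
  by_cases h1 : u = x ∧ v = y
  · simp [h1, h]
  · by_cases h2 : u = y ∧ v = x
    · simp [h2, h.symm]
    · simp [h1, h2]

lemma exists_of_not_isGood (hG : ¬ IsGood G) :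
    ∃ x y z, IsTri G x y z ∧ 2 ≤ cod G x z ∧ 2 ≤ cod G y z := by
  unfold IsGood at hG
  push Not at hG
  obtain ⟨x, y, z, h, hb⟩ := hG
  have h1 := h.cod_pos
  have h2 := h.rotate.cod_pos
  have h3 := h.rotate.rotate.cod_pos
  rw [cod_comm z x] at h3
  unfold IsGoodTri at hb
  by_cases a1 : cod G x y = 1
  · exact ⟨x, y, z, h, by omega, by omega⟩
  · by_cases a2 : cod G y z = 1
    · refine ⟨y, z, x, h.rotate, ?_, ?_⟩
      · rw [cod_comm]; omega
      · rw [cod_comm]; omega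
    · refine ⟨x, z, y, ⟨h.2.2, h.2.1.symm, h.1⟩, by omega, ?_⟩
      rw [cod_comm]; omega

/-- Well-founded induction along strict subgraphs: a non-good extremal graph has an extremal
subgraph with one edge less, which is of a known type and cannot be regained by adding an edge. -/
theorem isKPlus_or_isRook (hk : 2 ≤ k) (hn : Fintype.card V = 4 * k + 1)
    (hex : excess G = 12 * (2 * k ^ 2 + 2 * k)) :
    (∃ A : Finset V, IsKPlus G A ∧ 2 * k ≤ A.card ∧ A.card ≤ 2 * k + 2) ∨ IsRook G := by
  induction G using WellFoundedLT.induction with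
  | ind G ih =>
    by_cases hG : IsGood G
    · rcases isResidual_of_isGood hG hk hn hex with h | h
      · exact Or.inl h
      · rcases hk.lt_or_eq with h3 | rfl
        · exact (h.false_of_three_le h3).elim
        · exact Or.inr h.isRook
    · exfalso
      obtain ⟨x, y, z, h, h1, h2⟩ := exists_of_not_isGood hG
      have ha := isAddEdge_deleteEdges h.1
      have h3 := ha.excess_le_of_two_le_cod h h1 h2
      have h4 := excess_le (G := G.deleteEdges {s(x, y)})
      rw [hn, max_four_mul_add_one] at h4
      push_cast at h4
      have h5 : G.deleteEdges {s(x, y)} < G := by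
        refine lt_of_le_of_ne (SimpleGraph.deleteEdges_le _) fun he => ha.not_adj ?_
        rw [he]
        exact h.1
      rcases ih _ h5 (by linarith) with ⟨A, hA, hA1, hA2⟩ | hA
      · have := hA.excess_lt_of_isAddEdge (by omega) (by omega) ha
        linarith
      · have := hA.excess_lt_of_isAddEdge ha
        linarith

end Induction
end LayerDomination

namespace LayerDomination

/-! ### Identification with the concrete graphs -/

section Isomorphism

set_option linter.unusedSectionVars false

variable {V : Type*} [Fintype V] {G : SimpleGraph V}

/-- A graph that is a matching with at most one unmatched vertex can be numbered so that
the numbers `2 i` and `2 i + 1` are matched. -/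
lemma exists_numbering (A : Finset V)
    (h : ∀ x ∈ A, ∀ y ∈ A, ∀ z ∈ A, G.Adj x y → G.Adj x z → y = z)
    (h' : ∀ x ∈ A, ∀ y ∈ A, (∀ z ∈ A, ¬ G.Adj x z) → (∀ z ∈ A, ¬ G.Adj y z) → x = y) :
    ∃ f : V → ℕ, (∀ x ∈ A, f x < A.card) ∧ (∀ x ∈ A, ∀ y ∈ A, f x = f y → x = y) ∧
      ∀ x ∈ A, ∀ y ∈ A, G.Adj x y ↔ x ≠ y ∧ f x / 2 = f y / 2 := by
  classical
  induction A using Finset.strongInduction with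
  | H A ih =>
    by_cases hA : ∃ x ∈ A, ∃ y ∈ A, G.Adj x y
    · obtain ⟨x, hx, y, hy, hxy⟩ := hA
      set B := (A.erase x).erase y with hB
      have hBA : ∀ z, z ∈ B ↔ z ≠ y ∧ z ≠ x ∧ z ∈ A := by intro z; simp [hB]
      have hcard : B.card + 2 = A.card := by
        have h1 := Finset.card_erase_add_one hx
        have h2 := Finset.card_erase_add_one (Finset.mem_erase.2 ⟨hxy.ne', hy⟩)
        rw [← hB] at h2
        omega
      have hnx : ∀ z ∈ B, ¬ G.Adj z x := fun z hz hzx => by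
        rw [hBA] at hz
        exact hz.1 (h x hx z hz.2.2 y hy hzx.symm hxy)
      have hny : ∀ z ∈ B, ¬ G.Adj z y := fun z hz hzy => by
        rw [hBA] at hz
        exact hz.2.1 (h y hy z hz.2.2 x hx hzy.symm hxy.symm)
      have hun : ∀ z ∈ B, (∀ w ∈ B, ¬ G.Adj z w) → ∀ w ∈ A, ¬ G.Adj z w := by
        intro z hz hzB w hw hzw
        by_cases h1 : w = x
        · exact hnx z hz (h1 ▸ hzw)
        · by_cases h2 : w = y
          · exact hny z hz (h2 ▸ hzw)
          · exact hzB w ((hBA w).2 ⟨h2, h1, hw⟩) hzw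
      have hss : B ⊂ A := by
        refine Finset.ssubset_iff_subset_ne.2 ⟨fun z hz => ((hBA z).1 hz).2.2, fun he => ?_⟩
        rw [he] at hcard
        omega
      have hBA' : ∀ z ∈ B, z ∈ A := fun z hz => ((hBA z).1 hz).2.2
      obtain ⟨f, f1, f2, f3⟩ := ih B hss
        (fun a ha b hb c hc => h a (hBA' a ha) b (hBA' b hb) c (hBA' c hc))
        (fun a ha b hb hab hba => h' a (hBA' a ha) b (hBA' b hb) (hun a ha hab) (hun b hb hba))
      have hcase : ∀ z ∈ A, z = x ∨ z = y ∨ z ∈ B := fun z hz => by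
        rw [hBA]; tauto
      have hxB : x ∉ B := by simp [hB]
      have hyB : y ∉ B := by simp [hB]
      let g : V → ℕ := fun z => if z = x then 0 else if z = y then 1 else f z + 2
      have gx : g x = 0 := by simp [g]
      have gy : g y = 1 := by simp [g, hxy.ne']
      have gB : ∀ z ∈ B, g z = f z + 2 := fun z hz => by
        have := (hBA z).1 hz
        simp [g, this.1, this.2.1]
      refine ⟨g, ?_, ?_, ?_⟩
      · intro z hz
        rcases hcase z hz with rfl | rfl | hz
        · rw [gx]; omega
        · rw [gy]; omega
        · rw [gB z hz]; have := f1 z hz; omega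
      · intro z hz w hw hzw
        rcases hcase z hz with rfl | rfl | hz <;> rcases hcase w hw with rfl | rfl | hw
        · rfl
        · omega
        · rw [gB w hw] at hzw; omega
        · omega
        · rfl
        · rw [gB w hw] at hzw; omega
        · rw [gB z hz] at hzw; omega
        · rw [gB z hz] at hzw; omega
        · rw [gB z hz, gB w hw] at hzw
          exact f2 z hz w hw (by omega)
      · intro z hz w hw
        rcases hcase z hz with rfl | rfl | hz <;> rcases hcase w hw with rfl | rfl | hw
        · simp
        · simp [gx, gy, hxy, hxy.ne]
        · rw [gB w hw, gx]
          exact iff_of_false (fun hc => hnx w hw hc.symm) (by omega)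
        · simp [gx, gy, hxy.symm, hxy.ne']
        · simp
        · rw [gB w hw, gy]
          exact iff_of_false (fun hc => hny w hw hc.symm) (by omega)
        · rw [gB z hz, gx]
          exact iff_of_false (fun hc => hnx z hz hc) (by omega)
        · rw [gB z hz, gy]
          exact iff_of_false (fun hc => hny z hz hc) (by omega)
        · rw [gB z hz, gB w hw, f3 z hz w hw]
          have : (f z + 2) / 2 = (f w + 2) / 2 ↔ f z / 2 = f w / 2 := by omega
          rw [this]
    · push Not at hA
      have hss : ∀ x ∈ A, ∀ y ∈ A, x = y := fun x hx y hy =>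
        h' x hx y hy (hA x hx) (hA y hy)
      refine ⟨fun _ => 0, fun x hx => Finset.card_pos.2 ⟨x, hx⟩, fun x hx y hy _ => hss x hx y hy,
        fun x hx y hy => iff_of_false (hA x hx y hy) fun hc => hc.1 (hss x hx y hy)⟩

theorem IsKPlus.nonempty_iso {A : Finset V} (hA : IsKPlus G A) {n : ℕ}
    (hn : Fintype.card V = n) : Nonempty (G ≃g kPlus n A.card) := by
  classical
  obtain ⟨f, f1, f2, f3⟩ := exists_numbering A hA.matching hA.unmatched
  have hAn : A.card ≤ n := hn ▸ Finset.card_le_univ A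
  have hc : Fintype.card {x // x ∉ A} = n - A.card := by
    rw [Fintype.card_subtype_compl, hn, Fintype.card_coe]
  let e := Fintype.equivFinOfCardEq hc
  let g : V → Fin n := fun x => if hx : x ∈ A then ⟨f x, lt_of_lt_of_le (f1 x hx) hAn⟩ else
    ⟨A.card + e ⟨x, hx⟩, by have := (e ⟨x, hx⟩).2; omega⟩
  have gA : ∀ x ∈ A, (g x).1 = f x := fun x hx => by simp [g, hx]
  have gA' : ∀ x (hx : x ∉ A), (g x).1 = A.card + e ⟨x, hx⟩ := fun x hx => by simp [g, hx]
  have ginj : Function.Injective g := by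
    intro x y hxy
    have hxy' : (g x).1 = (g y).1 := by rw [hxy]
    by_cases hx : x ∈ A <;> by_cases hy : y ∈ A
    · rw [gA x hx, gA y hy] at hxy'
      exact f2 x hx y hy hxy'
    · rw [gA x hx, gA' y hy] at hxy'
      have := f1 x hx
      omega
    · rw [gA' x hx, gA y hy] at hxy'
      have := f1 y hy
      omega
    · rw [gA' x hx, gA' y hy] at hxy'
      have h1 : e ⟨x, hx⟩ = e ⟨y, hy⟩ := Fin.ext (by omega)
      simpa using e.injective h1
  have gbij : Function.Bijective g :=
    (Fintype.bijective_iff_injective_and_card g).2 ⟨ginj, by simp [hn]⟩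
  refine ⟨⟨Equiv.ofBijective g gbij, ?_⟩⟩
  intro x y
  have hne : g x ≠ g y ↔ x ≠ y := ginj.ne_iff
  simp only [Equiv.ofBijective_apply, kPlus, SimpleGraph.fromRel_adj, hne]
  by_cases hx : x ∈ A <;> by_cases hy : y ∈ A
  · have h1 := f1 x hx
    have h2 := f1 y hy
    rw [f3 x hx y hy, gA x hx, gA y hy]
    constructor
    · rintro ⟨h3, h4⟩
      exact ⟨h3, by omega⟩
    · rintro ⟨h3, h4⟩
      exact ⟨h3, by omega⟩
  · have h1 := f1 x hx
    have h2 := gA' y hy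
    rw [gA x hx]
    refine iff_of_true ⟨fun he => hy (he ▸ hx), by omega⟩ (hA.join x hx y hy)
  · have h1 := f1 y hy
    have h2 := gA' x hx
    rw [gA y hy]
    refine iff_of_true ⟨fun he => hx (he ▸ hy), by omega⟩ (hA.join y hy x hx).symm
  · have h1 := gA' y hy
    have h2 := gA' x hx
    exact iff_of_false (by omega) (hA.indep x hx y hy)

lemma IsRook.mem_of_adj (hG : IsRook G) {a o b p q t : V} (h1 : G.Adj a o) (h2 : G.Adj a b)
    (h3 : G.Adj a p) (h4 : G.Adj a q) (hnd : [o, b, p, q].Nodup) (ht : G.Adj a t) :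
    t = o ∨ t = b ∨ t = p ∨ t = q := by
  by_contra! hc
  have hnd' : [t, o, b, p, q].Nodup := by
    rw [List.nodup_cons]
    exact ⟨by simp [hc], hnd⟩
  have := sum_map_le_sum (f := fun u => adjInd G a u) (fun u => adjInd_nonneg _ _) hnd'
  simp only [List.map_cons, List.map_nil, List.sum_cons, List.sum_nil, adjInd_of_adj h1,
    adjInd_of_adj h2, adjInd_of_adj h3, adjInd_of_adj h4, adjInd_of_adj ht] at this
  have h5 := hG.deg_eq a
  unfold deg at h5
  omega

/-- The edge `a p` lies in a triangle whose third vertex is a neighbour of `a`, so one of `o`, `b`,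
`p`, `q`; only `q` is possible. -/
lemma IsRook.adj_of_adj (hG : IsRook G) {a o b p q : V} (h : IsTri G o a b)
    (h3 : G.Adj a p) (h4 : G.Adj a q) (hpo : p ≠ o) (hqo : q ≠ o) (hpb : p ≠ b) (hqb : q ≠ b)
    (hpq : p ≠ q) : G.Adj p q := by
  have hnd : [o, b, p, q].Nodup := by
    have := h.2.2.ne
    have := hpo.symm
    have := hqo.symm
    have := hpb.symm
    have := hqb.symm
    simp_all
  obtain ⟨t, ht, ht'⟩ := exists_of_cod_pos (by rw [hG.cod_adj a p h3]; norm_num : cod G a p ≠ 0)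
  rcases hG.mem_of_adj h.1.symm h.2.1 h3 h4 hnd ht with rfl | rfl | rfl | rfl
  · exact absurd (eq_of_cod_eq_one (hG.cod_adj _ _ h.1) ht'.symm h3 h.2.2 h.2.1) hpb
  · exact absurd (eq_of_cod_eq_one (hG.cod_adj _ _ h.2.1) h3 ht'.symm h.1.symm h.2.2.symm) hpo
  · exact absurd ht' G.irrefl
  · exact ht'

lemma IsRook.exists_common (hG : IsRook G) {a c o : V} (hne : a ≠ c) (h : ¬ G.Adj a c) :
    ∃ p, p ≠ o ∧ G.Adj a p ∧ G.Adj c p := by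
  obtain ⟨z, w, hzw, h1, h2, h3, h4⟩ := exists_two_of_two_le_cod (hG.cod_not_adj a c hne h).ge
  by_cases hz : z = o
  · exact ⟨w, fun hw => hzw (hz.trans hw.symm), h3, h4⟩
  · exact ⟨z, hz, h1, h2⟩

/-- The two vectors are the row and column coordinates of the nine vertices. -/
lemma h9_adj_iff : ∀ i j : Fin 9, h9.Adj i j ↔ i ≠ j ∧
    (![0, 0, 1, 1, 0, 1, 2, 2, 2] i = (![0, 0, 1, 1, 0, 1, 2, 2, 2] j : Fin 3) ∨
     ![0, 1, 1, 2, 2, 0, 1, 2, 0] i = (![0, 1, 1, 2, 2, 0, 1, 2, 0] j : Fin 3)) := by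
  simp only [h9, SimpleGraph.fromEdgeSet_adj, Set.mem_insert_iff, Set.mem_singleton_iff]
  decide

lemma deg_h9 (i : Fin 9) : deg h9 i = 4 := by
  classical
  simp only [deg, adjInd, h9_adj_iff]
  have : ∀ i : Fin 9, ∑ j : Fin 9, (if i ≠ j ∧
    (![0, 0, 1, 1, 0, 1, 2, 2, 2] i = (![0, 0, 1, 1, 0, 1, 2, 2, 2] j : Fin 3) ∨
     ![0, 1, 1, 2, 2, 0, 1, 2, 0] i = (![0, 1, 1, 2, 2, 0, 1, 2, 0] j : Fin 3)) then (1 : ℤ)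
      else 0) = 4 := by decide
  rw [← this i]

theorem IsRook.nonempty_iso (hG : IsRook G) : Nonempty (G ≃g h9) := by
  classical
  have hpos : 0 < Fintype.card V := by rw [hG.card]; norm_num
  obtain ⟨o⟩ := Fintype.card_pos_iff.1 hpos
  have hdeg := hG.deg_eq o
  rw [deg_eq_card] at hdeg
  have hdeg' : (Finset.univ.filter fun y => G.Adj o y).card = 4 := by exact_mod_cast hdeg
  obtain ⟨a, ha⟩ := Finset.card_pos.1 (by omega : 0 < (Finset.univ.filter fun y => G.Adj o y).card)
  have oa : G.Adj o a := by simpa using ha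
  obtain ⟨b, ob, ab⟩ := exists_of_cod_pos (by rw [hG.cod_adj o a oa]; norm_num : cod G o a ≠ 0)
  obtain ⟨c, hc, hcab⟩ := Finset.exists_mem_notMem_of_card_lt_card
    (lt_of_le_of_lt (Finset.card_le_two (a := a) (b := b))
      (by omega : 2 < (Finset.univ.filter fun y => G.Adj o y).card))
  have oc : G.Adj o c := by simpa using hc
  simp only [Finset.mem_insert, Finset.mem_singleton, not_or] at hcab
  obtain ⟨nca, ncb⟩ := hcab
  obtain ⟨d, od, cd⟩ := exists_of_cod_pos (by rw [hG.cod_adj o c oc]; norm_num : cod G o c ≠ 0)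
  have only_a : ∀ u, G.Adj o u → G.Adj a u → u = b := fun u h1 h2 =>
    eq_of_cod_eq_one (hG.cod_adj o a oa) h1 h2 ob ab
  have only_b : ∀ u, G.Adj o u → G.Adj b u → u = a := fun u h1 h2 =>
    eq_of_cod_eq_one (hG.cod_adj o b ob) h1 h2 oa ab.symm
  have nac : ¬ G.Adj a c := fun h => ncb (only_a c oc h)
  have nbc : ¬ G.Adj b c := fun h => nca (only_b c oc h)
  have nda : d ≠ a := by rintro rfl; exact nac cd.symm
  have ndb : d ≠ b := by rintro rfl; exact nbc cd.symm
  have nad : ¬ G.Adj a d := fun h => ndb (only_a d od h)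
  have nbd : ¬ G.Adj b d := fun h => nda (only_b d od h)
  -- The triangles `o a b` and `o c d` are the row and the column of `o`; the remaining four cells
  -- are the second common neighbours of one vertex from each.
  obtain ⟨p, po, ap, cp⟩ := hG.exists_common (o := o) (Ne.symm nca) nac
  obtain ⟨q, qo, aq, dq⟩ := hG.exists_common (o := o) (Ne.symm nda) nad
  obtain ⟨r, ro, br, cr⟩ := hG.exists_common (o := o) (Ne.symm ncb) nbc
  obtain ⟨s, so, bs, ds⟩ := hG.exists_common (o := o) (Ne.symm ndb) nbd
  have only_ab : ∀ u, G.Adj a u → G.Adj b u → u = o := fun u h1 h2 =>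
    eq_of_cod_eq_one (hG.cod_adj a b ab) h1 h2 oa.symm ob.symm
  have only_cd : ∀ u, G.Adj c u → G.Adj d u → u = o := fun u h1 h2 =>
    eq_of_cod_eq_one (hG.cod_adj c d cd) h1 h2 oc.symm od.symm
  have pq : p ≠ q := by rintro rfl; exact po (only_cd p cp dq)
  have rs : r ≠ s := by rintro rfl; exact ro (only_cd r cr ds)
  have pr : p ≠ r := by rintro rfl; exact po (only_ab p ap br)
  have qs : q ≠ s := by rintro rfl; exact qo (only_ab q aq bs)
  have ps : p ≠ s := by rintro rfl; exact po (only_ab p ap bs)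
  have qr : q ≠ r := by rintro rfl; exact qo (only_ab q aq br)
  have pb : p ≠ b := by rintro rfl; exact nbc cp.symm
  have qb : q ≠ b := by rintro rfl; exact nbd dq.symm
  have ra : r ≠ a := by rintro rfl; exact nac cr.symm
  have sa : s ≠ a := by rintro rfl; exact nad ds.symm
  have pd : p ≠ d := by rintro rfl; exact nad ap
  have rd : r ≠ d := by rintro rfl; exact nbd br
  have qc : q ≠ c := by rintro rfl; exact nac aq
  have sc : s ≠ c := by rintro rfl; exact nbc bs
  have apq := hG.adj_of_adj ⟨oa, ab, ob⟩ ap aq po qo pb qb pq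
  have ars := hG.adj_of_adj ⟨ob, ab.symm, oa⟩ br bs ro so ra sa rs
  have apr := hG.adj_of_adj ⟨oc, cd, od⟩ cp cr po ro pd rd pr
  have aqs := hG.adj_of_adj ⟨od, cd.symm, oc⟩ dq ds qo so qc sc qs
  let φ : Fin 9 → V := ![o, a, p, r, b, c, q, s, d]
  have hnd : [o, a, p, r, b, c, q, s, d].Nodup := by
    have := oa.ne
    have := ob.ne
    have := oc.ne
    have := od.ne
    have := ab.ne
    have := cd.ne
    have := ap.ne
    have := cp.ne
    have := aq.ne
    have := dq.ne
    have := br.ne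
    have := cr.ne
    have := bs.ne
    have := ds.ne
    simp only [List.nodup_cons, List.mem_cons, List.not_mem_nil, or_false, not_or,
      not_false_eq_true, List.nodup_nil, and_true]
    refine ⟨⟨?_, ?_, ?_, ?_, ?_, ?_, ?_, ?_⟩, ⟨?_, ?_, ?_, ?_, ?_, ?_, ?_⟩, ⟨?_, ?_, ?_, ?_, ?_, ?_⟩,
      ⟨?_, ?_, ?_, ?_, ?_⟩, ⟨?_, ?_, ?_, ?_⟩, ⟨?_, ?_, ?_⟩, ⟨?_, ?_⟩, ?_⟩ <;>
      first | assumption | (apply Ne.symm; assumption)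
  have hinj : Function.Injective φ := by
    have h1 : List.ofFn φ = [o, a, p, r, b, c, q, s, d] := by simp [φ, List.ofFn_succ]
    rw [← h1] at hnd
    exact List.nodup_ofFn.1 hnd
  have hbij : Function.Bijective φ :=
    (Fintype.bijective_iff_injective_and_card φ).2 ⟨hinj, by simp [hG.card]⟩
  have hle : h9 ≤ G.comap φ := by
    unfold h9
    rw [SimpleGraph.fromEdgeSet_le]
    refine Set.sdiff_subset.trans ?_
    simp only [Set.insert_subset_iff, Set.singleton_subset_iff, SimpleGraph.mem_edgeSet,
      SimpleGraph.comap_adj]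
    refine ⟨oa, ap, apr, cr.symm, cp, apq, aq.symm, ab, ob.symm, od, ds, aqs.symm, dq.symm, cd.symm,
      oc.symm, br.symm, bs, ars.symm⟩
  -- A spanning subgraph in which every degree is the same has the same edges.
  have hadj : ∀ i j, adjInd h9 i j = adjInd G (φ i) (φ j) := by
    intro i
    have h1 : ∀ j, 0 ≤ adjInd G (φ i) (φ j) - adjInd h9 i j := by
      intro j
      by_cases h : h9.Adj i j
      · have h' : G.Adj (φ i) (φ j) := hle h
        rw [adjInd_of_adj h, adjInd_of_adj h', sub_self]
      · rw [adjInd_of_not_adj h, sub_zero]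
        exact adjInd_nonneg _ _
    have h2 : ∑ j, (adjInd G (φ i) (φ j) - adjInd h9 i j) = 0 := by
      rw [Finset.sum_sub_distrib, ← deg, deg_h9]
      have := Equiv.sum_comp (Equiv.ofBijective φ hbij) (fun y => adjInd G (φ i) y)
      simp only [Equiv.ofBijective_apply] at this
      rw [this, ← deg, hG.deg_eq, sub_self]
    rw [Finset.sum_eq_zero_iff_of_nonneg fun j _ => h1 j] at h2
    intro j
    linarith [h2 j (Finset.mem_univ j)]
  refine ⟨SimpleGraph.Iso.symm ⟨Equiv.ofBijective φ hbij, ?_⟩⟩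
  intro i j
  rw [Equiv.ofBijective_apply, Equiv.ofBijective_apply, ← adjInd_eq_one_iff, ← hadj,
    adjInd_eq_one_iff]

end Isomorphism
end LayerDomination

namespace LayerDomination

/-! ### Five vertices by exhaustive computation -/

section FiveVertices

/-- The disjunction of a Boolean function on five elements. -/
def anyFive (f : Fin 5 → Bool) : Bool := f 0 || f 1 || f 2 || f 3 || f 4

lemma anyFive_iff (f : Fin 5 → Bool) : anyFive f = true ↔ ∃ x, f x = true := by
  simp [anyFive, Fin.exists_fin_succ, or_assoc]

/-- The entry of a list of five with a given index. -/
def pick (a b c d e : Bool) : ℕ → Bool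
  | 0 => a
  | k + 1 => match k with
    | 0 => b
    | k + 1 => match k with
      | 0 => c
      | k + 1 => match k with
        | 0 => d
        | _ + 1 => e

/-- The adjacency function of a graph on five vertices with given edges. -/
def edgeFun (a b c d e f g h i j : Bool) (x y : Fin 5) : Bool :=
  pick (pick false a b c d y) (pick a false e f g y) (pick b e false h i y) (pick c f h false j y)
    (pick d g i j false y) x

/-- There is an isomorphism between the graphs with adjacency functions `s` and `t`. -/
def searchIso (s t : Fin 5 → Fin 5 → Bool) : Bool :=
  anyFive fun p => anyFive fun q => p != q && s p q == t 0 1 &&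
  anyFive fun r => p != r && q != r && s p r == t 0 2 && s q r == t 1 2 &&
  anyFive fun u => p != u && q != u && r != u && s p u == t 0 3 && s q u == t 1 3 &&
    s r u == t 2 3 &&
  anyFive fun v => p != v && q != v && r != v && u != v && s p v == t 0 4 && s q v == t 1 4 &&
    s r v == t 2 4 && s u v == t 3 4

/-- The edge `xy` lies in no triangle. -/
def bareFun (s : Fin 5 → Fin 5 → Bool) (x y : Fin 5) : Bool :=
  s x y && !anyFive fun z => s x z && s y z

/-- The vertices `x`, `y`, `z` form a triangle. -/
def triFun (s : Fin 5 → Fin 5 → Bool) (x y z : Fin 5) : Bool := s x y && s y z && s x z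

/-- The sum of a function over the ten pairs. -/
def pairCount (s : Fin 5 → Fin 5 → Bool) : ℕ :=
  (s 0 1).toNat + (s 0 2).toNat + (s 0 3).toNat + (s 0 4).toNat + (s 1 2).toNat +
  (s 1 3).toNat + (s 1 4).toNat + (s 2 3).toNat + (s 2 4).toNat + (s 3 4).toNat

/-- The sum of a function over the ten triples. -/
def tripleCount (t : Fin 5 → Fin 5 → Fin 5 → Bool) : ℕ :=
  (t 0 1 2).toNat + (t 0 1 3).toNat + (t 0 1 4).toNat + (t 0 2 3).toNat + (t 0 2 4).toNat +
  (t 0 3 4).toNat + (t 1 2 3).toNat + (t 1 2 4).toNat + (t 1 3 4).toNat + (t 2 3 4).toNat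

/-- The graph is extremal. -/
def isMaxFive (s : Fin 5 → Fin 5 → Bool) : Bool :=
  Nat.beq (2 * pairCount s) (8 + pairCount (bareFun s) + 2 * tripleCount (triFun s))

/-- Search for an isomorphism with one of the five extremal graphs on five vertices. -/
def searchFive (s : Fin 5 → Fin 5 → Bool) : Bool :=
  searchIso s (edgeFun true true true true true true true false false false) ||
  searchIso s (edgeFun true false true true false true true true true false) ||
  searchIso s (edgeFun true false false true false false true true true true) ||
  searchIso s (edgeFun true false true false true true true false true true) ||
  searchIso s (edgeFun true false true true true false true true true true)

/-- All 1024 graphs are checked. The Boolean encoding is made for fast kernel evaluation: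
`searchIso` abandons a partial map at the first mismatch. -/
lemma isMaxFive_search : ∀ a b c d e f g h i j : Bool,
    (!isMaxFive (edgeFun a b c d e f g h i j) ||
      searchFive (edgeFun a b c d e f g h i j)) = true := by
  decide +kernel

lemma nonempty_iso_of_searchIso {s t : Fin 5 → Fin 5 → Bool} {G H : SimpleGraph (Fin 5)}
    (hs : ∀ x y, G.Adj x y ↔ s x y = true) (ht : ∀ x y, H.Adj x y ↔ t x y = true)
    (h : searchIso s t = true) : Nonempty (G ≃g H) := by
  simp only [searchIso, anyFive_iff, Bool.and_eq_true, bne_iff_ne, beq_iff_eq] at h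
  obtain ⟨p, q, h1, r, h2, u, h3, v, h4⟩ := h
  let φ : Fin 5 → Fin 5 := ![p, q, r, u, v]
  have hφ : ∀ i j, i < j → φ i ≠ φ j ∧ s (φ i) (φ j) = t i j := by
    intro i j hij
    fin_cases i <;> fin_cases j <;> first
      | exact absurd hij (by decide)
      | exact ⟨by simp [φ]; tauto, by simp [φ]; tauto⟩
  have hinj : Function.Injective φ := by
    intro i j hij
    rcases lt_trichotomy i j with h | h | h
    · exact absurd hij (hφ i j h).1
    · exact h
    · exact absurd hij.symm (hφ j i h).1
  refine ⟨SimpleGraph.Iso.symm ⟨Equiv.ofBijective φ (Finite.injective_iff_bijective.1 hinj), ?_⟩⟩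
  intro i j
  rw [Equiv.ofBijective_apply, Equiv.ofBijective_apply]
  rcases lt_trichotomy i j with h | h | h
  · rw [hs, ht, (hφ i j h).2]
  · rw [h]; simp
  · rw [G.adj_comm, H.adj_comm, hs, ht, (hφ j i h).2]

lemma bareInd_eq_toNat {s : Fin 5 → Fin 5 → Bool} {G : SimpleGraph (Fin 5)}
    (hs : ∀ x y, G.Adj x y ↔ s x y = true) (x y : Fin 5) :
    bareInd G x y = (bareFun s x y).toNat := by
  classical
  have h1 : (G.Adj x y ∧ cod G x y = 0) ↔ bareFun s x y = true := by
    rw [bareFun, Bool.and_eq_true, ← hs, Bool.not_eq_true', ← Bool.not_eq_true, anyFive_iff]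
    refine and_congr_right fun _ => ⟨?_, ?_⟩
    · rintro h ⟨z, hz⟩
      rw [Bool.and_eq_true, ← hs, ← hs] at hz
      have := cod_pos hz.1 hz.2
      omega
    · intro h
      by_contra hc
      obtain ⟨z, h1, h2⟩ := exists_of_cod_pos hc
      exact h ⟨z, by rw [Bool.and_eq_true, ← hs, ← hs]; exact ⟨h1, h2⟩⟩
  unfold bareInd
  by_cases h : bareFun s x y = true
  · rw [if_pos (h1.2 h), h]; rfl
  · rw [if_neg fun h' => h (h1.1 h'), Bool.not_eq_true _ |>.mp h]; rfl

lemma isMaxFive_of_excess {s : Fin 5 → Fin 5 → Bool} {G : SimpleGraph (Fin 5)}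
    (hs : ∀ x y, G.Adj x y ↔ s x y = true) (h : excess G = 48) : isMaxFive s = true := by
  have h1 : ∀ x y, adjInd G x y = (s x y).toNat := by
    intro x y
    by_cases hxy : G.Adj x y
    · rw [adjInd_of_adj hxy, (hs x y).1 hxy]; rfl
    · rw [adjInd_of_not_adj hxy]
      rw [hs, Bool.not_eq_true] at hxy
      rw [hxy]; rfl
  have hE : ∑ x, ∑ y, adjInd G x y = 2 * pairCount s := by
    simp only [Fin.sum_univ_five, adjInd_self, adjInd_comm (G := G) 1 0, adjInd_comm (G := G) 2 0,
      adjInd_comm (G := G) 3 0, adjInd_comm (G := G) 4 0, adjInd_comm (G := G) 2 1,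
      adjInd_comm (G := G) 3 1, adjInd_comm (G := G) 4 1, adjInd_comm (G := G) 3 2,
      adjInd_comm (G := G) 4 2, adjInd_comm (G := G) 4 3]
    simp only [h1, pairCount]
    push_cast
    ring
  have hself : ∀ x, bareInd G x x = 0 := fun x => by simp [bareInd]
  have hB : ∑ x, ∑ y, bareInd G x y = 2 * pairCount (bareFun s) := by
    simp only [Fin.sum_univ_five, hself, bareInd_comm (G := G) 1 0, bareInd_comm (G := G) 2 0,
      bareInd_comm (G := G) 3 0, bareInd_comm (G := G) 4 0, bareInd_comm (G := G) 2 1,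
      bareInd_comm (G := G) 3 1, bareInd_comm (G := G) 4 1, bareInd_comm (G := G) 3 2,
      bareInd_comm (G := G) 4 2, bareInd_comm (G := G) 4 3]
    simp only [bareInd_eq_toNat hs, pairCount]
    push_cast
    ring
  have htri : ∀ x y z, ((triFun s x y z).toNat : ℤ) =
      (s x y).toNat * (s y z).toNat * (s x z).toNat := by
    intro x y z
    unfold triFun
    cases s x y <;> cases s y z <;> cases s x z <;> rfl
  have hT : ∑ x, ∑ y, adjInd G x y * cod G x y = 6 * tripleCount (triFun s) := by
    simp only [cod, Fin.sum_univ_five, adjInd_self, adjInd_comm (G := G) 1 0,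
      adjInd_comm (G := G) 2 0,
      adjInd_comm (G := G) 3 0, adjInd_comm (G := G) 4 0, adjInd_comm (G := G) 2 1,
      adjInd_comm (G := G) 3 1, adjInd_comm (G := G) 4 1, adjInd_comm (G := G) 3 2,
      adjInd_comm (G := G) 4 2, adjInd_comm (G := G) 4 3]
    simp only [h1, tripleCount]
    push_cast
    simp only [htri]
    ring
  unfold excess at h
  rw [hE, hB, hT] at h
  unfold isMaxFive
  rw [Nat.beq_eq]
  omega

theorem nonempty_iso_of_five {G : SimpleGraph (Fin 5)} (h : excess G = 48) :
    Nonempty (G ≃g h5a) ∨ Nonempty (G ≃g h5b) ∨ ∃ s, (s = 2 ∨ s = 3 ∨ s = 4) ∧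
      Nonempty (G ≃g kPlus 5 s) := by
  classical
  let w : Fin 5 → Fin 5 → Bool := fun x y => decide (G.Adj x y)
  let s := edgeFun (w 0 1) (w 0 2) (w 0 3) (w 0 4) (w 1 2) (w 1 3) (w 1 4) (w 2 3) (w 2 4) (w 3 4)
  have hs : ∀ x y, G.Adj x y ↔ s x y = true := by
    intro x y
    fin_cases x <;> fin_cases y <;> simp [s, edgeFun, pick, w] <;>
      exact G.adj_comm _ _
  have h1 := isMaxFive_search (w 0 1) (w 0 2) (w 0 3) (w 0 4) (w 1 2) (w 1 3) (w 1 4) (w 2 3)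
    (w 2 4) (w 3 4)
  have h2 : isMaxFive s = true := isMaxFive_of_excess hs h
  change (!isMaxFive s || searchFive s) = true at h1
  rw [h2, Bool.not_true, Bool.false_or] at h1
  simp only [searchFive, Bool.or_eq_true] at h1
  have k2 : ∀ x y, (kPlus 5 2).Adj x y ↔
      edgeFun true true true true true true true false false false x y = true := by
    simp only [kPlus, SimpleGraph.fromRel_adj]; decide
  have k3 : ∀ x y, (kPlus 5 3).Adj x y ↔
      edgeFun true false true true false true true true true false x y = true := by
    simp only [kPlus, SimpleGraph.fromRel_adj]; decide
  have k4 : ∀ x y, (kPlus 5 4).Adj x y ↔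
      edgeFun true false false true false false true true true true x y = true := by
    simp only [kPlus, SimpleGraph.fromRel_adj]; decide
  have ka : ∀ x y, h5a.Adj x y ↔
      edgeFun true false true false true true true false true true x y = true := by
    simp only [h5a, SimpleGraph.fromEdgeSet_adj, Set.mem_insert_iff, Set.mem_singleton_iff]
    decide
  have kb : ∀ x y, h5b.Adj x y ↔
      edgeFun true false true true true false true true true true x y = true := by
    simp only [h5b, SimpleGraph.fromEdgeSet_adj, Set.mem_insert_iff, Set.mem_singleton_iff]
    decide
  rcases h1 with (((h1 | h1) | h1) | h1) | h1
  · exact Or.inr (Or.inr ⟨2, by simp, nonempty_iso_of_searchIso hs k2 h1⟩)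
  · exact Or.inr (Or.inr ⟨3, by simp, nonempty_iso_of_searchIso hs k3 h1⟩)
  · exact Or.inr (Or.inr ⟨4, by simp, nonempty_iso_of_searchIso hs k4 h1⟩)
  · exact Or.inl (nonempty_iso_of_searchIso hs ka h1)
  · exact Or.inr (Or.inl (nonempty_iso_of_searchIso hs kb h1))

end FiveVertices
end LayerDomination

namespace LayerDomination

/-! ### From dominating sets to graphs and back -/

section Translation

set_option linter.unusedSectionVars false

variable {n : ℕ}

lemma mem_level {D : Finset (LayerVertex n 3 2)} {A : Finset (Fin n)} {i : ℕ} :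
    A ∈ level D i ↔ (∃ h : A.card = 2 ∨ A.card = 3, (⟨A, h⟩ : LayerVertex n 3 2) ∈ D) ∧
      A.card = i := by
  simp [level]

lemma layerGraph_adj {A B : LayerVertex n 3 2} : (layerGraph n 3 2).Adj A B ↔
    (A.1.card = 2 ∧ B.1.card = 3 ∧ A.1 ⊆ B.1) ∨ (B.1.card = 2 ∧ A.1.card = 3 ∧ B.1 ⊆ A.1) := by
  rw [layerGraph, SimpleGraph.fromRel_adj]
  refine ⟨fun h => h.2, fun h => ⟨?_, h⟩⟩
  rintro rfl
  omega

lemma card_eq_level (D : Finset (LayerVertex n 3 2)) :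
    D.card = (level D 2).card + (level D 3).card := by
  rw [level, level, ← Finset.card_union_of_disjoint, ← Finset.filter_or, Finset.filter_true_of_mem,
    Finset.card_map]
  · intro A hA
    simp only [Finset.mem_map, Function.Embedding.subtype_apply] at hA
    obtain ⟨B, -, rfl⟩ := hA
    exact B.2
  · rw [Finset.disjoint_filter]
    intro A _ h1 h2
    omega

lemma sum_pair_mem {α : Type*} [Fintype α] [DecidableEq α] (𝒜 : Finset (Finset α))
    (h𝒜 : ∀ s ∈ 𝒜, s.card = 2) :
    ∑ x, ∑ y, (if x ≠ y ∧ ({x, y} : Finset α) ∈ 𝒜 then (1 : ℤ) else 0) = 2 * 𝒜.card := by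
  have h1 : ∀ x y : α, (if x ≠ y ∧ ({x, y} : Finset α) ∈ 𝒜 then (1 : ℤ) else 0) =
      ∑ s ∈ 𝒜, if (x, y) ∈ s.offDiag then 1 else 0 := by
    intro x y
    have h2 : ∀ s ∈ 𝒜, ((x, y) ∈ s.offDiag ↔ x ≠ y ∧ s = {x, y}) := by
      intro s hs
      rw [Finset.mem_offDiag]
      constructor
      · rintro ⟨hx, hy, hne⟩
        refine ⟨hne, (Finset.eq_of_subset_of_card_le ?_ ?_).symm⟩
        · intro z hz
          simp only [Finset.mem_insert, Finset.mem_singleton] at hz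
          rcases hz with rfl | rfl <;> assumption
        · rw [h𝒜 s hs, Finset.card_pair hne]
      · rintro ⟨hne, rfl⟩
        simp [hne]
    rw [Finset.sum_congr rfl fun s hs => if_congr (h2 s hs) rfl rfl]
    by_cases hne : x = y
    · simp [hne]
    · simp [hne]
  simp only [h1]
  rw [Finset.sum_congr rfl fun x _ => Finset.sum_comm, Finset.sum_comm]
  have h3 : ∀ s ∈ 𝒜, ∑ x, ∑ y, (if (x, y) ∈ s.offDiag then (1 : ℤ) else 0) = 2 := by
    intro s hs
    rw [← Fintype.sum_prod_type' (f := fun x y => if (x, y) ∈ s.offDiag then (1 : ℤ) else 0)]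
    simp only [Prod.mk.eta, Finset.sum_boole, Finset.filter_univ_mem]
    rw [Finset.offDiag_card, h𝒜 s hs]
    norm_num
  rw [Finset.sum_congr rfl h3]
  simp [mul_comm]

lemma sum_adjInd_mul_cod_eq_card {V : Type*} [Fintype V] [DecidableEq V] (G : SimpleGraph V)
    [DecidableRel G.Adj] :
    ∑ x, ∑ y, adjInd G x y * cod G x y = 6 * ((G.cliqueFinset 3).card : ℤ) := by
  rw [sum_adjInd_mul_cod_eq]
  congr!

/-- If the non-edges of `G` are the two-sets in `𝒜`, then this counts its edges. -/
lemma sum_adjInd_of_compl {G : SimpleGraph (Fin n)} (𝒜 : Finset (Finset (Fin n)))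
    (h𝒜 : ∀ s ∈ 𝒜, s.card = 2) (hG : ∀ x y, G.Adj x y ↔ x ≠ y ∧ ({x, y} : Finset (Fin n)) ∉ 𝒜) :
    ∑ x, ∑ y, adjInd G x y = 2 * (n.choose 2 - 𝒜.card) := by
  have h1 := sum_pair_mem 𝒜 h𝒜
  have h2 := sum_pair_mem (Finset.powersetCard 2 (Finset.univ : Finset (Fin n)))
    fun s hs => (Finset.mem_powersetCard.1 hs).2
  rw [Finset.card_powersetCard, Finset.card_univ, Fintype.card_fin] at h2
  rw [mul_sub, ← h1, ← h2, ← Finset.sum_sub_distrib]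
  refine Finset.sum_congr rfl fun x _ => ?_
  rw [← Finset.sum_sub_distrib]
  refine Finset.sum_congr rfl fun y _ => ?_
  by_cases hxy : x = y
  · simp [hxy]
  · have h3 : ({x, y} : Finset (Fin n)) ∈ Finset.powersetCard 2 Finset.univ :=
      Finset.mem_powersetCard.2 ⟨Finset.subset_univ _, Finset.card_pair hxy⟩
    by_cases h4 : ({x, y} : Finset (Fin n)) ∈ 𝒜
    · rw [adjInd_of_not_adj fun h => ((hG x y).1 h).2 h4, if_pos ⟨hxy, h3⟩, if_pos ⟨hxy, h4⟩]
      rfl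
    · rw [adjInd_of_adj ((hG x y).2 ⟨hxy, h4⟩), if_pos ⟨hxy, h3⟩, if_neg fun h => h4 h.2]
      rfl

/-! ### The graph of a dominating set -/

section Dominating

variable {D : Finset (LayerVertex n 3 2)}

lemma mem_shadow_of_pair (hD : IsDominating (layerGraph n 3 2) D) {x y : Fin n} (hxy : x ≠ y)
    (h : ({x, y} : Finset (Fin n)) ∉ level D 2) :
    ∃ X ∈ level D 3, x ∈ X ∧ y ∈ X := by
  have hc : ({x, y} : Finset (Fin n)).card = 2 := Finset.card_pair hxy
  have h1 : (⟨{x, y}, Or.inl hc⟩ : LayerVertex n 3 2) ∉ D := fun h1 =>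
    h (mem_level.2 ⟨⟨Or.inl hc, h1⟩, hc⟩)
  obtain ⟨B, hB, hadj⟩ := hD _ h1
  rw [layerGraph_adj] at hadj
  rcases hadj with ⟨-, h3, h4⟩ | ⟨-, h3, -⟩
  · exact ⟨B.1, mem_level.2 ⟨⟨B.2, hB⟩, h3⟩, h4 (by simp), h4 (by simp)⟩
  · simp only at h3
    omega

lemma assocGraph_adj (hD : IsDominating (layerGraph n 3 2) D) (x y : Fin n) :
    (assocGraph D).Adj x y ↔ x ≠ y ∧ ({x, y} : Finset (Fin n)) ∉ level D 2 := by
  change (x ≠ y ∧ ({x, y} : Finset (Fin n)) ∈ ∂ (level D 3) \ level D 2) ↔ _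
  rw [Finset.mem_sdiff]
  refine and_congr_right fun hxy => ⟨fun h => h.2, fun h => ⟨?_, h⟩⟩
  obtain ⟨X, hX, hx, hy⟩ := mem_shadow_of_pair hD hxy h
  have hXc : X.card = 3 := (mem_level.1 hX).2
  rw [Finset.mem_shadow_iff_exists_mem_card_add_one]
  refine ⟨X, hX, ?_, ?_⟩
  · intro z hz
    simp only [Finset.mem_insert, Finset.mem_singleton] at hz
    rcases hz with rfl | rfl <;> assumption
  · rw [hXc, Finset.card_pair hxy]

lemma mem_level_of_clique (hD : IsDominating (layerGraph n 3 2) D) {X : Finset (Fin n)}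
    (hX : (assocGraph D).IsNClique 3 X) : X ∈ level D 3 := by
  by_contra h
  have hc := hX.card_eq
  have h1 : (⟨X, Or.inr hc⟩ : LayerVertex n 3 2) ∉ D := fun h1 =>
    h (mem_level.2 ⟨⟨Or.inr hc, h1⟩, hc⟩)
  obtain ⟨B, hB, hadj⟩ := hD _ h1
  rw [layerGraph_adj] at hadj
  rcases hadj with ⟨h3, -⟩ | ⟨h3, -, h4⟩
  · simp only at h3
    omega
  · obtain ⟨x, y, hxy, hBxy⟩ := Finset.card_eq_two.1 h3
    have hx : x ∈ X := h4 (by simp [hBxy])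
    have hy : y ∈ X := h4 (by simp [hBxy])
    have h5 := ((assocGraph_adj hD x y).1 (hX.isClique hx hy hxy)).2
    rw [← hBxy] at h5
    exact h5 (mem_level.2 ⟨⟨B.2, hB⟩, h3⟩)

lemma sum_adjInd_le_four {V : Type*} {G : SimpleGraph V} {X : Finset V} (hc : X.card = 3)
    (hX : ¬ G.IsNClique 3 X) : ∑ x ∈ X, ∑ y ∈ X, adjInd G x y ≤ 4 := by
  classical
  obtain ⟨a, b, c, hab, hac, hbc, rfl⟩ := Finset.card_eq_three.1 hc
  have h1 : ¬ (G.Adj a b ∧ G.Adj a c ∧ G.Adj b c) := fun h => hX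
    (SimpleGraph.is3Clique_iff.2 ⟨a, b, c, h.1, h.2.1, h.2.2, rfl⟩)
  have e : ∀ f : V → ℤ, ∑ x ∈ ({a, b, c} : Finset V), f x = f a + f b + f c := by
    intro f
    rw [Finset.sum_insert (by simp [hab, hac]), Finset.sum_pair hbc]
    ring
  rw [e, e, e, e, adjInd_self, adjInd_self, adjInd_self, adjInd_comm b a, adjInd_comm c a,
    adjInd_comm c b]
  have l1 := adjInd_le_one (G := G) a b
  have l2 := adjInd_le_one (G := G) a c
  have l3 := adjInd_le_one (G := G) b c
  have h2 : adjInd G a b + adjInd G a c + adjInd G b c ≤ 2 := by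
    by_contra h
    exact h1 ⟨adjInd_eq_one_iff.1 (by omega), adjInd_eq_one_iff.1 (by omega),
      adjInd_eq_one_iff.1 (by omega)⟩
  linarith

/-- A triple of `D` covering a bare edge is not a triangle of the graph, so it spans at most two
edges, that is, four ordered pairs. -/
lemma bareSum_le [DecidableRel (assocGraph D).Adj] (hD : IsDominating (layerGraph n 3 2) D) :
    bareSum (assocGraph D) ≤
      4 * (level D 3 \ (assocGraph D).cliqueFinset 3).card := by
  set S := level D 3 \ (assocGraph D).cliqueFinset 3 with hS
  have h1 : ∀ x y, bareInd (assocGraph D) x y ≤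
      ∑ X ∈ S, (if x ∈ X then (if y ∈ X then adjInd (assocGraph D) x y else 0) else 0) := by
    intro x y
    have hnn : ∀ X ∈ S, 0 ≤ (if x ∈ X then (if y ∈ X then adjInd (assocGraph D) x y else 0) else 0) := by
      intro X _
      split_ifs
      · exact adjInd_nonneg _ _
      · rfl
      · rfl
    by_cases hb : (assocGraph D).Adj x y ∧ cod (assocGraph D) x y = 0
    · obtain ⟨hadj, hcod⟩ := hb
      have h2 := (assocGraph_adj hD x y).1 hadj
      obtain ⟨X, hX, hx, hy⟩ := mem_shadow_of_pair hD h2.1 h2.2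
      have hXS : X ∈ S := by
        rw [hS, Finset.mem_sdiff]
        refine ⟨hX, fun hc => ?_⟩
        rw [SimpleGraph.mem_cliqueFinset_iff] at hc
        have h3 : ({x, y} : Finset (Fin n)).card < X.card := by
          rw [hc.card_eq, Finset.card_pair h2.1]; norm_num
        obtain ⟨z, hz, hzn⟩ := Finset.exists_mem_notMem_of_card_lt_card h3
        simp only [Finset.mem_insert, Finset.mem_singleton, not_or] at hzn
        have := cod_pos (hc.isClique hx hz (Ne.symm hzn.1)) (hc.isClique hy hz (Ne.symm hzn.2))
        omega
      refine le_trans ?_ (Finset.single_le_sum hnn hXS)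
      rw [if_pos hx, if_pos hy, adjInd_of_adj hadj]
      exact bareInd_le_one _ _
    · have h0 : bareInd (assocGraph D) x y = 0 := if_neg hb
      rw [h0]
      exact Finset.sum_nonneg hnn
  have h2 : bareSum (assocGraph D) ≤ ∑ X ∈ S, ∑ x ∈ X, ∑ y ∈ X, adjInd (assocGraph D) x y := by
    refine le_trans (Finset.sum_le_sum fun x _ => Finset.sum_le_sum fun y _ => h1 x y) ?_
    rw [Finset.sum_congr rfl fun x _ => Finset.sum_comm, Finset.sum_comm]
    refine le_of_eq (Finset.sum_congr rfl fun X _ => ?_)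
    have h3 : ∀ x, ∑ y, (if x ∈ X then (if y ∈ X then adjInd (assocGraph D) x y else 0) else 0) =
        if x ∈ X then ∑ y ∈ X, adjInd (assocGraph D) x y else 0 := by
      intro x
      split_ifs <;> simp
    simp only [h3]
    simp
  refine h2.trans ?_
  have h3 : ∀ X ∈ S, ∑ x ∈ X, ∑ y ∈ X, adjInd (assocGraph D) x y ≤ 4 := by
    intro X hX
    rw [hS, Finset.mem_sdiff, SimpleGraph.mem_cliqueFinset_iff] at hX
    exact sum_adjInd_le_four (mem_level.1 hX.1).2 hX.2
  refine (Finset.sum_le_sum h3).trans ?_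
  simp [mul_comm]

/-- `D` consists of the non-edges, all the triangles, and at least one further triple for every two
bare edges. -/
theorem le_excess_assocGraph (hD : IsDominating (layerGraph n 3 2) D) :
    12 * ((n.choose 2 : ℤ) - D.card) ≤ excess (assocGraph D) := by
  classical
  have h1 := sum_adjInd_of_compl (level D 2) (fun s hs => (mem_level.1 hs).2) (assocGraph_adj hD)
  have h2 := bareSum_le hD
  have h3 := sum_adjInd_mul_cod_eq_card (assocGraph D)
  have h4 : (assocGraph D).cliqueFinset 3 ⊆ level D 3 := fun X hX =>
    mem_level_of_clique hD (SimpleGraph.mem_cliqueFinset_iff.1 hX)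
  have h5 := Finset.card_sdiff_add_card_eq_card h4
  have h6 := card_eq_level D
  unfold excess
  rw [h1, h3]
  change _ ≤ _ - 3 * bareSum (assocGraph D) - _
  push_cast [h6, ← h5]
  linarith

end Dominating

/-! ### The dominating set of a graph without bare edges -/

section Construction

variable {G : SimpleGraph (Fin n)}

open Classical in
variable (G) in
/-- The non-edges and the triangles of a graph. -/
noncomputable def domSet : Finset (LayerVertex n 3 2) :=
  Finset.univ.filter fun A => (A.1.card = 2 ∧ ∀ x ∈ A.1, ∀ y ∈ A.1, ¬ G.Adj x y) ∨
    G.IsNClique 3 A.1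

lemma mem_domSet {A : LayerVertex n 3 2} : A ∈ domSet G ↔
    (A.1.card = 2 ∧ ∀ x ∈ A.1, ∀ y ∈ A.1, ¬ G.Adj x y) ∨ G.IsNClique 3 A.1 := by
  simp [domSet]

/-- An edge is dominated by a triangle through it, which exists as no edge is bare; a triple that is
not a triangle is dominated by a non-edge inside it. -/
lemma isDominating_domSet (h0 : bareSum G = 0) : IsDominating (layerGraph n 3 2) (domSet G) := by
  classical
  intro A hA
  rw [mem_domSet, not_or] at hA
  rcases A.2 with hc | hc
  · have h1 : ∃ x ∈ A.1, ∃ y ∈ A.1, G.Adj x y := by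
      by_contra! h
      exact hA.1 ⟨hc, h⟩
    obtain ⟨x, hx, y, hy, hxy⟩ := h1
    obtain ⟨z, hz⟩ := exists_tri_of_bareSum h0 hxy
    have hT : G.IsNClique 3 {x, y, z} :=
      SimpleGraph.is3Clique_iff.2 ⟨x, y, z, hz.1, hz.2.2, hz.2.1, rfl⟩
    have hAxy : A.1 = {x, y} := (Finset.eq_of_subset_of_card_le
      (by intro w hw; simp only [Finset.mem_insert, Finset.mem_singleton] at hw
          rcases hw with rfl | rfl <;> assumption)
      (by rw [hc, Finset.card_pair hxy.ne])).symm
    refine ⟨⟨{x, y, z}, Or.inr hT.card_eq⟩, mem_domSet.2 (Or.inr hT), ?_⟩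
    rw [layerGraph_adj]
    refine Or.inl ⟨hc, hT.card_eq, ?_⟩
    rw [hAxy]
    intro w hw
    simp only [Finset.mem_insert, Finset.mem_singleton] at hw ⊢
    tauto
  · have h1 : ¬ G.IsClique (A.1 : Set (Fin n)) := fun h => hA.2 ⟨h, hc⟩
    rw [SimpleGraph.isClique_iff, Set.Pairwise] at h1
    push Not at h1
    obtain ⟨x, hx, y, hy, hne, hxy⟩ := h1
    refine ⟨⟨{x, y}, Or.inl (Finset.card_pair hne)⟩, mem_domSet.2 (Or.inl
      ⟨Finset.card_pair hne, ?_⟩), ?_⟩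
    · intro a ha b hb
      simp only [Finset.mem_insert, Finset.mem_singleton] at ha hb
      rcases ha with rfl | rfl <;> rcases hb with rfl | rfl
      · exact G.irrefl
      · exact hxy
      · exact fun h => hxy h.symm
      · exact G.irrefl
    · rw [layerGraph_adj]
      refine Or.inr ⟨Finset.card_pair hne, hc, ?_⟩
      intro w hw
      simp only [Finset.mem_insert, Finset.mem_singleton] at hw
      rcases hw with rfl | rfl <;> assumption

lemma not_adj_domSet {A B : LayerVertex n 3 2} (hA : A ∈ domSet G) (hB : B ∈ domSet G)
    (hAc : A.1.card = 2) (hBc : B.1.card = 3) : ¬ A.1 ⊆ B.1 := by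
  intro h
  rw [mem_domSet] at hA hB
  rcases hA with hA | hA
  · rcases hB with hB | hB
    · omega
    · obtain ⟨x, y, hxy, hAxy⟩ := Finset.card_eq_two.1 hAc
      have hx : x ∈ A.1 := by simp [hAxy]
      have hy : y ∈ A.1 := by simp [hAxy]
      exact hA.2 x hx y hy (hB.isClique (h hx) (h hy) hxy)
  · have := hA.card_eq
    omega

lemma isIndepSet_domSet :
    (layerGraph n 3 2).IsIndepSet (domSet G : Set (LayerVertex n 3 2)) := by
  intro A hA B hB _ h
  rw [layerGraph_adj] at h
  rcases h with ⟨h1, h2, h3⟩ | ⟨h1, h2, h3⟩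
  · exact not_adj_domSet hA hB h1 h2 h3
  · exact not_adj_domSet hB hA h1 h2 h3

lemma card_domSet (h0 : bareSum G = 0) :
    12 * ((n.choose 2 : ℤ) - (domSet G).card) = excess G := by
  classical
  have hadj : ∀ x y, G.Adj x y ↔ x ≠ y ∧ ({x, y} : Finset (Fin n)) ∉ level (domSet G) 2 := by
    intro x y
    constructor
    · intro h
      refine ⟨h.ne, fun hc => ?_⟩
      obtain ⟨⟨h1, h2⟩, h3⟩ := mem_level.1 hc
      rw [mem_domSet] at h2
      rcases h2 with h2 | h2
      · exact h2.2 x (by simp) y (by simp) h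
      · have := h2.card_eq
        simp only at this
        omega
    · rintro ⟨hne, h⟩
      by_contra hxy
      refine h (mem_level.2 ⟨⟨Or.inl (Finset.card_pair hne), mem_domSet.2 (Or.inl
        ⟨Finset.card_pair hne, ?_⟩)⟩, Finset.card_pair hne⟩)
      intro a ha b hb
      simp only [Finset.mem_insert, Finset.mem_singleton] at ha hb
      rcases ha with rfl | rfl <;> rcases hb with rfl | rfl
      · exact G.irrefl
      · exact hxy
      · exact fun h => hxy h.symm
      · exact G.irrefl
  have h1 := sum_adjInd_of_compl (level (domSet G) 2) (fun s hs => (mem_level.1 hs).2) hadj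
  have h3 := sum_adjInd_mul_cod_eq_card G
  have h4 : G.cliqueFinset 3 = level (domSet G) 3 := by
    ext X
    rw [SimpleGraph.mem_cliqueFinset_iff, mem_level]
    constructor
    · intro h
      exact ⟨⟨Or.inr h.card_eq, mem_domSet.2 (Or.inr h)⟩, h.card_eq⟩
    · rintro ⟨⟨h1, h2⟩, h3⟩
      rw [mem_domSet] at h2
      rcases h2 with h2 | h2
      · have := h2.1
        simp only at this
        omega
      · exact h2
  have h6 := card_eq_level (domSet G)
  unfold excess
  rw [h1, h3, h4]
  change _ = _ - 3 * bareSum G - _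
  rw [h0]
  push_cast [h6]
  ring

end Construction
end Translation
end LayerDomination

namespace LayerDomination

/-! ### Extremal examples and the final assembly -/

section Model

set_option linter.unusedSectionVars false

/-- The join of a perfect matching with `m` edges and `N` independent vertices. -/
def model (m N : ℕ) : SimpleGraph ((Fin m × Bool) ⊕ Fin N) where
  Adj
    | Sum.inl p, Sum.inl q => p.1 = q.1 ∧ p.2 ≠ q.2
    | Sum.inl _, Sum.inr _ => True
    | Sum.inr _, Sum.inl _ => True
    | Sum.inr _, Sum.inr _ => False
  symm := ⟨by
    rintro (p | p) (q | q) h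
    · exact ⟨h.1.symm, h.2.symm⟩
    · trivial
    · trivial
    · exact h⟩
  loopless := ⟨by
    rintro (p | p) h
    · exact h.2 rfl
    · exact h⟩

variable {m N : ℕ}

lemma adjInd_model_inl_inl (p q : Fin m × Bool) :
    adjInd (model m N) (Sum.inl p) (Sum.inl q) = if q = (p.1, !p.2) then 1 else 0 := by
  classical
  unfold adjInd
  refine if_congr ?_ rfl rfl
  obtain ⟨i, b⟩ := p
  obtain ⟨j, c⟩ := q
  change (i = j ∧ b ≠ c) ↔ _
  rw [Prod.mk.injEq]
  cases b <;> cases c <;> simp [eq_comm]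

lemma adjInd_model_inl_inr (p : Fin m × Bool) (q : Fin N) :
    adjInd (model m N) (Sum.inl p) (Sum.inr q) = 1 := adjInd_of_adj trivial

lemma adjInd_model_inr_inl (p : Fin m × Bool) (q : Fin N) :
    adjInd (model m N) (Sum.inr q) (Sum.inl p) = 1 := adjInd_of_adj trivial

lemma adjInd_model_inr_inr (p q : Fin N) :
    adjInd (model m N) (Sum.inr p) (Sum.inr q) = 0 := adjInd_of_not_adj fun h => h

lemma cod_model_inl_inl (p : Fin m × Bool) :
    cod (model m N) (Sum.inl p) (Sum.inl (p.1, !p.2)) = N := by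
  obtain ⟨i, b⟩ := p
  simp [cod, adjInd_model_inl_inl, adjInd_model_inl_inr]

lemma cod_model_inl_inr (p : Fin m × Bool) (q : Fin N) :
    cod (model m N) (Sum.inl p) (Sum.inr q) = 1 := by
  simp [cod, adjInd_model_inl_inl, adjInd_model_inl_inr, adjInd_model_inr_inl,
    adjInd_model_inr_inr]

lemma bareSum_model (hN : 1 ≤ N) : bareSum (model m N) = 0 := by
  refine Finset.sum_eq_zero fun x _ => Finset.sum_eq_zero fun y _ => if_neg ?_
  rintro ⟨h, h0⟩
  rcases x with p | p <;> rcases y with q | q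
  · have h1 := adjInd_of_adj h
    rw [adjInd_model_inl_inl] at h1
    split_ifs at h1 with h2
    · rw [h2, cod_model_inl_inl] at h0
      omega
    · omega
  · rw [cod_model_inl_inr] at h0
    omega
  · rw [cod_comm, cod_model_inl_inr] at h0
    omega
  · exact h

lemma excess_model (hN : 1 ≤ N) : excess (model m N) = 12 * (m * (N + 1)) := by
  have h0 := bareSum_model (m := m) hN
  have hE : ∑ x, ∑ y, adjInd (model m N) x y = 2 * m * (N + 1) + N * (2 * m) := by
    simp [Fintype.sum_sum_type, adjInd_model_inl_inl, adjInd_model_inl_inr, adjInd_model_inr_inl,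
      adjInd_model_inr_inr]
    ring
  have hT : ∑ x, ∑ y, adjInd (model m N) x y * cod (model m N) x y = 6 * m * N := by
    simp [Fintype.sum_sum_type, adjInd_model_inl_inl, adjInd_model_inl_inr, adjInd_model_inr_inl,
      adjInd_model_inr_inr, cod_model_inl_inl, cod_model_inl_inr,
      cod_comm (G := model m N) (Sum.inr _) (Sum.inl _)]
    ring
  unfold excess
  rw [hE, hT]
  change _ - 3 * bareSum (model m N) - _ = _
  rw [h0]
  ring

lemma exists_excess_eq_max {n : ℕ} (hn : 3 ≤ n) :
    ∃ G : SimpleGraph (Fin n), bareSum G = 0 ∧ excess G = 12 * ((n + 1) ^ 2 / 8 : ℕ) := by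
  -- The product m(N+1) with 2m + (N+1) = n+1 is largest when 2m and N+1 are as equal as integrality
  -- permits.
  have h1 : ∃ m N : ℕ, 2 * m + N = n ∧ 1 ≤ N ∧ m * (N + 1) = (n + 1) ^ 2 / 8 := by
    obtain ⟨k, hk⟩ : ∃ k, k = n / 4 := ⟨_, rfl⟩
    rcases (by omega : n = 4 * k ∨ n = 4 * k + 1 ∨ n = 4 * k + 1 + 1 ∨ n = 4 * k + 1 + 1 + 1) with
      h | h | h | h <;> subst h
    · exact ⟨k, 2 * k, by ring, by omega, by rw [max_four_mul]; ring⟩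
    · exact ⟨k, 2 * k + 1, by ring, by omega, by rw [max_four_mul_add_one]; ring⟩
    · exact ⟨k + 1, 2 * k, by ring, by omega, by rw [max_four_mul_add_two]; ring⟩
    · exact ⟨k + 1, 2 * k + 1, by ring, by omega, by rw [max_four_mul_add_three]; ring⟩
  obtain ⟨m, N, h1, h2, h3⟩ := h1
  have hc : Fintype.card ((Fin m × Bool) ⊕ Fin N) = n := by simp; omega
  let e := Fintype.equivFinOfCardEq hc
  let φ : (model m N).map e.toEmbedding ≃g model m N := (SimpleGraph.Iso.map e (model m N)).symm
  refine ⟨(model m N).map e.toEmbedding, ?_, ?_⟩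
  · rw [← bareSum_model (m := m) h2, bareSum, bareSum, ← sum_iso φ]
    refine Finset.sum_congr rfl fun x _ => ?_
    rw [← sum_iso φ]
    simp only [bareInd_iso]
  · rw [← excess_iso φ, excess_model h2]
    rw [← h3]
    push_cast
    ring

/-- Ensures that the natural-number subtraction in the main theorem is not truncated. -/
lemma max_le_choose {n : ℕ} (hn : 3 ≤ n) : (n + 1) ^ 2 / 8 ≤ n.choose 2 := by
  rw [Nat.choose_two_right, Nat.div_le_iff_le_mul_add_pred (by norm_num)]
  obtain ⟨k, rfl⟩ : ∃ k, n = k + 3 := ⟨n - 3, by omega⟩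
  have h : 2 ∣ (k + 3) * (k + 3 - 1) := by
    have := Nat.even_mul_succ_self (k + 2)
    rw [mul_comm] at this
    exact this.two_dvd
  obtain ⟨c, hc⟩ := h
  rw [hc, Nat.mul_div_cancel_left _ (by norm_num)]
  have : (k + 3) * (k + 2) = 2 * c := hc
  nlinarith

lemma le_card_of_isDominating {n : ℕ} {D : Finset (LayerVertex n 3 2)}
    (hD : IsDominating (layerGraph n 3 2) D) :
    (n.choose 2 : ℤ) - ((n + 1) ^ 2 / 8 : ℕ) ≤ D.card := by
  have h1 := le_excess_assocGraph hD
  have h2 := excess_le (G := assocGraph D)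
  rw [Fintype.card_fin] at h2
  linarith

lemma excess_assocGraph_eq {n : ℕ} (hn : 3 ≤ n) {D : Finset (LayerVertex n 3 2)}
    (hD : IsDominating (layerGraph n 3 2) D) (hc : D.card = n.choose 2 - (n + 1) ^ 2 / 8) :
    excess (assocGraph D) = 12 * ((n + 1) ^ 2 / 8 : ℕ) := by
  have h1 := le_excess_assocGraph hD
  have h2 := excess_le (G := assocGraph D)
  have h3 := max_le_choose hn
  rw [Fintype.card_fin] at h2
  rw [hc, Nat.cast_sub h3] at h1
  linarith

theorem nonempty_iso_of_one_mod_four {k : ℕ} (hk : 1 ≤ k) {G : SimpleGraph (Fin (4 * k + 1))}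
    (hex : excess G = 12 * ((4 * k + 1 + 1) ^ 2 / 8 : ℕ)) :
    Nonempty (G ≃g h5a) ∨ Nonempty (G ≃g h5b) ∨ Nonempty (G ≃g h9) ∨
      ∃ s : ℕ, (2 * s + 1 = 4 * k + 1 ∨ 2 * s = 4 * k + 1 + 1 ∨ 2 * s = 4 * k + 1 + 3) ∧
        Nonempty (G ≃g kPlus (4 * k + 1) s) := by
  rw [max_four_mul_add_one] at hex
  -- The structural argument needs k ≥ 2; k = 1 is the computation on five vertices, where the two
  -- sporadic graphs occur.
  rcases hk.lt_or_eq with hk | rfl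
  · rcases isKPlus_or_isRook hk (Fintype.card_fin _) (by rw [hex]; push_cast; ring) with
      ⟨A, hA, h1, h2⟩ | hA
    · exact Or.inr (Or.inr (Or.inr ⟨A.card, by omega, hA.nonempty_iso (Fintype.card_fin _)⟩))
    · exact Or.inr (Or.inr (Or.inl hA.nonempty_iso))
  · rcases nonempty_iso_of_five (G := G) (by rw [hex]; norm_num) with h | h | ⟨s, hs, h⟩
    · exact Or.inl h
    · exact Or.inr (Or.inl h)
    · exact Or.inr (Or.inr (Or.inr ⟨s, by omega, h⟩))

end Model
end LayerDomination

theorem theorem2 (n : ℕ) (hn : 3 ≤ n) :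
    (∀ D : Finset (LayerDomination.LayerVertex n 3 2),
      LayerDomination.IsDominating (LayerDomination.layerGraph n 3 2) D →
      D.card = n.choose 2 - (n + 1) ^ 2 / 8 →
        (n % 4 = 0 →
          Nonempty (LayerDomination.assocGraph D ≃g LayerDomination.kPlus n (n / 2))) ∧
        (n % 4 = 1 →
          Nonempty (LayerDomination.assocGraph D ≃g LayerDomination.h5a) ∨
          Nonempty (LayerDomination.assocGraph D ≃g LayerDomination.h5b) ∨
          Nonempty (LayerDomination.assocGraph D ≃g LayerDomination.h9) ∨
          ∃ s : ℕ, (2 * s + 1 = n ∨ 2 * s = n + 1 ∨ 2 * s = n + 3) ∧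
            Nonempty (LayerDomination.assocGraph D ≃g LayerDomination.kPlus n s)) ∧
        (n % 4 = 2 →
          Nonempty (LayerDomination.assocGraph D ≃g LayerDomination.kPlus n ((n + 2) / 2))) ∧
        (n % 4 = 3 →
          Nonempty (LayerDomination.assocGraph D ≃g LayerDomination.kPlus n ((n + 1) / 2)))) ∧
    (∃ D : Finset (LayerDomination.LayerVertex n 3 2),
      LayerDomination.IsDominating (LayerDomination.layerGraph n 3 2) D ∧
      (LayerDomination.layerGraph n 3 2).IsIndepSet (D : Set (LayerDomination.LayerVertex n 3 2)) ∧
      D.card = n.choose 2 - (n + 1) ^ 2 / 8 ∧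
      ∀ D' : Finset (LayerDomination.LayerVertex n 3 2),
        LayerDomination.IsDominating (LayerDomination.layerGraph n 3 2) D' →
        D.card ≤ D'.card) := by
  classical
  have hmax := LayerDomination.max_le_choose hn
  refine ⟨fun D hD hc => ?_, ?_⟩
  · have hex := LayerDomination.excess_assocGraph_eq hn hD hc
    have hcard : Fintype.card (Fin n) = n := Fintype.card_fin n
    have heven : Even n → ∃ A : Finset (Fin n),
        LayerDomination.IsKPlus (LayerDomination.assocGraph D) A ∧ Even A.card ∧
          (2 * A.card = n ∨ 2 * A.card = n + 2) := by
      intro he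
      obtain ⟨-, A, h⟩ := LayerDomination.isKPlus_of_even (G := LayerDomination.assocGraph D)
        (by rwa [hcard]) (by rwa [hcard]) (by rw [hcard]; exact hex)
      rw [hcard] at h
      exact ⟨A, h⟩
    refine ⟨fun h => ?_, fun h => ?_, fun h => ?_, fun h => ?_⟩
    -- Of the two candidate sizes n/2 and (n+2)/2 the parity of |A| selects one; for n ≡ 0 modulo 4
    -- it is n/2.
    · obtain ⟨A, hA, ⟨c, hc⟩, h1⟩ := heven (Nat.even_iff.2 (by omega))
      rw [show n / 2 = A.card by omega]
      exact hA.nonempty_iso hcard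
    · obtain ⟨k, rfl⟩ : ∃ k, n = 4 * k + 1 := ⟨n / 4, by omega⟩
      exact LayerDomination.nonempty_iso_of_one_mod_four (by omega) hex
    · obtain ⟨A, hA, ⟨c, hc⟩, h1⟩ := heven (Nat.even_iff.2 (by omega))
      rw [show (n + 2) / 2 = A.card by omega]
      exact hA.nonempty_iso hcard
    · obtain ⟨A, hA, h1⟩ := LayerDomination.isKPlus_of_three_mod_four
        (G := LayerDomination.assocGraph D) (by rwa [hcard]) (by rw [hcard]; exact hex)
      rw [hcard] at h1
      rw [show (n + 1) / 2 = A.card by omega]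
      exact hA.nonempty_iso hcard
  · obtain ⟨G, h0, hex⟩ := LayerDomination.exists_excess_eq_max hn
    have hc := LayerDomination.card_domSet h0
    rw [hex] at hc
    refine ⟨LayerDomination.domSet G, LayerDomination.isDominating_domSet h0,
      LayerDomination.isIndepSet_domSet, by omega, fun D' hD' => ?_⟩
    have := LayerDomination.le_card_of_isDominating hD'
    omega
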